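/- Let $M$ be a smooth manifold of dimension $2m+2$ with a Lorentzian metric $g$ of signature $(-,+,\dots,+)$, and let $\mathcal N$ be an almost Robinson structure on $(M,g)$: a complex rank-$(m+1)$ subbundle of $T^{\mathbb C}M=TM\otimes\mathbb C$, totally isotropic for the complexified metric $g^{\mathbb C}$, such that $\mathcal N\cap\overline{\mathcal N}$ has rank $1$. Let $\mathcal R=\mathcal N\cap TM$ be the real null line bundle with $\mathcal R^{\mathbb C}=\mathcal N\cap\overline{\mathcal N}$. Assume that $\mathcal R$ is trivial, let $\xi$ be a nowhere vanishing section of $\mathcal R$ and $\xi^*$ a null vector field with $g(\xi,\xi^*)=1$, and put $\mathcal R^*=\mathrm{span}\,\xi^*$, $\mathcal S=(\mathcal R\oplus\mathcal R^*)^\perp$, $\sigma=g(\xi^*,\cdot)$, $\sigma^*=g(\xi,\cdot)$, $T^{1,0}M=\mathcal N\cap\mathcal S^{\mathbb C}$ and $T^{0,1}M=\overline{T^{1,0}M}$. A Witt structure on $TM$ (or on $T^{\mathbb C}M$, with $g^{\mathbb C}$) is a decomposition into subbundles $V_i$ with an involution $i\mapsto i^*$ of the indices such that $V_i\perp V_j$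 for $j\notin\{i,i^*\}$; for $i^*\ne i$, $V_i$ is totally isotropic and $g$ pairs $V_i$ and $V_{i^*}$ (of equal rank) non-degenerately; for $i^*=i$, $V_i$ is anisotropic. A Witt connection is a connection that preserves $g$ (resp. $g^{\mathbb C}$) and every $V_i$. Write $A_k$ for the component of $A$ in $V_k$, $\flat,\sharp$ for the musical isomorphisms and $\mathcal L$ for the Lie derivative. For $X\in\Gamma(V_i)$, $Y\in\Gamma(V_j)$ let $\tau_k(X,Y)=0$ if $i=j$ or $j\neq k$, and, if $i\ne j=k$, $$\tau_k(X,Y)=\tfrac12\bigl((\mathcal L_XY^\flat+\mathcal L_YX^\flat)^\sharp_k-[X,Y]_k-(d(g(X,Y)))^\sharp_k\bigr)\ \text{ if } i=j^*,\qquad \tau_k(X,Y)=\tfrac12\bigl((\mathcal L_XY^\flat)^\sharp_k-[X,Y]_k\bigr)\ \text{ if } i\ne j^*.$$ The canonical Witt connection is the Witt connection whose torsion satisfies, for $X\in\Gamma(V_i)$, $Y\in\Gamma(V_j)$, $$T(X,Y)=-\sum_{k\ne i,j}[X,Y]_k+\tau_j(X,Y)-\tau_i(Y,X).$$ Then $TM=(\mathcal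 R\oplus\mathcal R^*)\oplus\mathcal S$ and $T^{\mathbb C}M=(\mathcal R^{\mathbb C}\oplus(\mathcal R^*)^{\mathbb C})\oplus(T^{1,0}M\oplus T^{0,1}M)$ are Witt structures (with $\mathcal R,\mathcal R^*$ and $T^{1,0}M,T^{0,1}M$ exchanged by $i\mapsto i^*$, and $\mathcal S$ fixed), $g$ is positive definite on $\mathcal S$, and there is a unique real endomorphism $J$ of $TM$ whose complex extension is $\sqrt{-1}$ on $T^{1,0}M$, $-\sqrt{-1}$ on $T^{0,1}M$ and $0$ on $\mathcal R\oplus\mathcal R^*$; it is smooth and $(g|_{\mathcal S},J|_{\mathcal S})$ is an almost Hermitian structure on $\mathcal S$. Put $\omega(X,Y)=g(JX,Y)$. Moreover the canonical Witt connection $\nabla^{\mathbb C}$ of the complex Witt structure exists and is unique, and it restricts to a smooth connection $\nabla$ on $TM$ (the Lichnerowicz connection) such that: 1. $\nabla$ is a Witt connection for $TM=(\mathcal R\oplus\mathcal R^*)\oplus\mathcal S$. 2. $\nabla J=0$ and $\nabla\omega=0$. 3. The torsion of $\nabla$ is given, for $X,Y\in\Gamma(\mathcal S)$, by $$\begin{aligned}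 T(X,Y)&=-\tfrac14N_J(X,Y)-\tfrac14\bigl(d^c\omega+\mathcal M(d^c\omega)\bigr)^\sharp(X,Y)+d\sigma(X,Y)\,\xi+d\sigma^*(X,Y)\,\xi^*,\\ T(\xi,X)&=d\sigma^*(\xi,X)\,\xi^*-\tfrac12(\mathcal L_Xg)(\xi,\xi^*)\,\xi+\tau_{\mathcal S}(\xi,X)+\tfrac14\Bigl[\bigl(\mathcal L_\xi\omega-\mathcal M(\mathcal L_\xi\omega)\bigr)^\sharp(JX)\Bigr]_{\mathcal S},\\ T(\xi^*,X)&=d\sigma(\xi^*,X)\,\xi-\tfrac12(\mathcal L_Xg)(\xi,\xi^*)\,\xi^*+\tau_{\mathcal S}(\xi^*,X)+\tfrac14\Bigl[\bigl(\mathcal L_{\xi^*}\omega-\mathcal M(\mathcal L_{\xi^*}\omega)\bigr)^\sharp(JX)\Bigr]_{\mathcal S},\\ T(\xi,\xi^*)&=-[\xi,\xi^*]_{\mathcal S}, \end{aligned}$$ where $\tau_{\mathcal S}$ is taken for the real Witt structure, $N_J(X,Y)=\bigl([X,Y]-[JX,JY]\bigr)_{\mathcal S}+J[JX,Y]+J[X,JY]$,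 $(d^c\omega)(X,Y,Z)=-(d\omega)(JX,JY,JZ)$, and for a $p$-form $\alpha$, $g(\alpha^\sharp(X_1,\dots,X_{p-1}),X_p)=\alpha(X_1,\dots,X_p)$ and $\mathcal M(\alpha)(X_1,\dots,X_p)=\alpha(JX_1,JX_2,X_3,\dots,X_p)$. Here $d\alpha(X,Y)=X\alpha(Y)-Y\alpha(X)-\alpha([X,Y])$ for a $1$-form $\alpha$, and $d\omega$ is normalized likewise. -/

import Mathlib

open scoped Manifold ContDiff TensorProduct

noncomputable section

namespace WittGeometry

/-! ### Calculus on a bundle with a metric and a bracket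

The tangent bundle (over `ℝ`) and its complexification (over `ℂ`) are treated in parallel.
The record below only collects their concrete operations; it is used for the two instances
`realCalculus` and `complexCalculus` defined further down and for nothing else. -/

/-- The operations on sections of a bundle `W` of `𝕜`-vector spaces over `M`: which sections are
smooth on a given set, the (bilinear) metric, the Lie bracket of sections and the derivative of a
`𝕜`-valued function along a section. -/
structure Calculus (𝕜 : Type*) [Field 𝕜] (M : Type*) (W : M → Type*)
    [∀ x, AddCommGroup (W x)] [∀ x, Module 𝕜 (W x)] where
  SmoothOn : Set M → (Π x, W x) → Prop
  metric : Π x, LinearMap.BilinForm 𝕜 (W x)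
  bracket : (Π x, W x) → (Π x, W x) → Π x, W x
  der : (Π x, W x) → (M → 𝕜) → M → 𝕜

section Generic

variable {𝕜 : Type*} [Field 𝕜] {M : Type*} [TopologicalSpace M] {W : M → Type*}
  [∀ x, AddCommGroup (W x)] [∀ x, Module 𝕜 (W x)]

namespace Calculus

variable (C : Calculus 𝕜 M W)

/-- Globally smooth sections. -/
def Smooth (X : Π x, W x) : Prop := C.SmoothOn Set.univ X

/-- The function `g(X, Y)`. -/
def pair (X Y : Π x, W x) : M → 𝕜 := fun x => C.metric x (X x) (Y x)

/-- `X ∈ Γ(V)`: smooth sections of a family of subspaces. -/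
def IsSection (V : Π x, Submodule 𝕜 (W x)) (X : Π x, W x) : Prop :=
  C.Smooth X ∧ ∀ x, X x ∈ V x

/-- `V` is a smooth subbundle of rank `r`: near every point it has a smooth frame. -/
def IsSubbundle (V : Π x, Submodule 𝕜 (W x)) (r : ℕ) : Prop :=
  ∀ x₀ : M, ∃ U : Set M, IsOpen U ∧ x₀ ∈ U ∧ ∃ s : Fin r → Π x, W x,
    (∀ a, C.SmoothOn U (s a)) ∧
    ∀ x ∈ U, LinearIndependent 𝕜 (fun a => s a x) ∧
      Submodule.span 𝕜 (Set.range fun a => s a x) = V x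

/-- `X♭`, as a function on vector fields. -/
def flat (X : Π x, W x) : (Π x, W x) → M → 𝕜 := fun Z => C.pair X Z

/-- The differential `df`. -/
def d₀ (f : M → 𝕜) : (Π x, W x) → M → 𝕜 := fun Z => C.der Z f

/-- `(dα)(X, Y) = X α(Y) - Y α(X) - α([X, Y])` for a `1`-form `α`. -/
def d₁ (α : (Π x, W x) → M → 𝕜) (X Y : Π x, W x) : M → 𝕜 :=
  C.der X (α Y) - C.der Y (α X) - α (C.bracket X Y)

/-- `(dβ)(X, Y, Z)` for a `2`-form `β`. -/
def d₂ (β : (Π x, W x) → (Π x, W x) → M → 𝕜) (X Y Z : Π x, W x) : M → 𝕜 :=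
  C.der X (β Y Z) - C.der Y (β X Z) + C.der Z (β X Y)
    - β (C.bracket X Y) Z + β (C.bracket X Z) Y - β (C.bracket Y Z) X

/-- Lie derivative of a `1`-form: `(L_X α)(Z) = X α(Z) - α([X, Z])`. -/
def lie₁ (X : Π x, W x) (α : (Π x, W x) → M → 𝕜) : (Π x, W x) → M → 𝕜 :=
  fun Z => C.der X (α Z) - α (C.bracket X Z)

/-- Lie derivative of a `(0,2)`-tensor:
`(L_X b)(Y, Z) = X b(Y, Z) - b([X, Y], Z) - b(Y, [X, Z])`. -/
def lie₂ (X : Π x, W x) (b : (Π x, W x) → (Π x, W x) → M → 𝕜) :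
    (Π x, W x) → (Π x, W x) → M → 𝕜 :=
  fun Y Z => C.der X (b Y Z) - b (C.bracket X Y) Z - b Y (C.bracket X Z)

/-- `α♯`: the smooth section `A` with `g(A, Z) = α(Z)` for every smooth section `Z`. -/
def sharp (α : (Π x, W x) → M → 𝕜) : Π x, W x :=
  Classical.epsilon fun A => C.Smooth A ∧ ∀ Z, C.Smooth Z → C.pair A Z = α Z

/-- The torsion `T(X, Y) = ∇_X Y - ∇_Y X - [X, Y]` of an operator `∇ = nab`
(`nab X Y` is `∇_X Y`). -/
def torsion (nab : (Π x, W x) → (Π x, W x) → Π x, W x) (X Y : Π x, W x) : Π x, W x :=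
  nab X Y - nab Y X - C.bracket X Y

end Calculus

variable {ι : Type*}

open Classical in
/-- For a decomposition `W x = ⨁ i, V i x`, the component `π^k_x : W x → V k x ⊆ W x`,
i.e. the projection onto `V k x` along the sum of the other summands. -/
def component (V : ι → Π x, Submodule 𝕜 (W x)) (k : ι) (x : M) : W x →ₗ[𝕜] W x :=
  if h : IsCompl (V k x) (⨆ (j : ι) (_ : j ≠ k), V j x) then
    Submodule.projection (V k x) (⨆ (j : ι) (_ : j ≠ k), V j x) h
  else 0

variable [DecidableEq ι]

/-- A Witt structure. The indices `i` with `star i = i` label the anisotropic summands `V_q`, the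
pairs `{i, star i}` with `star i ≠ i` label the pairs `V_p, V_{p*}` of totally isotropic
summands in duality. `V i` has rank `r i`. -/
structure IsWittStructure (C : Calculus 𝕜 M W) (star : ι → ι)
    (V : ι → Π x, Submodule 𝕜 (W x)) (r : ι → ℕ) : Prop where
  star_star : ∀ i, star (star i) = i
  subbundle : ∀ i, C.IsSubbundle (V i) (r i)
  rank_star : ∀ i, r (star i) = r i
  direct : ∀ x, DirectSum.IsInternal fun i => V i x
  /-- The blocks `V_q`, `V_p ⊕ V_{p*}` are mutually orthogonal. -/
  orthogonal : ∀ i j, j ≠ i → j ≠ star i → ∀ x, ∀ v ∈ V i x, ∀ w ∈ V j x, C.metric x v w = 0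
  isotropic : ∀ i, star i ≠ i → ∀ x, ∀ v ∈ V i x, ∀ w ∈ V i x, C.metric x v w = 0
  nondegenerate : ∀ i, star i ≠ i → ∀ x, ∀ v ∈ V i x,
    (∀ w ∈ V (star i) x, C.metric x v w = 0) → v = 0
  anisotropic : ∀ i, star i = i → ∀ x, ∀ v ∈ V i x, C.metric x v v = 0 → v = 0

/-- The Witt condition on `∇`: it is metric and preserves every summand. -/
structure IsWittOperator (C : Calculus 𝕜 M W) (V : ι → Π x, Submodule 𝕜 (W x))
    (nab : (Π x, W x) → (Π x, W x) → Π x, W x) : Prop where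
  metric : ∀ X Y Z, C.Smooth X → C.Smooth Y → C.Smooth Z →
    C.der X (C.pair Y Z) = C.pair (nab X Y) Z + C.pair Y (nab X Z)
  preserves : ∀ i X Y, C.Smooth X → C.IsSection (V i) Y → C.IsSection (V i) (nab X Y)

/-- The tensor `τ_k(X, Y)` for `X ∈ Γ(V_i)`, `Y ∈ Γ(V_j)`. -/
def tau (C : Calculus 𝕜 M W) (star : ι → ι) (V : ι → Π x, Submodule 𝕜 (W x))
    (k i j : ι) (X Y : Π x, W x) (x : M) : W x :=
  if i = j ∨ j ≠ k then 0
  else if i = star j then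
    (2⁻¹ : 𝕜) •
      (component V k x (C.sharp (C.lie₁ X (C.flat Y) + C.lie₁ Y (C.flat X)) x)
        - component V k x (C.bracket X Y x)
        - component V k x (C.sharp (C.d₀ (C.pair X Y)) x))
  else
    (2⁻¹ : 𝕜) •
      (component V k x (C.sharp (C.lie₁ X (C.flat Y)) x) - component V k x (C.bracket X Y x))

/-- `∇` has the torsion of the canonical Witt connection: for `X ∈ Γ(V_i)`, `Y ∈ Γ(V_j)`,
`T(X, Y) = -[X, Y]_{(V_{i*} + V_{j*})^⊥} + τ_j(X, Y) - τ_i(Y, X)`, where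
`(V_{i*} + V_{j*})^⊥` is the sum of the `V_k` with `k ≠ i, j`. -/
def HasCanonicalTorsion [Fintype ι] (C : Calculus 𝕜 M W) (star : ι → ι)
    (V : ι → Π x, Submodule 𝕜 (W x)) (nab : (Π x, W x) → (Π x, W x) → Π x, W x) : Prop :=
  ∀ i j X Y, C.IsSection (V i) X → C.IsSection (V j) Y → ∀ x,
    C.torsion nab X Y x =
      - (∑ k ∈ Finset.univ.filter (fun k => k ≠ i ∧ k ≠ j), component V k x (C.bracket X Y x))
        + tau C star V j i j X Y x - tau C star V i j i Y X x

end Generic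

/-! ### The tangent bundle and its complexification -/

section Manifold

variable {E : Type*} [NormedAddCommGroup E] [NormedSpace ℝ E]
  {M : Type*} [TopologicalSpace M] [ChartedSpace E M]

variable (E M) in
/-- A smooth pseudo-Riemannian metric on `M`. -/
structure PseudoMetric [IsManifold 𝓘(ℝ, E) ∞ M] where
  val : Π x : M, TangentSpace 𝓘(ℝ, E) x →L[ℝ] TangentSpace 𝓘(ℝ, E) x →L[ℝ] ℝ
  symm : ∀ x v w, val x v w = val x w v
  nondegenerate : ∀ x v, (∀ w, val x v w = 0) → v = 0
  contMDiff : ContMDiff 𝓘(ℝ, E) (𝓘(ℝ, E).prod 𝓘(ℝ, E →L[ℝ] E →L[ℝ] ℝ)) ∞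
    (fun x : M => Bundle.TotalSpace.mk' (E →L[ℝ] E →L[ℝ] ℝ) x (val x))

/-- Lorentzian signature `(-, +, …, +)`. -/
def PseudoMetric.IsLorentzian [IsManifold 𝓘(ℝ, E) ∞ M] (g : PseudoMetric E M) : Prop :=
  ∀ x, ∃ v, g.val x v v < 0 ∧ ∀ w, g.val x v w = 0 → w ≠ 0 → 0 < g.val x w w

variable (E) in
/-- The complexified tangent space `T^ℂ_x M`. -/
abbrev CTangent (x : M) : Type _ := ℂ ⊗[ℝ] TangentSpace 𝓘(ℝ, E) x

/-- `v ↦ v ⊗ 1`. -/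
def ofReal (x : M) : TangentSpace 𝓘(ℝ, E) x →ₗ[ℝ] CTangent E x :=
  TensorProduct.mk ℝ ℂ (TangentSpace 𝓘(ℝ, E) x) 1

/-- Real part of a complex tangent vector. -/
def rePart (x : M) : CTangent E x →ₗ[ℝ] TangentSpace 𝓘(ℝ, E) x :=
  (TensorProduct.lid ℝ (TangentSpace 𝓘(ℝ, E) x)).toLinearMap ∘ₗ
    Complex.reLm.rTensor (TangentSpace 𝓘(ℝ, E) x)

/-- Imaginary part of a complex tangent vector. -/
def imPart (x : M) : CTangent E x →ₗ[ℝ] TangentSpace 𝓘(ℝ, E) x :=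
  (TensorProduct.lid ℝ (TangentSpace 𝓘(ℝ, E) x)).toLinearMap ∘ₗ
    Complex.imLm.rTensor (TangentSpace 𝓘(ℝ, E) x)

/-- Complex conjugation on `T^ℂ_x M`. -/
def conjTangent (x : M) : CTangent E x →ₛₗ[starRingEnd ℂ] CTangent E x where
  toFun := Complex.conjAe.toLinearMap.rTensor (TangentSpace 𝓘(ℝ, E) x)
  map_add' := map_add _
  map_smul' c z := by
    induction z using TensorProduct.induction_on with
    | zero => simp
    | tmul a v => simp [TensorProduct.smul_tmul']
    | add a b ha hb => simp only [smul_add, map_add, ha, hb]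

/-- The complex conjugate of a complex subspace. -/
def conjSubspace (x : M) (N : Submodule ℂ (CTangent E x)) : Submodule ℂ (CTangent E x) :=
  N.comap (conjTangent x)

variable [IsManifold 𝓘(ℝ, E) ∞ M]

/-- Smoothness on `U` of a vector field. -/
def SmoothFieldOn (U : Set M) (X : Π x : M, TangentSpace 𝓘(ℝ, E) x) : Prop :=
  ContMDiffOn 𝓘(ℝ, E) 𝓘(ℝ, E).tangent ∞
    (fun x => (⟨x, X x⟩ : TangentBundle 𝓘(ℝ, E) M)) U

/-- The complexification of a real vector field. -/
def complexify (X : Π x : M, TangentSpace 𝓘(ℝ, E) x) : Π x : M, CTangent E x :=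
  fun x => ofReal x (X x)

/-- Real part of a complex vector field. -/
def reField (Z : Π x : M, CTangent E x) : Π x : M, TangentSpace 𝓘(ℝ, E) x :=
  fun x => rePart x (Z x)

/-- Imaginary part of a complex vector field. -/
def imField (Z : Π x : M, CTangent E x) : Π x : M, TangentSpace 𝓘(ℝ, E) x :=
  fun x => imPart x (Z x)

/-- The calculus of vector fields on `(M, g)`. -/
def realCalculus (g : PseudoMetric E M) :
    Calculus ℝ M (fun x : M => TangentSpace 𝓘(ℝ, E) x) where
  SmoothOn := SmoothFieldOn
  metric x := (g.val x).toBilinForm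
  bracket X Y := VectorField.mlieBracket 𝓘(ℝ, E) X Y
  der X f := fun x => mvfderiv 𝓘(ℝ, E) f x (X x)

/-- The calculus of complex vector fields on `(M, g)`: metric, bracket and derivative are the
complex-(bi)linear extensions of the real ones. -/
def complexCalculus (g : PseudoMetric E M) :
    Calculus ℂ M (fun x : M => CTangent E x) where
  SmoothOn U Z := SmoothFieldOn U (reField Z) ∧ SmoothFieldOn U (imField Z)
  metric x := LinearMap.BilinForm.baseChange ℂ (g.val x).toBilinForm
  bracket Z Z' :=
    complexify (VectorField.mlieBracket 𝓘(ℝ, E) (reField Z) (reField Z')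
        - VectorField.mlieBracket 𝓘(ℝ, E) (imField Z) (imField Z'))
      + Complex.I • complexify (VectorField.mlieBracket 𝓘(ℝ, E) (reField Z) (imField Z')
        + VectorField.mlieBracket 𝓘(ℝ, E) (imField Z) (reField Z'))
  der Z f := fun x => mvfderiv 𝓘(ℝ, E) f x (reField Z x)
    + Complex.I * mvfderiv 𝓘(ℝ, E) f x (imField Z x)

/-- A connection on the complex vector bundle `T^ℂ M`, extended `ℂ`-linearly to complex
directions: `nab X Y` is `∇_X Y`. -/
structure IsComplexConnection (g : PseudoMetric E M)
    (nab : (Π x : M, CTangent E x) → (Π x : M, CTangent E x) → Π x : M, CTangent E x) :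
    Prop where
  smooth : ∀ X Y, (complexCalculus g).Smooth X → (complexCalculus g).Smooth Y →
    (complexCalculus g).Smooth (nab X Y)
  add_left : ∀ X X' Y, (complexCalculus g).Smooth X → (complexCalculus g).Smooth X' →
    (complexCalculus g).Smooth Y → nab (X + X') Y = nab X Y + nab X' Y
  add_right : ∀ X Y Y', (complexCalculus g).Smooth X → (complexCalculus g).Smooth Y →
    (complexCalculus g).Smooth Y' → nab X (Y + Y') = nab X Y + nab X Y'
  smul_left : ∀ (f : M → ℂ) X Y, ContMDiff 𝓘(ℝ, E) 𝓘(ℝ, ℂ) ∞ f →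
    (complexCalculus g).Smooth X → (complexCalculus g).Smooth Y →
    nab (fun x => f x • X x) Y = fun x => f x • nab X Y x
  leibniz : ∀ (f : M → ℂ) X Y, ContMDiff 𝓘(ℝ, E) 𝓘(ℝ, ℂ) ∞ f →
    (complexCalculus g).Smooth X → (complexCalculus g).Smooth Y →
    nab X (fun x => f x • Y x) =
      fun x => f x • nab X Y x + (complexCalculus g).der X f x • Y x

/-- The operator `(X, Y) ↦ ∇_X Y` of a connection on `TM`. -/
def covOperator
    (cov : CovariantDerivative 𝓘(ℝ, E) E (fun x : M => TangentSpace 𝓘(ℝ, E) x))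
    (X Y : Π x : M, TangentSpace 𝓘(ℝ, E) x) : Π x : M, TangentSpace 𝓘(ℝ, E) x :=
  fun x => cov Y x (X x)

/-! ### Almost Robinson structures -/

/-- An almost Robinson structure on a Lorentzian manifold of dimension `2 * m + 2`: a complex
subbundle `N` of `T^ℂ M` of rank `m + 1`, totally isotropic, such that `N ∩ N̄` has rank `1`. -/
structure IsAlmostRobinson (m : ℕ) (g : PseudoMetric E M)
    (N : Π x : M, Submodule ℂ (CTangent E x)) : Prop where
  dim : Module.finrank ℝ E = 2 * m + 2
  lorentzian : g.IsLorentzian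
  subbundle : (complexCalculus g).IsSubbundle N (m + 1)
  isotropic : ∀ x, ∀ z ∈ N x, ∀ w ∈ N x, (complexCalculus g).metric x z w = 0
  rank_inter : ∀ x, Module.finrank ℂ (N x ⊓ conjSubspace x (N x) : Submodule ℂ (CTangent E x)) = 1

/-- The null line bundle `R = N ∩ TM`, with `R^ℂ = N ∩ N̄`. -/
def nullLine (N : Π x : M, Submodule ℂ (CTangent E x)) (x : M) :
    Submodule ℝ (TangentSpace 𝓘(ℝ, E) x) :=
  ((N x).restrictScalars ℝ).comap (ofReal x)

/-- `ξ` is a section of `R` and `ξ'` (written `ξ*` on paper) a null vector field with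
`g(ξ, ξ') = 1`; then `R* = span ξ'` is a null line bundle with `TM = R* ⊕ R^⊥`. -/
structure IsNullFrame (g : PseudoMetric E M) (N : Π x : M, Submodule ℂ (CTangent E x))
    (ξ ξ' : Π x : M, TangentSpace 𝓘(ℝ, E) x) : Prop where
  smooth : (realCalculus g).Smooth ξ
  smooth' : (realCalculus g).Smooth ξ'
  mem : ∀ x, ξ x ∈ nullLine N x
  null' : ∀ x, g.val x (ξ' x) (ξ' x) = 0
  dual : ∀ x, g.val x (ξ x) (ξ' x) = 1

/-- The line bundle `R*`. -/
def dualLine (ξ' : Π x : M, TangentSpace 𝓘(ℝ, E) x) (x : M) :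
    Submodule ℝ (TangentSpace 𝓘(ℝ, E) x) :=
  Submodule.span ℝ {ξ' x}

/-- The screen bundle `S = (R ⊕ R*)^⊥`. -/
def screen (g : PseudoMetric E M) (N : Π x : M, Submodule ℂ (CTangent E x))
    (ξ' : Π x : M, TangentSpace 𝓘(ℝ, E) x) (x : M) : Submodule ℝ (TangentSpace 𝓘(ℝ, E) x) :=
  (g.val x).toBilinForm.orthogonal (nullLine N x ⊔ dualLine ξ' x)

/-- Indices of the real Witt structure `TM = (R ⊕ R*) ⊕ S`. -/
inductive RealIndex
  | R
  | Rdual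
  | S
  deriving DecidableEq

/-- The involution of indices for `TM = (R ⊕ R*) ⊕ S`. -/
def RealIndex.star : RealIndex → RealIndex
  | .R => .Rdual
  | .Rdual => .R
  | .S => .S

/-- The ranks of `R`, `R*`, `S`. -/
def RealIndex.rank (m : ℕ) : RealIndex → ℕ
  | .R => 1
  | .Rdual => 1
  | .S => 2 * m

/-- Indices of the complex Witt structure
`T^ℂ M = (R^ℂ ⊕ (R*)^ℂ) ⊕ (T^{1,0} M ⊕ T^{0,1} M)`. -/
inductive ComplexIndex
  | R
  | Rdual
  | T10
  | T01
  deriving DecidableEq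

instance : Fintype ComplexIndex where
  elems := {.R, .Rdual, .T10, .T01}
  complete i := by cases i <;> simp

/-- The involution of indices for the complex Witt structure. -/
def ComplexIndex.star : ComplexIndex → ComplexIndex
  | .R => .Rdual
  | .Rdual => .R
  | .T10 => .T01
  | .T01 => .T10

/-- The ranks of `R^ℂ`, `(R*)^ℂ`, `T^{1,0} M`, `T^{0,1} M`. -/
def ComplexIndex.rank (m : ℕ) : ComplexIndex → ℕ
  | .R => 1
  | .Rdual => 1
  | .T10 => m
  | .T01 => m

/-- The real Witt structure `TM = (R ⊕ R*) ⊕ S`. -/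
def realWitt (g : PseudoMetric E M) (N : Π x : M, Submodule ℂ (CTangent E x))
    (ξ' : Π x : M, TangentSpace 𝓘(ℝ, E) x) :
    RealIndex → Π x : M, Submodule ℝ (TangentSpace 𝓘(ℝ, E) x)
  | .R => nullLine N
  | .Rdual => dualLine ξ'
  | .S => screen g N ξ'

/-- `T^{1,0} M = N ∩ S^ℂ`, so that `N = R^ℂ ⊕ T^{1,0} M`. -/
def tangent10 (g : PseudoMetric E M) (N : Π x : M, Submodule ℂ (CTangent E x))
    (ξ' : Π x : M, TangentSpace 𝓘(ℝ, E) x) (x : M) : Submodule ℂ (CTangent E x) :=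
  N x ⊓ (screen g N ξ' x).baseChange ℂ

/-- The complex Witt structure `T^ℂ M = (R^ℂ ⊕ (R*)^ℂ) ⊕ (T^{1,0} M ⊕ T^{0,1} M)`. -/
def complexWitt (g : PseudoMetric E M) (N : Π x : M, Submodule ℂ (CTangent E x))
    (ξ' : Π x : M, TangentSpace 𝓘(ℝ, E) x) :
    ComplexIndex → Π x : M, Submodule ℂ (CTangent E x)
  | .R => fun x => (nullLine N x).baseChange ℂ
  | .Rdual => fun x => (dualLine ξ' x).baseChange ℂ
  | .T10 => tangent10 g N ξ'
  | .T01 => fun x => conjSubspace x (tangent10 g N ξ' x)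

/-- The endomorphism `J` of `TM` whose complex-linear extension is `i` on `T^{1,0} M`, `-i` on
`T^{0,1} M` and `0` on `R ⊕ R*`. -/
def screenJ (g : PseudoMetric E M) (N : Π x : M, Submodule ℂ (CTangent E x))
    (ξ' : Π x : M, TangentSpace 𝓘(ℝ, E) x) (x : M) :
    TangentSpace 𝓘(ℝ, E) x →ₗ[ℝ] TangentSpace 𝓘(ℝ, E) x :=
  rePart x ∘ₗ
    (Complex.I • component (complexWitt g N ξ') .T10 x
      - Complex.I • component (complexWitt g N ξ') .T01 x).restrictScalars ℝ ∘ₗ ofReal x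

/-- `J` acting on vector fields. -/
def fieldJ (g : PseudoMetric E M) (N : Π x : M, Submodule ℂ (CTangent E x))
    (ξ' X : Π x : M, TangentSpace 𝓘(ℝ, E) x) : Π x : M, TangentSpace 𝓘(ℝ, E) x :=
  fun x => screenJ g N ξ' x (X x)

/-- The `2`-form `ω(X, Y) = g(JX, Y)`. -/
def omega (g : PseudoMetric E M) (N : Π x : M, Submodule ℂ (CTangent E x))
    (ξ' X Y : Π x : M, TangentSpace 𝓘(ℝ, E) x) : M → ℝ :=
  (realCalculus g).pair (fieldJ g N ξ' X) Y

/-- The component `X_S` of a vector field along the screen bundle. -/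
def screenPart (g : PseudoMetric E M) (N : Π x : M, Submodule ℂ (CTangent E x))
    (ξ' X : Π x : M, TangentSpace 𝓘(ℝ, E) x) : Π x : M, TangentSpace 𝓘(ℝ, E) x :=
  fun x => component (realWitt g N ξ') .S x (X x)

/-- The Nijenhuis tensor of `J` on the screen bundle,
`N_J(X, Y) = ([X, Y] - [JX, JY])_S + J[JX, Y] + J[X, JY]` for `X, Y ∈ Γ(S)`. -/
def nijenhuis (g : PseudoMetric E M) (N : Π x : M, Submodule ℂ (CTangent E x))
    (ξ' X Y : Π x : M, TangentSpace 𝓘(ℝ, E) x) : Π x : M, TangentSpace 𝓘(ℝ, E) x :=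
  screenPart g N ξ' ((realCalculus g).bracket X Y
      - (realCalculus g).bracket (fieldJ g N ξ' X) (fieldJ g N ξ' Y))
    + fieldJ g N ξ' ((realCalculus g).bracket (fieldJ g N ξ' X) Y)
    + fieldJ g N ξ' ((realCalculus g).bracket X (fieldJ g N ξ' Y))

/-- `(d^c ω)(X, Y, Z) = -(dω)(JX, JY, JZ)`. -/
def dcOmega (g : PseudoMetric E M) (N : Π x : M, Submodule ℂ (CTangent E x))
    (ξ' X Y Z : Π x : M, TangentSpace 𝓘(ℝ, E) x) : M → ℝ :=
  - (realCalculus g).d₂ (omega g N ξ') (fieldJ g N ξ' X) (fieldJ g N ξ' Y) (fieldJ g N ξ' Z)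

/-- `M(α)(X, Y) = α(JX, JY)` for a `2`-form `α`. -/
def twist₂ (g : PseudoMetric E M) (N : Π x : M, Submodule ℂ (CTangent E x))
    (ξ' : Π x : M, TangentSpace 𝓘(ℝ, E) x)
    (α : (Π x : M, TangentSpace 𝓘(ℝ, E) x) → (Π x : M, TangentSpace 𝓘(ℝ, E) x) → M → ℝ)
    (X Y : Π x : M, TangentSpace 𝓘(ℝ, E) x) : M → ℝ :=
  α (fieldJ g N ξ' X) (fieldJ g N ξ' Y)

/-- `M(α)(X, Y, Z) = α(JX, JY, Z)` for a `3`-form `α`. -/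
def twist₃ (g : PseudoMetric E M) (N : Π x : M, Submodule ℂ (CTangent E x))
    (ξ' : Π x : M, TangentSpace 𝓘(ℝ, E) x)
    (α : (Π x : M, TangentSpace 𝓘(ℝ, E) x) → (Π x : M, TangentSpace 𝓘(ℝ, E) x) →
      (Π x : M, TangentSpace 𝓘(ℝ, E) x) → M → ℝ)
    (X Y Z : Π x : M, TangentSpace 𝓘(ℝ, E) x) : M → ℝ :=
  α (fieldJ g N ξ' X) (fieldJ g N ξ' Y) Z

/-- `J` is smooth, `T^{1,0} M` and `T^{0,1} M` are the `±i`-eigenbundles of its complex-linear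
extension, it vanishes on `R ⊕ R*`, and `(g, J)` is Hermitian on `S` (with `g` positive definite
there). -/
structure IsScreenHermitian (g : PseudoMetric E M) (N : Π x : M, Submodule ℂ (CTangent E x))
    (ξ ξ' : Π x : M, TangentSpace 𝓘(ℝ, E) x) : Prop where
  smooth : ∀ X, (realCalculus g).Smooth X → (realCalculus g).Smooth (fieldJ g N ξ' X)
  eigen10 : ∀ x z, z ∈ complexWitt g N ξ' .T10 x ↔
    (screenJ g N ξ' x).baseChange ℂ z = Complex.I • z
  eigen01 : ∀ x z, z ∈ complexWitt g N ξ' .T01 x ↔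
    (screenJ g N ξ' x).baseChange ℂ z = -Complex.I • z
  map_R : ∀ x, screenJ g N ξ' x (ξ x) = 0
  map_Rdual : ∀ x, screenJ g N ξ' x (ξ' x) = 0
  map_S : ∀ x, ∀ v ∈ screen g N ξ' x, screenJ g N ξ' x v ∈ screen g N ξ' x
  sq : ∀ x, ∀ v ∈ screen g N ξ' x, screenJ g N ξ' x (screenJ g N ξ' x v) = -v
  isometry : ∀ x, ∀ v ∈ screen g N ξ' x, ∀ w ∈ screen g N ξ' x,
    g.val x (screenJ g N ξ' x v) (screenJ g N ξ' x w) = g.val x v w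
  positive : ∀ x, ∀ v ∈ screen g N ξ' x, v ≠ 0 → 0 < g.val x v v

/-- The canonical Witt connection of `T^ℂ M = (R^ℂ ⊕ (R*)^ℂ) ⊕ (T^{1,0} M ⊕ T^{0,1} M)`. -/
structure IsCanonicalComplexWitt (g : PseudoMetric E M)
    (N : Π x : M, Submodule ℂ (CTangent E x)) (ξ' : Π x : M, TangentSpace 𝓘(ℝ, E) x)
    (nab : (Π x : M, CTangent E x) → (Π x : M, CTangent E x) → Π x : M, CTangent E x) :
    Prop where
  connection : IsComplexConnection g nab
  witt : IsWittOperator (complexCalculus g) (complexWitt g N ξ') nab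
  torsion : HasCanonicalTorsion (complexCalculus g) ComplexIndex.star (complexWitt g N ξ') nab

/-- The formulas for the torsion `T` of the Lichnerowicz connection, where `σ = ξ'♭` and
`σ' = ξ♭` (on paper `σ = (ξ*)♭` and `σ* = ξ♭`). -/
structure HasLichnerowiczTorsion (g : PseudoMetric E M)
    (N : Π x : M, Submodule ℂ (CTangent E x)) (ξ ξ' : Π x : M, TangentSpace 𝓘(ℝ, E) x)
    (T : Π x : M, TangentSpace 𝓘(ℝ, E) x →L[ℝ] TangentSpace 𝓘(ℝ, E) x →L[ℝ]
      TangentSpace 𝓘(ℝ, E) x) : Prop where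
  screen_screen : ∀ X Y, (realCalculus g).IsSection (screen g N ξ') X →
    (realCalculus g).IsSection (screen g N ξ') Y → ∀ x,
    T x (X x) (Y x) =
      - (1 / 4 : ℝ) • nijenhuis g N ξ' X Y x
      - (1 / 4 : ℝ) • (realCalculus g).sharp
          (fun Z => dcOmega g N ξ' X Y Z + twist₃ g N ξ' (dcOmega g N ξ') X Y Z) x
      + (realCalculus g).d₁ ((realCalculus g).flat ξ') X Y x • ξ x
      + (realCalculus g).d₁ ((realCalculus g).flat ξ) X Y x • ξ' x
  null_screen : ∀ X, (realCalculus g).IsSection (screen g N ξ') X → ∀ x,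
    T x (ξ x) (X x) =
      (realCalculus g).d₁ ((realCalculus g).flat ξ) ξ X x • ξ' x
      - (1 / 2 : ℝ) • (realCalculus g).lie₂ X (realCalculus g).pair ξ ξ' x • ξ x
      + tau (realCalculus g) RealIndex.star (realWitt g N ξ') .S .R .S ξ X x
      + (1 / 4 : ℝ) • screenPart g N ξ' ((realCalculus g).sharp
          (fun Z => (realCalculus g).lie₂ ξ (omega g N ξ') (fieldJ g N ξ' X) Z
            - twist₂ g N ξ' ((realCalculus g).lie₂ ξ (omega g N ξ')) (fieldJ g N ξ' X) Z)) x
  dual_screen : ∀ X, (realCalculus g).IsSection (screen g N ξ') X → ∀ x,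
    T x (ξ' x) (X x) =
      (realCalculus g).d₁ ((realCalculus g).flat ξ') ξ' X x • ξ x
      - (1 / 2 : ℝ) • (realCalculus g).lie₂ X (realCalculus g).pair ξ ξ' x • ξ' x
      + tau (realCalculus g) RealIndex.star (realWitt g N ξ') .S .Rdual .S ξ' X x
      + (1 / 4 : ℝ) • screenPart g N ξ' ((realCalculus g).sharp
          (fun Z => (realCalculus g).lie₂ ξ' (omega g N ξ') (fieldJ g N ξ' X) Z
            - twist₂ g N ξ' ((realCalculus g).lie₂ ξ' (omega g N ξ')) (fieldJ g N ξ' X) Z)) x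
  null_dual : ∀ x, T x (ξ x) (ξ' x) =
    - screenPart g N ξ' ((realCalculus g).bracket ξ ξ') x

end Manifold

end WittGeometry

end

open WittGeometry

open scoped Manifold ContDiff TensorProduct

open WittGeometry

noncomputable section

set_option linter.unusedSectionVars false

/-! The tangent bundle over ℝ and its complexification over ℂ obey the same rules: cutoffs, local
frames, a nondegenerate symmetric metric, a derivation and a bracket with its Leibniz rule.
`Calculus.IsLawful` records these rules, and the connection is constructed from them once for both
fields.

The connection is given by one explicit formula. Let K(X,Y,Z) be the right hand side of the Koszul
formula, and let Y_R, Y_{R*}, Y_S be the components of Y. Then `lichForm` sets 4 g(∇_X Y, Z) =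
2K(X,Y_R,Z_{R*}) + 2K(X,Y_{R*},Z_R) + K(X,Y_S,Z_S) + K(X,JY,JZ), where every K, with projected
arguments Y', Z', is corrected by g([Y',Z'],T), T being the part of X in the block (null plane or
screen) that does not contain Y', Z'. K is tensorial in Z, satisfies a Leibniz rule in Y, and
K(X,Y,Z)+K(X,Z,Y) = 2 X g(Y,Z). The correction does no harm because T is orthogonal to Y', Z', and
the weights are right by `pair_decomp`. Hence ∇ is a metric connection. It commutes with the
projections and, thanks to the last term, with J (`lich_line`, `lich_screen`, `lich_J`). So it is a
Witt connection with J and ω parallel, over either field.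

Why it is canonical: for a Witt connection and X in V_i, Y in V_j with i ≠ j, the V_j-component of
T(X,Y) is ∇_X Y - [X,Y]_j. The prescribed torsion therefore says ∇_X Y = [X,Y]_j + τ_j(X,Y) for all
mixed pairs. No index of the complex structure is fixed by the involution, so metricity tested on
V_{i*} reduces derivatives inside V_i to mixed ones. This gives uniqueness
(`IsCanonicalComplexWitt.unique`). For existence, the J-average doubles the pairing of T^{1,0} with
T^{0,1}, and the formula becomes 2 g(∇_X Y, Z) = K(X,Y,Z), plus g([Y,Z],X) when X lies in the other
block (`two_pair_complexLich`). Written out, this is the definition of τ.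

Reality: J commutes with conjugation, so it comes from a real endomorphism. All ingredients of the
formula are complexifications of real ones, hence so is the connection (`complexLich_complexify`).
The torsion formulas follow by pairing with ξ, ξ' and screen sections and expanding the Koszul
terms. What remains is the pointwise algebra of the decompositions, with positivity on S from the
signature, and the passage from an operator on smooth fields to a `CovariantDerivative` by local
frames. -/

namespace WittGeometry


/-! ### Consequences of the rules: frames, tensoriality, duality, subbundles. -/

section Lawful

variable {𝕜 : Type*} [Field 𝕜] {M : Type*} [TopologicalSpace M] {W : M → Type*}
  [∀ x, AddCommGroup (W x)] [∀ x, Module 𝕜 (W x)]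

/-- The rules obeyed by the calculus of sections of the tangent bundle and of its
complexification; `F U f` says that the function `f` is smooth on `U`. -/
structure Calculus.IsLawful (C : Calculus 𝕜 M W) (F : Set M → (M → 𝕜) → Prop) : Prop where
  fun_const : ∀ U c, F U (fun _ => c)
  fun_add : ∀ {U f h}, F U f → F U h → F U (f + h)
  fun_mul : ∀ {U f h}, F U f → F U h → F U (f * h)
  fun_inv : ∀ {U f}, F U f → (∀ x ∈ U, f x ≠ 0) → F U (f⁻¹)
  fun_mono : ∀ {U V f}, V ⊆ U → F U f → F V f
  fun_congr : ∀ {U f h}, F U f → (∀ x ∈ U, h x = f x) → F U h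
  fun_ne : ∀ {U f x}, F U f → IsOpen U → x ∈ U → f x ≠ 0 →
    ∃ V, IsOpen V ∧ x ∈ V ∧ V ⊆ U ∧ ∀ y ∈ V, f y ≠ 0
  sec_zero : ∀ U, C.SmoothOn U (fun _ => 0)
  sec_add : ∀ {U X Y}, C.SmoothOn U X → C.SmoothOn U Y → C.SmoothOn U (fun x => X x + Y x)
  sec_smul : ∀ {U f X}, F U f → C.SmoothOn U X → C.SmoothOn U (fun x => f x • X x)
  sec_mono : ∀ {U V X}, V ⊆ U → C.SmoothOn U X → C.SmoothOn V X
  sec_congr : ∀ {U X Y}, C.SmoothOn U X → (∀ x ∈ U, Y x = X x) → C.SmoothOn U Y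
  sec_local : ∀ {X}, (∀ x, ∃ U, IsOpen U ∧ x ∈ U ∧ C.SmoothOn U X) → C.Smooth X
  -- The last two clauses turn data smooth on U and arbitrary elsewhere into globally smooth data.
  -- This is how local frames enter operations whose rules hold only for global sections.
  cutoff : ∀ {U : Set M} {x}, IsOpen U → x ∈ U → ∃ χ : M → 𝕜, F Set.univ χ ∧
    (∃ V, IsOpen V ∧ x ∈ V ∧ V ⊆ U ∧ ∀ y ∈ V, χ y = 1) ∧ (∀ y ∉ U, χ y = 0) ∧
    (∀ f, F U f → F Set.univ (χ * f)) ∧ ∀ X, C.SmoothOn U X → C.Smooth (fun y => χ y • X y)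
  frame : ∀ x₀ : M, ∃ n : ℕ, ∃ U : Set M, IsOpen U ∧ x₀ ∈ U ∧ ∃ e : Fin n → Π x, W x,
    (∀ a, C.SmoothOn U (e a)) ∧ ∀ x ∈ U, LinearIndependent 𝕜 (fun a => e a x) ∧
      Submodule.span 𝕜 (Set.range fun a => e a x) = ⊤
  pair_smooth : ∀ {U X Y}, C.SmoothOn U X → C.SmoothOn U Y → F U (C.pair X Y)
  symm : ∀ x v w, C.metric x v w = C.metric x w v
  nondeg : ∀ x v, (∀ w, C.metric x v w = 0) → v = 0
  der_smooth : ∀ {X f}, C.Smooth X → F Set.univ f → F Set.univ (C.der X f)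
  der_add_left : ∀ X Y f, C.der (fun x => X x + Y x) f = C.der X f + C.der Y f
  der_smul_left : ∀ (h : M → 𝕜) X f, C.der (fun x => h x • X x) f = h * C.der X f
  der_add : ∀ X {f h}, F Set.univ f → F Set.univ h → C.der X (f + h) = C.der X f + C.der X h
  der_mul : ∀ X {f h}, F Set.univ f → F Set.univ h →
    C.der X (f * h) = f * C.der X h + h * C.der X f
  der_const : ∀ X c, C.der X (fun _ => c) = 0
  bracket_smooth : ∀ {X Y}, C.Smooth X → C.Smooth Y → C.Smooth (C.bracket X Y)
  bracket_swap : ∀ X Y x, C.bracket X Y x = - C.bracket Y X x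
  bracket_add : ∀ {X Y Z}, C.Smooth X → C.Smooth Y → C.Smooth Z →
    ∀ x, C.bracket X (fun y => Y y + Z y) x = C.bracket X Y x + C.bracket X Z x
  bracket_smul : ∀ {X Y f}, C.Smooth X → C.Smooth Y → F Set.univ f →
    ∀ x, C.bracket X (fun y => f y • Y y) x = f x • C.bracket X Y x + C.der X f x • Y x

/-- A `1`-form: an operation from smooth sections to smooth functions that is linear over
smooth functions. -/
structure Calculus.IsForm (C : Calculus 𝕜 M W) (F : Set M → (M → 𝕜) → Prop)
    (α : (Π x, W x) → M → 𝕜) : Prop where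
  smooth : ∀ {Z}, C.Smooth Z → F Set.univ (α Z)
  add : ∀ {Y Z}, C.Smooth Y → C.Smooth Z → α (fun x => Y x + Z x) = α Y + α Z
  smul : ∀ {f Z}, F Set.univ f → C.Smooth Z → α (fun x => f x • Z x) = f * α Z

namespace Calculus.IsLawful

variable {C : Calculus 𝕜 M W} {F : Set M → (M → 𝕜) → Prop} (L : C.IsLawful F)
include L

theorem fun_neg {U f} (hf : F U f) : F U (-f) :=
  L.fun_congr (L.fun_mul (L.fun_const U (-1)) hf) (by simp)

theorem fun_sub {U f h} (hf : F U f) (hh : F U h) : F U (f - h) := by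
  rw [sub_eq_add_neg]; exact L.fun_add hf (L.fun_neg hh)

theorem fun_sum {κ : Type*} (s : Finset κ) {U : Set M} {f : κ → M → 𝕜} (hf : ∀ a, F U (f a)) :
    F U (fun x => ∑ a ∈ s, f a x) := by
  classical
  induction s using Finset.induction_on with
  | empty => simpa using L.fun_const U 0
  | insert a s ha ih =>
    refine L.fun_congr (L.fun_add (hf a) ih) fun x _ => ?_
    simp [Finset.sum_insert ha]

theorem fun_prod {κ : Type*} (s : Finset κ) {U : Set M} {f : κ → M → 𝕜} (hf : ∀ a, F U (f a)) :
    F U (fun x => ∏ a ∈ s, f a x) := by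
  classical
  induction s using Finset.induction_on with
  | empty => simpa using L.fun_const U 1
  | insert a s ha ih =>
    refine L.fun_congr (L.fun_mul (hf a) ih) fun x _ => ?_
    simp [Finset.prod_insert ha]

/-- Determinants and cofactors are polynomials in the entries; they serve Cramer's rule in
`exists_coeff`. -/
theorem fun_det {κ : Type*} [Fintype κ] [DecidableEq κ] {U : Set M} {G : M → Matrix κ κ 𝕜}
    (hG : ∀ a b, F U (fun x => G x a b)) : F U (fun x => (G x).det) := by
  simp only [Matrix.det_apply']
  refine L.fun_sum _ fun σ => ?_
  exact L.fun_mul (L.fun_const U _) (L.fun_prod _ fun a => hG _ _)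

theorem fun_adjugate {κ : Type*} [Fintype κ] [DecidableEq κ] {U : Set M} {G : M → Matrix κ κ 𝕜}
    (hG : ∀ a b, F U (fun x => G x a b)) (i j : κ) : F U (fun x => (G x).adjugate i j) := by
  simp only [Matrix.adjugate_apply]
  refine L.fun_det fun a b => ?_
  by_cases h : a = j
  · subst h; simpa using L.fun_const U _
  · simpa [Matrix.updateRow_ne h] using hG a b

theorem sec_sum {κ : Type*} (s : Finset κ) {U : Set M} {X : κ → Π x, W x}
    (hX : ∀ a, C.SmoothOn U (X a)) : C.SmoothOn U (fun x => ∑ a ∈ s, X a x) := by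
  classical
  induction s using Finset.induction_on with
  | empty => simpa using L.sec_zero U
  | insert a s ha ih =>
    refine L.sec_congr (L.sec_add (hX a) ih) fun x _ => ?_
    simp [Finset.sum_insert ha]

theorem sec_neg {U X} (hX : C.SmoothOn U X) : C.SmoothOn U (fun x => - X x) :=
  L.sec_congr (L.sec_smul (L.fun_const U (-1)) hX) (by simp)

theorem sec_sub {U X Y} (hX : C.SmoothOn U X) (hY : C.SmoothOn U Y) :
    C.SmoothOn U (fun x => X x - Y x) :=
  L.sec_congr (L.sec_add hX (L.sec_neg hY)) (by simp [sub_eq_add_neg])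

theorem sec_const_smul {U X} (c : 𝕜) (hX : C.SmoothOn U X) : C.SmoothOn U (fun x => c • X x) :=
  L.sec_smul (L.fun_const U c) hX

/-- Coefficients in a local frame are smooth if the products with the frame are. -/
theorem exists_coeff {κ : Type*} [Fintype κ] {U : Set M} {e : κ → Π x, W x}
    (he : ∀ a, C.SmoothOn U (e a))
    (hb : ∀ x ∈ U, LinearIndependent 𝕜 (fun a => e a x) ∧
      Submodule.span 𝕜 (Set.range fun a => e a x) = ⊤)
    (A : Π x, W x) (hA : ∀ a, F U (C.pair A (e a))) :
    ∃ c : κ → M → 𝕜, (∀ a, F U (c a)) ∧ ∀ x ∈ U, A x = ∑ a, c a x • e a x := by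
  classical
  -- The Gram matrix of the frame. A vector in its kernel would give a combination of the frame
  -- orthogonal to the whole frame, hence zero.
  let G : M → Matrix κ κ 𝕜 := fun x => Matrix.of fun a b => C.pair (e a) (e b) x
  have hG : ∀ a b, F U (fun x => G x a b) := fun a b => L.pair_smooth (he a) (he b)
  have perp : ∀ x ∈ U, ∀ v, (∀ b, C.metric x v (e b x) = 0) → v = 0 := by
    intro x hx v hv
    refine L.nondeg x v fun w => ?_
    have hw : w ∈ Submodule.span 𝕜 (Set.range fun a => e a x) := by rw [(hb x hx).2]; trivial
    induction hw using Submodule.span_induction with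
    | mem w hw => obtain ⟨b, rfl⟩ := hw; exact hv b
    | zero => simp
    | add a b _ _ ha hb => simp [ha, hb]
    | smul c a _ ha => simp [ha]
  have hdet : ∀ x ∈ U, (G x).det ≠ 0 := by
    intro x hx h0
    obtain ⟨v, hv0, hv⟩ := Matrix.exists_vecMul_eq_zero_iff.mpr h0
    apply hv0
    have : ∑ a, v a • e a x = 0 := by
      refine perp x hx _ fun b => ?_
      have := congrFun hv b
      simpa [Matrix.vecMul, dotProduct, G, Calculus.pair] using this
    funext a
    exact Fintype.linearIndependent_iff.mp (hb x hx).1 v this a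
  -- The coefficients are the row of products times the inverse Gram matrix, written as adjugate
  -- over determinant so that smoothness is visible.
  refine ⟨fun a x => ∑ b, C.pair A (e b) x * ((G x).det⁻¹ * (G x).adjugate b a),
    fun a => L.fun_sum _ fun b => ?_, fun x hx => ?_⟩
  · exact L.fun_mul (hA b) (L.fun_mul (L.fun_inv (L.fun_det hG) hdet) (L.fun_adjugate hG _ _))
  · rw [← sub_eq_zero]
    refine perp x hx _ fun d => ?_
    have key : (fun b => C.pair A (e b) x) =
        Matrix.vecMul (Matrix.vecMul (fun b => C.pair A (e b) x) (G x)⁻¹) (G x) := by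
      rw [Matrix.vecMul_vecMul, Matrix.nonsing_inv_mul _ (isUnit_iff_ne_zero.mpr (hdet x hx)),
        Matrix.vecMul_one]
    have := congrFun key d
    simp only [Matrix.vecMul, dotProduct, Matrix.inv_def, Ring.inverse_eq_inv',
      Matrix.smul_apply, smul_eq_mul] at this
    simp only [map_sub, map_sum, map_smul, LinearMap.sub_apply, LinearMap.sum_apply,
      LinearMap.smul_apply, smul_eq_mul]
    rw [sub_eq_zero]
    exact this

theorem smoothOn_of_pair_frame {κ : Type*} [Fintype κ] {U : Set M} {e : κ → Π x, W x}
    (he : ∀ a, C.SmoothOn U (e a))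
    (hb : ∀ x ∈ U, LinearIndependent 𝕜 (fun a => e a x) ∧
      Submodule.span 𝕜 (Set.range fun a => e a x) = ⊤)
    (A : Π x, W x) (hA : ∀ a, F U (C.pair A (e a))) : C.SmoothOn U A := by
  obtain ⟨c, hc, h⟩ := L.exists_coeff he hb A hA
  exact L.sec_congr (L.sec_sum _ fun a => L.sec_smul (hc a) (he a)) h

/-- A local section agrees near a point with a global one. -/
theorem globalize {U : Set M} {x₀ : M} (hU : IsOpen U) (hx : x₀ ∈ U) {κ : Type*}
    {X : κ → Π x, W x} (hX : ∀ a, C.SmoothOn U (X a)) :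
    ∃ Y : κ → Π x, W x, (∀ a, C.Smooth (Y a)) ∧
      ∃ V, IsOpen V ∧ x₀ ∈ V ∧ V ⊆ U ∧ ∀ a, ∀ y ∈ V, Y a y = X a y := by
  obtain ⟨χ, -, ⟨V, hV, hxV, hVU, h1⟩, -, -, hs⟩ := L.cutoff hU hx
  exact ⟨fun a y => χ y • X a y, fun a => hs _ (hX a), V, hV, hxV, hVU,
    fun a y hy => by simp [h1 y hy]⟩

theorem exists_extension {x₀ : M} (v : W x₀) : ∃ X, C.Smooth X ∧ X x₀ = v := by
  obtain ⟨n, U, hU, hx, e, he, hb⟩ := L.frame x₀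
  have hv : v ∈ Submodule.span 𝕜 (Set.range fun a => e a x₀) := by rw [(hb x₀ hx).2]; trivial
  obtain ⟨c, rfl⟩ := (Submodule.mem_span_range_iff_exists_fun 𝕜).mp hv
  obtain ⟨Y, hY, V, hV, hxV, -, hYX⟩ := L.globalize hU hx he
  exact ⟨fun x => ∑ a, c a • Y a x, L.sec_sum _ fun a => L.sec_const_smul _ (hY a), by
    simp [hYX _ _ hxV]⟩

theorem finite (x₀ : M) : FiniteDimensional 𝕜 (W x₀) := by
  obtain ⟨n, U, hU, hx, e, he, hb⟩ := L.frame x₀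
  exact ⟨⟨(Set.finite_range fun a => e a x₀).toFinset, by simpa using (hb x₀ hx).2⟩⟩

theorem ext_of_pair {A B : Π x, W x} (h : ∀ Z, C.Smooth Z → C.pair A Z = C.pair B Z) : A = B := by
  funext x
  rw [← sub_eq_zero]
  refine L.nondeg x _ fun w => ?_
  obtain ⟨Z, hZ, rfl⟩ := L.exists_extension w
  have := congrFun (h Z hZ) x
  simp only [Calculus.pair] at this
  simp [this]

/-- A frame exists only locally, while the hypothesis concerns global sections; the frame is
replaced by global sections agreeing with it near the point. -/
theorem smooth_of_pair {A : Π x, W x} (h : ∀ Z, C.Smooth Z → F Set.univ (C.pair A Z)) :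
    C.Smooth A := by
  refine L.sec_local fun x₀ => ?_
  obtain ⟨n, U, hU, hx, e, he, hb⟩ := L.frame x₀
  obtain ⟨Y, hY, V, hV, hxV, hVU, hYX⟩ := L.globalize hU hx he
  refine ⟨V, hV, hxV, L.smoothOn_of_pair_frame (fun a => L.sec_mono (Set.subset_univ V) (hY a))
    (fun x hx => ?_) A fun a => L.fun_mono (Set.subset_univ V) (h _ (hY a))⟩
  simp only [hYX _ _ hx]
  exact hb x (hVU hx)

/-- An operation on smooth sections that is linear over functions at `x₀` only depends on the
value at `x₀`. -/
theorem eq_zero_of_tensorial {Q : Type*} [AddCommGroup Q] [Module 𝕜 Q] {x₀ : M}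
    {α : (Π x, W x) → Q}
    (hadd : ∀ X Y, C.Smooth X → C.Smooth Y → α (fun x => X x + Y x) = α X + α Y)
    (hsmul : ∀ f X, F Set.univ f → C.Smooth X → α (fun x => f x • X x) = f x₀ • α X)
    {Z : Π x, W x} (hZ : C.Smooth Z) (h0 : Z x₀ = 0) : α Z = 0 := by
  classical
  obtain ⟨n, U, hU, hx, e, he, hb⟩ := L.frame x₀
  obtain ⟨χ, hχ, ⟨V, hV, hxV, hVU, h1⟩, hχ0, hχf, hχs⟩ := L.cutoff hU hx
  obtain ⟨c, hc, hcZ⟩ := L.exists_coeff he hb Z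
    fun a => L.pair_smooth (L.sec_mono (Set.subset_univ U) hZ) (he a)
  have hc0 : ∀ a, c a x₀ = 0 := by
    have := hcZ x₀ hx
    rw [h0] at this
    exact Fintype.linearIndependent_iff.mp (hb x₀ hx).1 _ this.symm
  have hαz : α (fun _ => 0) = 0 := by
    have := hsmul (fun _ => 0) Z (L.fun_const _ 0) hZ
    simpa using this
  -- The section χ²Z is a combination of the global sections χ e_a with the global coefficients χ
  -- c_a: one factor χ for the coefficient, one for the frame. Each coefficient vanishes at x₀.
  have hsum : ∀ s : Finset (Fin n),
      α (fun x => ∑ a ∈ s, (χ * c a) x • (χ x • e a x)) = 0 := by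
    intro s
    induction s using Finset.induction_on with
    | empty => simpa using hαz
    | insert a s ha ih =>
      simp only [Finset.sum_insert ha]
      rw [hadd _ _ (L.sec_smul (hχf _ (hc a)) (hχs _ (he a)))
        (L.sec_sum _ fun a => L.sec_smul (hχf _ (hc a)) (hχs _ (he a))), ih,
        hsmul _ _ (hχf _ (hc a)) (hχs _ (he a))]
      simp [hc0]
  have hexp : (fun x => ∑ a, (χ * c a) x • (χ x • e a x)) = fun x => (χ * χ) x • Z x := by
    funext x
    by_cases hxU : x ∈ U
    · rw [hcZ x hxU, Finset.smul_sum]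
      refine Finset.sum_congr rfl fun a _ => ?_
      simp only [Pi.mul_apply, smul_smul]
      ring_nf
    · simp [hχ0 x hxU]
  have := hsum Finset.univ
  rw [hexp, hsmul _ _ (L.fun_mul hχ hχ) hZ] at this
  simpa [h1 x₀ hxV] using this

theorem congr_of_tensorial {Q : Type*} [AddCommGroup Q] [Module 𝕜 Q] {x₀ : M}
    {α : (Π x, W x) → Q}
    (hadd : ∀ X Y, C.Smooth X → C.Smooth Y → α (fun x => X x + Y x) = α X + α Y)
    (hsmul : ∀ f X, F Set.univ f → C.Smooth X → α (fun x => f x • X x) = f x₀ • α X)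
    {Y Z : Π x, W x} (hY : C.Smooth Y) (hZ : C.Smooth Z) (h : Y x₀ = Z x₀) : α Y = α Z := by
  have h1 := hsmul (fun _ => -1) Z (L.fun_const _ _) hZ
  have h2 := hadd Y _ hY (L.sec_const_smul (-1) hZ)
  rw [L.eq_zero_of_tensorial hadd hsmul (L.sec_add hY (L.sec_const_smul (-1) hZ))
    (by simp [h]), h1] at h2
  rw [neg_one_smul, ← sub_eq_add_neg] at h2
  exact (sub_eq_zero.mp h2.symm)

/-- `sharp` is a choice, meaningful only once a representing section exists. Tensoriality makes α a
functional on every fibre, nondegeneracy represents it by a vector, and the products of the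
resulting section are smooth by assumption. -/
theorem sharp_spec {α : (Π x, W x) → M → 𝕜} (hα : C.IsForm F α) :
    C.Smooth (C.sharp α) ∧ ∀ Z, C.Smooth Z → C.pair (C.sharp α) Z = α Z := by
  suffices h : ∃ A, C.Smooth A ∧ ∀ Z, C.Smooth Z → C.pair A Z = α Z from
    Classical.epsilon_spec h
  have hadd : ∀ x X Y, C.Smooth X → C.Smooth Y →
      α (fun x => X x + Y x) x = α X x + α Y x := fun x X Y hX hY => by rw [hα.add hX hY]; rfl
  have hsmul : ∀ x f X, F Set.univ f → C.Smooth X →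
      α (fun x => f x • X x) x = f x • α X x := fun x f X hf hX => by rw [hα.smul hf hX]; rfl
  choose X hX hXv using fun (x : M) (v : W x) => L.exists_extension v
  let φ : Π x, Module.Dual 𝕜 (W x) := fun x =>
    { toFun := fun v => α (X x v) x
      map_add' := fun v w => by
        rw [← hadd x _ _ (hX x v) (hX x w)]
        refine L.congr_of_tensorial (α := fun Z => α Z x) (hadd x) (hsmul x) (hX _ _)
          (L.sec_add (hX _ _) (hX _ _)) ?_
        simp [hXv]
      map_smul' := fun c v => by
        simp only [RingHom.id_apply]
        rw [← hsmul x (fun _ => c) _ (L.fun_const _ c) (hX x v)]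
        refine L.congr_of_tensorial (α := fun Z => α Z x) (hadd x) (hsmul x) (hX _ _)
          (L.sec_const_smul c (hX _ _)) ?_
        simp [hXv] }
  have hrep : ∀ x, ∃ a : W x, ∀ w, C.metric x a w = φ x w := by
    intro x
    have := L.finite x
    have hinj : Function.Injective (C.metric x) := by
      rw [← LinearMap.ker_eq_bot, LinearMap.ker_eq_bot']
      intro v hv
      exact L.nondeg x v fun w => by rw [hv]; rfl
    have hsurj := (LinearMap.injective_iff_surjective_of_finrank_eq_finrank
      (f := C.metric x) (Subspace.dual_finrank_eq).symm).mp hinj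
    obtain ⟨a, ha⟩ := hsurj (φ x)
    exact ⟨a, fun w => by rw [ha]⟩
  choose A hA using hrep
  have hpair : ∀ Z, C.Smooth Z → C.pair A Z = α Z := by
    intro Z hZ
    funext x
    rw [Calculus.pair, hA]
    exact L.congr_of_tensorial (α := fun Z => α Z x) (hadd x) (hsmul x) (hX _ _) hZ (hXv _ _)
  exact ⟨A, L.smooth_of_pair fun Z hZ => by rw [hpair Z hZ]; exact hα.smooth hZ, hpair⟩

/-- Linear independence of smooth sections is an open condition. -/
theorem linearIndependent_nhds {κ : Type*} [Fintype κ] {U : Set M} {x₀ : M} (hU : IsOpen U)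
    (hx : x₀ ∈ U) {s : κ → Π x, W x} (hs : ∀ a, C.SmoothOn U (s a))
    (hli : LinearIndependent 𝕜 fun a => s a x₀) :
    ∃ V, IsOpen V ∧ x₀ ∈ V ∧ V ⊆ U ∧ ∀ x ∈ V, LinearIndependent 𝕜 fun a => s a x := by
  classical
  have := L.finite x₀
  have hinj : Function.Injective (C.metric x₀) := by
    rw [← LinearMap.ker_eq_bot, LinearMap.ker_eq_bot']
    intro v hv
    exact L.nondeg x₀ v fun w => by rw [hv]; rfl
  have hsurj := (LinearMap.injective_iff_surjective_of_finrank_eq_finrank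
    (f := C.metric x₀) (Subspace.dual_finrank_eq).symm).mp hinj
  -- Vectors dual to the given ones at x₀. Extended to sections, they give a matrix of products that
  -- is the identity at x₀; where its determinant is nonzero the sections are independent.
  have hfun : ∀ b : κ, ∃ w : W x₀, ∀ a, C.metric x₀ (s a x₀) w = if a = b then 1 else 0 := by
    intro b
    obtain ⟨φ, hφ⟩ : ∃ φ : Module.Dual 𝕜 (W x₀), ∀ a, φ (s a x₀) = if a = b then 1 else 0 := by
      obtain ⟨φ, hφ⟩ := LinearMap.exists_extend (p := Submodule.span 𝕜 (Set.range fun a => s a x₀))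
        ((Finsupp.lapply b).comp hli.repr)
      refine ⟨φ, fun a => ?_⟩
      have := LinearMap.congr_fun hφ ⟨s a x₀, Submodule.subset_span ⟨a, rfl⟩⟩
      simp only [LinearMap.comp_apply, Submodule.subtype_apply] at this
      rw [this, hli.repr_eq_single a _ rfl]
      simp [Finsupp.single_apply]
    obtain ⟨w, hw⟩ := hsurj φ
    exact ⟨w, fun a => by rw [L.symm, hw, hφ]⟩
  choose w hw using hfun
  choose Y hY hYw using fun b => L.exists_extension (w b)
  let G : M → Matrix κ κ 𝕜 := fun x => Matrix.of fun a b => C.pair (s a) (Y b) x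
  have hG : F U (fun x => (G x).det) :=
    L.fun_det fun a b => L.pair_smooth (hs a) (L.sec_mono (Set.subset_univ U) (hY b))
  have h1 : G x₀ = 1 := by
    ext a b
    simp [G, Calculus.pair, hYw, hw, Matrix.one_apply]
  obtain ⟨V, hV, hxV, hVU, hne⟩ := L.fun_ne hG hU hx (by simp [h1])
  refine ⟨V, hV, hxV, hVU, fun x hxV => Fintype.linearIndependent_iff.mpr fun c hc => ?_⟩
  by_contra! hcon
  apply hne x hxV
  refine Matrix.exists_vecMul_eq_zero_iff.mp ⟨c, fun h => ?_, ?_⟩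
  · obtain ⟨i, hi⟩ := hcon; exact hi (congrFun h i)
  · funext b
    have : C.metric x (∑ a, c a • s a x) (Y b x) = 0 := by rw [hc]; simp
    simpa [Matrix.vecMul, dotProduct, G, Calculus.pair] using this

/-- A family of subspaces of constant rank that is locally spanned by smooth sections is a
subbundle. -/
theorem isSubbundle_of_span {V : Π x, Submodule 𝕜 (W x)} {r : ℕ}
    (hr : ∀ x, Module.finrank 𝕜 (V x) = r)
    (hs : ∀ x₀ : M, ∃ U, IsOpen U ∧ x₀ ∈ U ∧ ∃ n : ℕ, ∃ t : Fin n → Π x, W x,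
      (∀ a, C.SmoothOn U (t a)) ∧ ∀ x ∈ U, Submodule.span 𝕜 (Set.range fun a => t a x) = V x) :
    C.IsSubbundle V r := by
  intro x₀
  obtain ⟨U, hU, hx, n, t, ht, hsp⟩ := hs x₀
  have := fun x => L.finite x
  -- A basis at x₀ chosen among the spanning sections remains independent nearby, and constancy of
  -- the rank then forces it to span.
  obtain ⟨κ, a, ha, hspan, hli⟩ := exists_linearIndependent' 𝕜 (fun a => t a x₀)
  have : Finite κ := Finite.of_injective a ha
  have := Fintype.ofFinite κ
  have hcard : Fintype.card κ = r := by
    rw [← hr x₀, ← hsp x₀ hx, ← hspan, finrank_span_eq_card hli]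
  obtain ⟨O, hO, hxO, hOU, hliO⟩ := L.linearIndependent_nhds hU hx (s := fun k => t (a k))
    (fun k => ht (a k)) hli
  let ε : Fin r ≃ κ := (Fintype.equivFinOfCardEq hcard).symm
  refine ⟨O, hO, hxO, fun i => t (a (ε i)), fun i => L.sec_mono hOU (ht _), fun x hxO => ?_⟩
  have hli' : LinearIndependent 𝕜 fun i => t (a (ε i)) x :=
    (hliO x hxO).comp ε ε.injective
  refine ⟨hli', ?_⟩
  refine Submodule.eq_of_le_of_finrank_eq ?_ ?_
  · rw [← hsp x (hOU hxO)]
    exact Submodule.span_mono (by rintro _ ⟨i, rfl⟩; exact ⟨_, rfl⟩)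
  · rw [finrank_span_eq_card hli', hr]; simp

end Calculus.IsLawful

end Lawful


/-! ### The Koszul expression and the Lichnerowicz connection. -/

section Koszul

variable {𝕜 : Type*} [Field 𝕜] {M : Type*} [TopologicalSpace M] {W : M → Type*}
  [∀ x, AddCommGroup (W x)] [∀ x, Module 𝕜 (W x)]

/-- A family of endomorphisms acting on sections. -/
def endo (A : Π x, W x →ₗ[𝕜] W x) (X : Π x, W x) : Π x, W x := fun x => A x (X x)

theorem endo_add (A : Π x, W x →ₗ[𝕜] W x) (X Y : Π x, W x) :
    endo A (X + Y) = endo A X + endo A Y := by funext x; simp [endo]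

theorem endo_smul (A : Π x, W x →ₗ[𝕜] W x) (f : M → 𝕜) (X : Π x, W x) :
    endo A (fun x => f x • X x) = fun x => f x • endo A X x := by funext x; simp [endo]

namespace Calculus

/-- The right hand side of the Koszul formula, `2 g(D_X Y, Z)` for the Levi-Civita connection. -/
def koszul (C : Calculus 𝕜 M W) (X Y Z : Π x, W x) : M → 𝕜 :=
  C.der X (C.pair Y Z) + C.der Y (C.pair X Z) - C.der Z (C.pair X Y)
    + C.pair (C.bracket X Y) Z - C.pair (C.bracket X Z) Y - C.pair (C.bracket Y Z) X

theorem pair_add_left (C : Calculus 𝕜 M W) (X Y Z : Π x, W x) :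
    C.pair (X + Y) Z = C.pair X Z + C.pair Y Z := by funext x; simp [pair]

theorem pair_add_right (C : Calculus 𝕜 M W) (X Y Z : Π x, W x) :
    C.pair X (Y + Z) = C.pair X Y + C.pair X Z := by funext x; simp [pair]

theorem pair_sub_left (C : Calculus 𝕜 M W) (X Y Z : Π x, W x) :
    C.pair (X - Y) Z = C.pair X Z - C.pair Y Z := by funext x; simp [pair]

theorem pair_smul_left (C : Calculus 𝕜 M W) (f : M → 𝕜) (X Z : Π x, W x) :
    C.pair (fun x => f x • X x) Z = f * C.pair X Z := by funext x; simp [pair]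

theorem pair_smul_right (C : Calculus 𝕜 M W) (f : M → 𝕜) (X Z : Π x, W x) :
    C.pair X (fun x => f x • Z x) = f * C.pair X Z := by funext x; simp [pair]

theorem pair_neg_left (C : Calculus 𝕜 M W) (X Z : Π x, W x) :
    C.pair (-X) Z = -C.pair X Z := by funext x; simp [pair]

theorem pair_neg_right (C : Calculus 𝕜 M W) (X Z : Π x, W x) :
    C.pair X (-Z) = -C.pair X Z := by funext x; simp [pair]

theorem pair_zero_left (C : Calculus 𝕜 M W) (Z : Π x, W x) : C.pair 0 Z = 0 := by
  funext x; simp [pair]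

theorem pair_zero_right (C : Calculus 𝕜 M W) (Z : Π x, W x) : C.pair Z 0 = 0 := by
  funext x; simp [pair]

namespace IsLawful

variable {C : Calculus 𝕜 M W} {F : Set M → (M → 𝕜) → Prop} (L : C.IsLawful F)
include L

theorem pair_comm (X Y : Π x, W x) : C.pair X Y = C.pair Y X := by
  funext x; exact L.symm _ _ _

theorem smooth_zero : C.Smooth (0 : Π x, W x) := L.sec_zero _

theorem smooth_add {X Y} (hX : C.Smooth X) (hY : C.Smooth Y) : C.Smooth (X + Y) := L.sec_add hX hY

theorem smooth_neg {X} (hX : C.Smooth X) : C.Smooth (-X) := L.sec_neg hX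

theorem smooth_sub {X Y} (hX : C.Smooth X) (hY : C.Smooth Y) : C.Smooth (X - Y) := L.sec_sub hX hY

theorem smooth_smul {f X} (hf : F Set.univ f) (hX : C.Smooth X) :
    C.Smooth (fun x => f x • X x) := L.sec_smul hf hX

theorem smooth_pair {X Y} (hX : C.Smooth X) (hY : C.Smooth Y) : F Set.univ (C.pair X Y) :=
  L.pair_smooth hX hY

theorem der_add' (X Y f) : C.der (X + Y) f = C.der X f + C.der Y f := L.der_add_left X Y f

theorem der_neg (X) {f} (hf : F Set.univ f) : C.der X (-f) = -C.der X f := by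
  have : -f = (fun _ => (-1 : 𝕜)) * f := by funext x; simp
  rw [this, L.der_mul _ (L.fun_const _ _) hf, L.der_const]
  funext x; simp

theorem der_sub (X) {f h} (hf : F Set.univ f) (hh : F Set.univ h) :
    C.der X (f - h) = C.der X f - C.der X h := by
  rw [sub_eq_add_neg, L.der_add _ hf (L.fun_neg hh), L.der_neg _ hh, sub_eq_add_neg]

theorem der_zero (X) : C.der X 0 = 0 := L.der_const X 0

theorem der_zero_left (f) : C.der (0 : Π x, W x) f = 0 := by
  have := L.der_smul_left 0 0 f
  rw [zero_mul] at this
  rw [← this]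
  congr 1
  funext x
  simp

theorem bracket_comm (X Y) : C.bracket X Y = -C.bracket Y X := by
  funext x; exact L.bracket_swap X Y x

theorem bracket_add_right {X Y Z} (hX : C.Smooth X) (hY : C.Smooth Y) (hZ : C.Smooth Z) :
    C.bracket X (Y + Z) = C.bracket X Y + C.bracket X Z := by
  funext x; exact L.bracket_add hX hY hZ x

theorem bracket_add_left {X Y Z} (hX : C.Smooth X) (hY : C.Smooth Y) (hZ : C.Smooth Z) :
    C.bracket (X + Y) Z = C.bracket X Z + C.bracket Y Z := by
  rw [L.bracket_comm, L.bracket_add_right hZ hX hY, L.bracket_comm X, L.bracket_comm Y]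
  abel

theorem pair_bracket_smul_right {X Y Z f} (hX : C.Smooth X) (hY : C.Smooth Y)
    (hf : F Set.univ f) : C.pair (C.bracket X (fun x => f x • Y x)) Z =
      f * C.pair (C.bracket X Y) Z + C.der X f * C.pair Y Z := by
  funext x
  simp [pair, L.bracket_smul hX hY hf]

theorem pair_bracket_smul_left {X Y Z f} (hX : C.Smooth X) (hY : C.Smooth Y)
    (hf : F Set.univ f) : C.pair (C.bracket (fun x => f x • X x) Y) Z =
      f * C.pair (C.bracket X Y) Z - C.der Y f * C.pair X Z := by
  rw [L.bracket_comm, pair_neg_left, L.pair_bracket_smul_right hY hX hf, L.bracket_comm Y X,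
    pair_neg_left]
  ring

theorem bracket_zero_right {X} (hX : C.Smooth X) : C.bracket X 0 = 0 := by
  funext x
  have := L.bracket_smul hX hX (L.fun_const Set.univ (0 : 𝕜)) x
  simp only [zero_smul, L.der_const, Pi.zero_apply, add_zero] at this
  exact this

theorem bracket_zero_left {X} (hX : C.Smooth X) : C.bracket 0 X = 0 := by
  rw [L.bracket_comm, L.bracket_zero_right hX, neg_zero]

theorem bracket_neg_right {X Y} (hX : C.Smooth X) (hY : C.Smooth Y) :
    C.bracket X (-Y) = -C.bracket X Y := by
  funext x
  have := L.bracket_smul hX hY (L.fun_const Set.univ (-1 : 𝕜)) x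
  simp only [neg_smul, one_smul, L.der_const, Pi.zero_apply, zero_smul, add_zero] at this
  exact this

theorem bracket_neg_left {X Y} (hX : C.Smooth X) (hY : C.Smooth Y) :
    C.bracket (-X) Y = -C.bracket X Y := by
  rw [L.bracket_comm, L.bracket_neg_right hY hX, L.bracket_comm Y, neg_neg]

theorem koszul_smooth {X Y Z} (hX : C.Smooth X) (hY : C.Smooth Y) (hZ : C.Smooth Z) :
    F Set.univ (C.koszul X Y Z) := by
  refine L.fun_sub (L.fun_sub (L.fun_add (L.fun_sub (L.fun_add ?_ ?_) ?_) ?_) ?_) ?_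
  · exact L.der_smooth hX (L.smooth_pair hY hZ)
  · exact L.der_smooth hY (L.smooth_pair hX hZ)
  · exact L.der_smooth hZ (L.smooth_pair hX hY)
  · exact L.smooth_pair (L.bracket_smooth hX hY) hZ
  · exact L.smooth_pair (L.bracket_smooth hX hZ) hY
  · exact L.smooth_pair (L.bracket_smooth hY hZ) hX

theorem koszul_add_left {X X' Y Z} (hX : C.Smooth X) (hX' : C.Smooth X') (hY : C.Smooth Y)
    (hZ : C.Smooth Z) : C.koszul (X + X') Y Z = C.koszul X Y Z + C.koszul X' Y Z := by
  simp only [koszul, pair_add_left, pair_add_right, L.der_add', L.bracket_add_left hX hX' hY,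
    L.bracket_add_left hX hX' hZ, L.der_add _ (L.smooth_pair hX hZ) (L.smooth_pair hX' hZ),
    L.der_add _ (L.smooth_pair hX hY) (L.smooth_pair hX' hY)]
  ring

theorem koszul_smul_left {X Y Z f} (hX : C.Smooth X) (hY : C.Smooth Y) (hZ : C.Smooth Z)
    (hf : F Set.univ f) : C.koszul (fun x => f x • X x) Y Z = f * C.koszul X Y Z := by
  simp only [koszul, pair_smul_left, pair_smul_right, L.der_smul_left,
    L.pair_bracket_smul_left hX hY hf, L.pair_bracket_smul_left hX hZ hf,
    L.der_mul _ hf (L.smooth_pair hX hZ), L.der_mul _ hf (L.smooth_pair hX hY)]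
  ring

/-- The Koszul form of metricity. It also transfers rules from the last slot to the middle one. -/
theorem koszul_antisymm {X Y Z} (_hX : C.Smooth X) (_hY : C.Smooth Y) (_hZ : C.Smooth Z) :
    C.koszul X Y Z + C.koszul X Z Y = 2 * C.der X (C.pair Y Z) := by
  simp only [koszul, L.pair_comm Z Y, L.bracket_comm Z Y, pair_neg_left]
  ring

theorem koszul_add_right {X Y Z Z'} (hX : C.Smooth X) (hY : C.Smooth Y) (hZ : C.Smooth Z)
    (hZ' : C.Smooth Z') : C.koszul X Y (Z + Z') = C.koszul X Y Z + C.koszul X Y Z' := by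
  simp only [koszul, pair_add_left, pair_add_right, L.der_add', L.bracket_add_right hX hZ hZ',
    L.bracket_add_right hY hZ hZ', L.der_add _ (L.smooth_pair hX hZ) (L.smooth_pair hX hZ'),
    L.der_add _ (L.smooth_pair hY hZ) (L.smooth_pair hY hZ')]
  ring

theorem koszul_smul_right {X Y Z f} (hX : C.Smooth X) (hY : C.Smooth Y) (hZ : C.Smooth Z)
    (hf : F Set.univ f) : C.koszul X Y (fun x => f x • Z x) = f * C.koszul X Y Z := by
  simp only [koszul, pair_smul_right, L.der_smul_left,
    L.pair_bracket_smul_right hX hZ hf, L.pair_bracket_smul_right hY hZ hf,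
    L.der_mul _ hf (L.smooth_pair hX hZ), L.der_mul _ hf (L.smooth_pair hY hZ), L.pair_comm Z]
  ring

theorem koszul_add_mid {X Y Y' Z} (hX : C.Smooth X) (hY : C.Smooth Y) (hY' : C.Smooth Y')
    (hZ : C.Smooth Z) : C.koszul X (Y + Y') Z = C.koszul X Y Z + C.koszul X Y' Z := by
  have h1 := L.koszul_antisymm hX (L.smooth_add hY hY') hZ
  have h2 := L.koszul_antisymm hX hY hZ
  have h3 := L.koszul_antisymm hX hY' hZ
  rw [pair_add_left, L.der_add _ (L.smooth_pair hY hZ) (L.smooth_pair hY' hZ),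
    L.koszul_add_right hX hZ hY hY'] at h1
  linear_combination h1 - h2 - h3

theorem koszul_smul_mid {X Y Z f} (hX : C.Smooth X) (hY : C.Smooth Y) (hZ : C.Smooth Z)
    (hf : F Set.univ f) : C.koszul X (fun x => f x • Y x) Z =
      f * C.koszul X Y Z + 2 * C.der X f * C.pair Y Z := by
  have h1 := L.koszul_antisymm hX (L.smooth_smul hf hY) hZ
  have h2 := L.koszul_antisymm hX hY hZ
  rw [pair_smul_left, L.der_mul _ hf (L.smooth_pair hY hZ), L.koszul_smul_right hX hZ hY hf] at h1
  linear_combination h1 - f * h2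

theorem koszul_zero_mid {X Z} (hX : C.Smooth X) (hZ : C.Smooth Z) : C.koszul X 0 Z = 0 := by
  simp [koszul, pair_zero_left, pair_zero_right, L.der_zero, L.der_zero_left,
    L.bracket_zero_left hZ, L.bracket_zero_right hX]

theorem koszul_zero_right {X Y} (hX : C.Smooth X) (hY : C.Smooth Y) : C.koszul X Y 0 = 0 := by
  simp [koszul, pair_zero_left, pair_zero_right, L.der_zero, L.der_zero_left,
    L.bracket_zero_right hY, L.bracket_zero_right hX]

end IsLawful

/-- The Koszul expression corrected by the bracket term `g([Y, Z], T)`. -/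
def koszulWith (C : Calculus 𝕜 M W) (T X Y Z : Π x, W x) : M → 𝕜 :=
  C.koszul X Y Z + C.pair (C.bracket Y Z) T

/-- The data entering the Lichnerowicz connection: a pair of dual null sections and a skew
endomorphism `J` that is a complex structure on the orthogonal complement. -/
structure IsScreenData (C : Calculus 𝕜 M W) (ξ ξ' : Π x, W x) (J : Π x, W x →ₗ[𝕜] W x) :
    Prop where
  smooth : C.Smooth ξ
  smooth' : C.Smooth ξ'
  null : ∀ x, C.metric x (ξ x) (ξ x) = 0
  null' : ∀ x, C.metric x (ξ' x) (ξ' x) = 0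
  dual : ∀ x, C.metric x (ξ x) (ξ' x) = 1
  smooth_J : ∀ X, C.Smooth X → C.Smooth (endo J X)
  J_left : ∀ x, J x (ξ x) = 0
  J_right : ∀ x, J x (ξ' x) = 0
  skew : ∀ x v w, C.metric x (J x v) w = -C.metric x v (J x w)
  sq : ∀ x v, J x (J x v) = -(v - C.metric x v (ξ' x) • ξ x - C.metric x v (ξ x) • ξ' x)

/-- The projection `v ↦ g(v, η) ζ`. -/
def lineProj (C : Calculus 𝕜 M W) (ζ η : Π x, W x) (x : M) : W x →ₗ[𝕜] W x :=
  ((C.metric x).flip (η x)).smulRight (ζ x)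

/-- The projection onto the orthogonal complement of `ξ, ξ'`. -/
def screenProj (C : Calculus 𝕜 M W) (ξ ξ' : Π x, W x) (x : M) : W x →ₗ[𝕜] W x :=
  LinearMap.id - C.lineProj ξ ξ' x - C.lineProj ξ' ξ x

/-- The projection onto the span of `ξ, ξ'`. -/
def planeProj (C : Calculus 𝕜 M W) (ξ ξ' : Π x, W x) (x : M) : W x →ₗ[𝕜] W x :=
  C.lineProj ξ ξ' x + C.lineProj ξ' ξ x

/-- `4 g(∇_X Y, Z)` for the Lichnerowicz connection. -/
def lichForm (C : Calculus 𝕜 M W) (ξ ξ' : Π x, W x) (J : Π x, W x →ₗ[𝕜] W x)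
    (X Y Z : Π x, W x) : M → 𝕜 :=
  -- The first two terms pair R with R*, the last two average the screen pairing over J; the weight
  -- 2 balances the average. The first argument of `koszulWith` is always the part of X in the
  -- opposite block.
  2 * C.koszulWith (endo (C.screenProj ξ ξ') X) X (endo (C.lineProj ξ ξ') Y)
      (endo (C.lineProj ξ' ξ) Z)
    + 2 * C.koszulWith (endo (C.screenProj ξ ξ') X) X (endo (C.lineProj ξ' ξ) Y)
      (endo (C.lineProj ξ ξ') Z)
    + C.koszulWith (endo (C.planeProj ξ ξ') X) X (endo (C.screenProj ξ ξ') Y)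
      (endo (C.screenProj ξ ξ') Z)
    + C.koszulWith (endo (C.planeProj ξ ξ') X) X (endo J Y) (endo J Z)

/-- The Lichnerowicz connection `∇_X Y`. -/
def lich (C : Calculus 𝕜 M W) (ξ ξ' : Π x, W x) (J : Π x, W x →ₗ[𝕜] W x)
    (X Y : Π x, W x) : Π x, W x :=
  C.sharp fun Z => (fun _ => (4 : 𝕜)⁻¹) * C.lichForm ξ ξ' J X Y Z

namespace IsLawful

variable {C : Calculus 𝕜 M W} {F : Set M → (M → 𝕜) → Prop} (L : C.IsLawful F)
include L

theorem koszulWith_smooth {T X Y Z} (hT : C.Smooth T) (hX : C.Smooth X) (hY : C.Smooth Y)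
    (hZ : C.Smooth Z) : F Set.univ (C.koszulWith T X Y Z) :=
  L.fun_add (L.koszul_smooth hX hY hZ) (L.smooth_pair (L.bracket_smooth hY hZ) hT)

theorem koszulWith_add_left {T T' X X' Y Z} (hX : C.Smooth X) (hX' : C.Smooth X')
    (hY : C.Smooth Y) (hZ : C.Smooth Z) :
    C.koszulWith (T + T') (X + X') Y Z = C.koszulWith T X Y Z + C.koszulWith T' X' Y Z := by
  simp only [koszulWith, L.koszul_add_left hX hX' hY hZ, pair_add_right]
  ring

theorem koszulWith_smul_left {T X Y Z f} (hX : C.Smooth X) (hY : C.Smooth Y) (hZ : C.Smooth Z)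
    (hf : F Set.univ f) :
    C.koszulWith (fun x => f x • T x) (fun x => f x • X x) Y Z = f * C.koszulWith T X Y Z := by
  simp only [koszulWith, L.koszul_smul_left hX hY hZ hf, pair_smul_right]
  ring

theorem koszulWith_add_mid {T X Y Y' Z} (hX : C.Smooth X) (hY : C.Smooth Y) (hY' : C.Smooth Y')
    (hZ : C.Smooth Z) :
    C.koszulWith T X (Y + Y') Z = C.koszulWith T X Y Z + C.koszulWith T X Y' Z := by
  simp only [koszulWith, L.koszul_add_mid hX hY hY' hZ, L.bracket_add_left hY hY' hZ,
    pair_add_left]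
  ring

theorem koszulWith_add_right {T X Y Z Z'} (hX : C.Smooth X) (hY : C.Smooth Y) (hZ : C.Smooth Z)
    (hZ' : C.Smooth Z') :
    C.koszulWith T X Y (Z + Z') = C.koszulWith T X Y Z + C.koszulWith T X Y Z' := by
  simp only [koszulWith, L.koszul_add_right hX hY hZ hZ', L.bracket_add_right hY hZ hZ',
    pair_add_left]
  ring

/-- The bracket correction would add -Z(f) g(Y,T), which vanishes because T is taken orthogonal to
Y. The rule for the last slot is analogous. -/
theorem koszulWith_smul_mid {T X Y Z f} (hX : C.Smooth X) (hY : C.Smooth Y) (hZ : C.Smooth Z)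
    (hf : F Set.univ f) (h : C.pair Y T = 0) :
    C.koszulWith T X (fun x => f x • Y x) Z =
      f * C.koszulWith T X Y Z + 2 * C.der X f * C.pair Y Z := by
  simp only [koszulWith, L.koszul_smul_mid hX hY hZ hf, L.pair_bracket_smul_left hY hZ hf, h]
  ring

theorem koszulWith_smul_right {T X Y Z f} (hX : C.Smooth X) (hY : C.Smooth Y) (hZ : C.Smooth Z)
    (hf : F Set.univ f) (h : C.pair Z T = 0) :
    C.koszulWith T X Y (fun x => f x • Z x) = f * C.koszulWith T X Y Z := by
  simp only [koszulWith, L.koszul_smul_right hX hY hZ hf, L.pair_bracket_smul_right hY hZ hf, h]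
  ring

theorem koszulWith_antisymm {T X Y Z} (hX : C.Smooth X) (hY : C.Smooth Y) (hZ : C.Smooth Z) :
    C.koszulWith T X Y Z + C.koszulWith T X Z Y = 2 * C.der X (C.pair Y Z) := by
  rw [← L.koszul_antisymm hX hY hZ, koszulWith, koszulWith, L.bracket_comm Z Y, pair_neg_left]
  ring

theorem koszulWith_zero_mid {T X Z} (hX : C.Smooth X) (hZ : C.Smooth Z) :
    C.koszulWith T X 0 Z = 0 := by
  simp [koszulWith, L.koszul_zero_mid hX hZ, L.bracket_zero_left hZ, pair_zero_left]

theorem koszulWith_zero_right {T X Y} (hX : C.Smooth X) (hY : C.Smooth Y) :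
    C.koszulWith T X Y 0 = 0 := by
  simp [koszulWith, L.koszul_zero_right hX hY, L.bracket_zero_right hY, pair_zero_left]

end IsLawful

namespace IsScreenData

variable {C : Calculus 𝕜 M W} {F : Set M → (M → 𝕜) → Prop} (L : C.IsLawful F)
  {ξ ξ' : Π x, W x} {J : Π x, W x →ₗ[𝕜] W x} (D : C.IsScreenData ξ ξ' J)
include L D

theorem smooth_line : ∀ X, C.Smooth X → C.Smooth (endo (C.lineProj ξ ξ') X) := fun _ hX =>
  L.smooth_smul (L.smooth_pair hX D.smooth') D.smooth

theorem smooth_line' : ∀ X, C.Smooth X → C.Smooth (endo (C.lineProj ξ' ξ) X) := fun _ hX =>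
  L.smooth_smul (L.smooth_pair hX D.smooth) D.smooth'

theorem smooth_screen : ∀ X, C.Smooth X → C.Smooth (endo (C.screenProj ξ ξ') X) := fun X hX =>
  L.smooth_sub (L.smooth_sub hX (D.smooth_line L X hX)) (D.smooth_line' L X hX)

theorem smooth_plane : ∀ X, C.Smooth X → C.Smooth (endo (C.planeProj ξ ξ') X) := fun X hX =>
  L.smooth_add (D.smooth_line L X hX) (D.smooth_line' L X hX)

theorem dual' (x) : C.metric x (ξ' x) (ξ x) = 1 := by rw [L.symm, D.dual]

theorem pair_J_left (x) (v : W x) : C.metric x (J x v) (ξ x) = 0 := by rw [D.skew, D.J_left]; simp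

theorem pair_J_right (x) (v : W x) : C.metric x (J x v) (ξ' x) = 0 := by rw [D.skew, D.J_right]; simp

/-- The metric pairs the two null lines with each other, so their projections are mutually adjoint,
while the screen projection is self-adjoint and J is skew. -/
theorem adjoint_line (Y Z) :
    C.pair (endo (C.lineProj ξ ξ') Y) Z = C.pair Y (endo (C.lineProj ξ' ξ) Z) := by
  funext x; simp [pair, endo, lineProj, L.symm x (ξ x) (Z x)]; ring

theorem adjoint_line' (Y Z) :
    C.pair (endo (C.lineProj ξ' ξ) Y) Z = C.pair Y (endo (C.lineProj ξ ξ') Z) := by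
  funext x; simp [pair, endo, lineProj, L.symm x (ξ' x) (Z x)]; ring

theorem adjoint_screen (Y Z) :
    C.pair (endo (C.screenProj ξ ξ') Y) Z = C.pair Y (endo (C.screenProj ξ ξ') Z) := by
  funext x
  simp [pair, endo, screenProj, lineProj, L.symm x (ξ x) (Z x), L.symm x (ξ' x) (Z x)]; ring

omit L in
theorem adjoint_J (Y Z) : C.pair (endo J Y) Z = -C.pair Y (endo J Z) := by
  funext x; simp [pair, endo, D.skew]

theorem line_line (Y) : endo (C.lineProj ξ ξ') (endo (C.lineProj ξ ξ') Y) =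
    endo (C.lineProj ξ ξ') Y := by
  funext x; simp [endo, lineProj, D.dual]

theorem line'_line' (Y) : endo (C.lineProj ξ' ξ) (endo (C.lineProj ξ' ξ) Y) =
    endo (C.lineProj ξ' ξ) Y := by
  funext x; simp [endo, lineProj, D.dual' L]

theorem line_line' (Y) : endo (C.lineProj ξ ξ') (endo (C.lineProj ξ' ξ) Y) = 0 := by
  funext x; simp [endo, lineProj, D.null']

theorem line'_line (Y) : endo (C.lineProj ξ' ξ) (endo (C.lineProj ξ ξ') Y) = 0 := by
  funext x; simp [endo, lineProj, D.null]

theorem line_J (Y) : endo (C.lineProj ξ ξ') (endo J Y) = 0 := by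
  funext x; simp [endo, lineProj, D.pair_J_right L]

theorem line'_J (Y) : endo (C.lineProj ξ' ξ) (endo J Y) = 0 := by
  funext x; simp [endo, lineProj, D.pair_J_left L]

theorem J_line (Y) : endo J (endo (C.lineProj ξ ξ') Y) = 0 := by
  funext x; simp [endo, lineProj, D.J_left]

theorem J_line' (Y) : endo J (endo (C.lineProj ξ' ξ) Y) = 0 := by
  funext x; simp [endo, lineProj, D.J_right]

theorem J_J (Y) : endo J (endo J Y) = -endo (C.screenProj ξ ξ') Y := by
  funext x; simp [endo, lineProj, screenProj, D.sq]

theorem screen_J (Y) : endo (C.screenProj ξ ξ') (endo J Y) = endo J Y := by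
  funext x; simp [endo, lineProj, screenProj, D.pair_J_left L, D.pair_J_right L]

theorem J_screen (Y) : endo J (endo (C.screenProj ξ ξ') Y) = endo J Y := by
  funext x; simp [endo, lineProj, screenProj, D.J_left, D.J_right]

theorem screen_line (Y) : endo (C.screenProj ξ ξ') (endo (C.lineProj ξ ξ') Y) = 0 := by
  funext x; simp [endo, lineProj, screenProj, D.null, D.dual]

theorem screen_line' (Y) : endo (C.screenProj ξ ξ') (endo (C.lineProj ξ' ξ) Y) = 0 := by
  funext x; simp [endo, lineProj, screenProj, D.null', D.dual' L]

theorem line_screen (Y) : endo (C.lineProj ξ ξ') (endo (C.screenProj ξ ξ') Y) = 0 := by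
  funext x; simp [endo, lineProj, screenProj, D.null', D.dual]

theorem line'_screen (Y) : endo (C.lineProj ξ' ξ) (endo (C.screenProj ξ ξ') Y) = 0 := by
  funext x; simp [endo, lineProj, screenProj, D.null, D.dual' L]

theorem screen_screen (Y) : endo (C.screenProj ξ ξ') (endo (C.screenProj ξ ξ') Y) =
    endo (C.screenProj ξ ξ') Y := by
  funext x; simp [endo, lineProj, screenProj, D.null, D.null', D.dual, D.dual' L]

omit D in
theorem plane_perp (X Y) (h : endo (C.lineProj ξ ξ') Y = 0) (h' : endo (C.lineProj ξ' ξ) Y = 0) :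
    C.pair Y (endo (C.planeProj ξ ξ') X) = 0 := by
  funext x
  have h := congrArg (C.metric x (X x)) (congrFun h x)
  have h' := congrArg (C.metric x (X x)) (congrFun h' x)
  simp only [endo, lineProj, LinearMap.smulRight_apply, map_smul,
    smul_eq_mul, Pi.zero_apply, map_zero] at h h'
  simp only [pair, endo, planeProj, lineProj, LinearMap.add_apply, LinearMap.smulRight_apply,
    map_add, map_smul, smul_eq_mul, Pi.zero_apply]
  change C.metric x (Y x) (ξ' x) * C.metric x (X x) (ξ x) = 0 at h
  change C.metric x (Y x) (ξ x) * C.metric x (X x) (ξ' x) = 0 at h'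
  change C.metric x (X x) (ξ' x) * C.metric x (Y x) (ξ x)
    + C.metric x (X x) (ξ x) * C.metric x (Y x) (ξ' x) = 0
  linear_combination h + h'

theorem line_perp_screen (X Y) :
    C.pair (endo (C.lineProj ξ ξ') Y) (endo (C.screenProj ξ ξ') X) = 0 := by
  rw [D.adjoint_line L, D.line'_screen L, pair_zero_right]

theorem line'_perp_screen (X Y) :
    C.pair (endo (C.lineProj ξ' ξ) Y) (endo (C.screenProj ξ ξ') X) = 0 := by
  rw [D.adjoint_line' L, D.line_screen L, pair_zero_right]

theorem screen_perp_plane (X Y) :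
    C.pair (endo (C.screenProj ξ ξ') Y) (endo (C.planeProj ξ ξ') X) = 0 :=
  plane_perp L _ _ (D.line_screen L Y) (D.line'_screen L Y)

theorem J_perp_plane (X Y) : C.pair (endo J Y) (endo (C.planeProj ξ ξ') X) = 0 :=
  plane_perp L _ _ (D.line_J L Y) (D.line'_J L Y)

/-- The decomposition of the metric underlying the Leibniz rule of the Lichnerowicz connection. -/
theorem pair_decomp (Y Z) :
    2 * C.pair (endo (C.lineProj ξ ξ') Y) (endo (C.lineProj ξ' ξ) Z)
      + 2 * C.pair (endo (C.lineProj ξ' ξ) Y) (endo (C.lineProj ξ ξ') Z)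
      + C.pair (endo (C.screenProj ξ ξ') Y) (endo (C.screenProj ξ ξ') Z)
      + C.pair (endo J Y) (endo J Z) = 2 * C.pair Y Z := by
  rw [D.adjoint_J, D.J_J L, D.adjoint_screen L, D.screen_screen L, D.adjoint_line L,
    D.line'_line' L, D.adjoint_line' L, D.line_line L, pair_neg_right]
  funext x
  simp [pair, endo, lineProj, screenProj]
  ring

theorem lichForm_isForm {X Y} (hX : C.Smooth X) (hY : C.Smooth Y) :
    C.IsForm F (C.lichForm ξ ξ' J X Y) := by
  have s1 := D.smooth_line L
  have s2 := D.smooth_line' L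
  have s3 := D.smooth_screen L
  have s4 := D.smooth_plane L
  have s5 := D.smooth_J
  have c2 : F Set.univ (2 : M → 𝕜) := L.fun_const _ 2
  refine ⟨fun {Z} hZ => ?_, fun {Z Z'} hZ hZ' => ?_, fun {f Z} hf hZ => ?_⟩
  · refine L.fun_add (L.fun_add (L.fun_add (L.fun_mul c2 ?_) (L.fun_mul c2 ?_)) ?_) ?_
    · exact L.koszulWith_smooth (s3 _ hX) hX (s1 _ hY) (s2 _ hZ)
    · exact L.koszulWith_smooth (s3 _ hX) hX (s2 _ hY) (s1 _ hZ)
    · exact L.koszulWith_smooth (s4 _ hX) hX (s3 _ hY) (s3 _ hZ)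
    · exact L.koszulWith_smooth (s4 _ hX) hX (s5 _ hY) (s5 _ hZ)
  · change C.lichForm ξ ξ' J X Y (Z + Z') = _
    simp only [lichForm, endo_add]
    rw [L.koszulWith_add_right hX (s1 _ hY) (s2 _ hZ) (s2 _ hZ'),
      L.koszulWith_add_right hX (s2 _ hY) (s1 _ hZ) (s1 _ hZ'),
      L.koszulWith_add_right hX (s3 _ hY) (s3 _ hZ) (s3 _ hZ'),
      L.koszulWith_add_right hX (s5 _ hY) (s5 _ hZ) (s5 _ hZ')]
    ring
  · simp only [lichForm, endo_smul]
    rw [L.koszulWith_smul_right hX (s1 _ hY) (s2 _ hZ) hf (D.line'_perp_screen L _ _),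
      L.koszulWith_smul_right hX (s2 _ hY) (s1 _ hZ) hf (D.line_perp_screen L _ _),
      L.koszulWith_smul_right hX (s3 _ hY) (s3 _ hZ) hf (D.screen_perp_plane L _ _),
      L.koszulWith_smul_right hX (s5 _ hY) (s5 _ hZ) hf (D.J_perp_plane L _ _)]
    ring

/-- The four terms produced by differentiating f add up to a multiple of g(Y,Z) by `pair_decomp`;
this is what dictates the weights in `lichForm`. -/
theorem lichForm_leibniz {X Y Z f} (hX : C.Smooth X) (hY : C.Smooth Y) (hZ : C.Smooth Z)
    (hf : F Set.univ f) : C.lichForm ξ ξ' J X (fun x => f x • Y x) Z =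
      f * C.lichForm ξ ξ' J X Y Z + 4 * (C.der X f * C.pair Y Z) := by
  have s1 := D.smooth_line L
  have s2 := D.smooth_line' L
  have s3 := D.smooth_screen L
  have s5 := D.smooth_J
  have hd := D.pair_decomp L Y Z
  simp only [lichForm, endo_smul]
  rw [L.koszulWith_smul_mid hX (s1 _ hY) (s2 _ hZ) hf (D.line_perp_screen L _ _),
    L.koszulWith_smul_mid hX (s2 _ hY) (s1 _ hZ) hf (D.line'_perp_screen L _ _),
    L.koszulWith_smul_mid hX (s3 _ hY) (s3 _ hZ) hf (D.screen_perp_plane L _ _),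
    L.koszulWith_smul_mid hX (s5 _ hY) (s5 _ hZ) hf (D.J_perp_plane L _ _)]
  linear_combination (2 * C.der X f) * hd

theorem lichForm_add_mid {X Y Y' Z} (hX : C.Smooth X) (hY : C.Smooth Y) (hY' : C.Smooth Y')
    (hZ : C.Smooth Z) : C.lichForm ξ ξ' J X (Y + Y') Z =
      C.lichForm ξ ξ' J X Y Z + C.lichForm ξ ξ' J X Y' Z := by
  have s1 := D.smooth_line L
  have s2 := D.smooth_line' L
  have s3 := D.smooth_screen L
  have s5 := D.smooth_J
  simp only [lichForm, endo_add]
  rw [L.koszulWith_add_mid hX (s1 _ hY) (s1 _ hY') (s2 _ hZ),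
    L.koszulWith_add_mid hX (s2 _ hY) (s2 _ hY') (s1 _ hZ),
    L.koszulWith_add_mid hX (s3 _ hY) (s3 _ hY') (s3 _ hZ),
    L.koszulWith_add_mid hX (s5 _ hY) (s5 _ hY') (s5 _ hZ)]
  ring

theorem lichForm_add_left {X X' Y Z} (hX : C.Smooth X) (hX' : C.Smooth X') (hY : C.Smooth Y)
    (hZ : C.Smooth Z) : C.lichForm ξ ξ' J (X + X') Y Z =
      C.lichForm ξ ξ' J X Y Z + C.lichForm ξ ξ' J X' Y Z := by
  have s1 := D.smooth_line L
  have s2 := D.smooth_line' L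
  have s3 := D.smooth_screen L
  have s5 := D.smooth_J
  simp only [lichForm, endo_add]
  rw [L.koszulWith_add_left hX hX' (s1 _ hY) (s2 _ hZ),
    L.koszulWith_add_left hX hX' (s2 _ hY) (s1 _ hZ),
    L.koszulWith_add_left hX hX' (s3 _ hY) (s3 _ hZ),
    L.koszulWith_add_left hX hX' (s5 _ hY) (s5 _ hZ)]
  ring

theorem lichForm_smul_left {X Y Z f} (hX : C.Smooth X) (hY : C.Smooth Y) (hZ : C.Smooth Z)
    (hf : F Set.univ f) : C.lichForm ξ ξ' J (fun x => f x • X x) Y Z =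
      f * C.lichForm ξ ξ' J X Y Z := by
  have s1 := D.smooth_line L
  have s2 := D.smooth_line' L
  have s3 := D.smooth_screen L
  have s5 := D.smooth_J
  simp only [lichForm, endo_smul]
  rw [L.koszulWith_smul_left hX (s1 _ hY) (s2 _ hZ) hf,
    L.koszulWith_smul_left hX (s2 _ hY) (s1 _ hZ) hf,
    L.koszulWith_smul_left hX (s3 _ hY) (s3 _ hZ) hf,
    L.koszulWith_smul_left hX (s5 _ hY) (s5 _ hZ) hf]
  ring

theorem lichForm_antisymm {X Y Z} (hX : C.Smooth X) (hY : C.Smooth Y) (hZ : C.Smooth Z) :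
    C.lichForm ξ ξ' J X Y Z + C.lichForm ξ ξ' J X Z Y = 4 * C.der X (C.pair Y Z) := by
  have s1 := D.smooth_line L
  have s2 := D.smooth_line' L
  have s3 := D.smooth_screen L
  have s5 := D.smooth_J
  -- Differentiating the decomposition of the metric collects the antisymmetries of the four Koszul
  -- terms into that of g.
  have hd := congrArg (C.der X) (D.pair_decomp L Y Z)
  have c2 : F Set.univ (2 : M → 𝕜) := L.fun_const _ 2
  have d2 : C.der X (2 : M → 𝕜) = 0 := L.der_const X 2
  have p1 := L.smooth_pair (s1 _ hY) (s2 _ hZ)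
  have p2 := L.smooth_pair (s2 _ hY) (s1 _ hZ)
  have p3 := L.smooth_pair (s3 _ hY) (s3 _ hZ)
  have p5 := L.smooth_pair (s5 _ hY) (s5 _ hZ)
  rw [L.der_add _ (L.fun_add (L.fun_add (L.fun_mul c2 p1) (L.fun_mul c2 p2)) p3) p5,
    L.der_add _ (L.fun_add (L.fun_mul c2 p1) (L.fun_mul c2 p2)) p3,
    L.der_add _ (L.fun_mul c2 p1) (L.fun_mul c2 p2), L.der_mul _ c2 p1, L.der_mul _ c2 p2,
    L.der_mul _ c2 (L.smooth_pair hY hZ), d2] at hd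
  have h1 := L.koszulWith_antisymm (T := endo (C.screenProj ξ ξ') X) hX (s1 _ hY) (s2 _ hZ)
  have h2 := L.koszulWith_antisymm (T := endo (C.screenProj ξ ξ') X) hX (s2 _ hY) (s1 _ hZ)
  have h3 := L.koszulWith_antisymm (T := endo (C.planeProj ξ ξ') X) hX (s3 _ hY) (s3 _ hZ)
  have h5 := L.koszulWith_antisymm (T := endo (C.planeProj ξ ξ') X) hX (s5 _ hY) (s5 _ hZ)
  simp only [lichForm]
  linear_combination 2 * h1 + 2 * h2 + h3 + h5 + 2 * hd

variable [NeZero (4 : 𝕜)]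

theorem lich_spec {X Y} (hX : C.Smooth X) (hY : C.Smooth Y) :
    C.Smooth (C.lich ξ ξ' J X Y) ∧ ∀ Z, C.Smooth Z →
      4 * C.pair (C.lich ξ ξ' J X Y) Z = C.lichForm ξ ξ' J X Y Z := by
  have hF := D.lichForm_isForm L hX hY
  have := L.sharp_spec (α := fun Z => (fun _ => (4 : 𝕜)⁻¹) * C.lichForm ξ ξ' J X Y Z)
    ⟨fun hZ => L.fun_mul (L.fun_const _ _) (hF.smooth hZ),
      fun hZ hZ' => by rw [hF.add hZ hZ']; ring, fun hf hZ => by rw [hF.smul hf hZ]; ring⟩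
  refine ⟨this.1, fun Z hZ => ?_⟩
  rw [lich, this.2 Z hZ]
  funext x
  have : (4 : 𝕜) ≠ 0 := NeZero.ne _
  simp [this]

theorem lich_smooth {X Y} (hX : C.Smooth X) (hY : C.Smooth Y) : C.Smooth (C.lich ξ ξ' J X Y) :=
  (D.lich_spec L hX hY).1

theorem four_pair_lich {X Y Z} (hX : C.Smooth X) (hY : C.Smooth Y) (hZ : C.Smooth Z) :
    4 * C.pair (C.lich ξ ξ' J X Y) Z = C.lichForm ξ ξ' J X Y Z :=
  (D.lich_spec L hX hY).2 Z hZ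

omit L D in
theorem four_mul_cancel {f h : M → 𝕜} (H : 4 * f = 4 * h) : f = h := by
  funext x
  have := congrFun H x
  exact mul_left_cancel₀ (NeZero.ne (4 : 𝕜)) (by simpa using this)

omit D in
theorem ext_of_four_pair {A B : Π x, W x}
    (h : ∀ Z, C.Smooth Z → 4 * C.pair A Z = 4 * C.pair B Z) : A = B :=
  L.ext_of_pair fun Z hZ => four_mul_cancel (h Z hZ)

theorem lich_add_left {X X' Y} (hX : C.Smooth X) (hX' : C.Smooth X') (hY : C.Smooth Y) :
    C.lich ξ ξ' J (X + X') Y = C.lich ξ ξ' J X Y + C.lich ξ ξ' J X' Y := by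
  refine ext_of_four_pair L fun Z hZ => ?_
  rw [pair_add_left, mul_add, D.four_pair_lich L (L.smooth_add hX hX') hY hZ,
    D.four_pair_lich L hX hY hZ, D.four_pair_lich L hX' hY hZ, D.lichForm_add_left L hX hX' hY hZ]

theorem lich_add_right {X Y Y'} (hX : C.Smooth X) (hY : C.Smooth Y) (hY' : C.Smooth Y') :
    C.lich ξ ξ' J X (Y + Y') = C.lich ξ ξ' J X Y + C.lich ξ ξ' J X Y' := by
  refine ext_of_four_pair L fun Z hZ => ?_
  rw [pair_add_left, mul_add, D.four_pair_lich L hX (L.smooth_add hY hY') hZ,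
    D.four_pair_lich L hX hY hZ, D.four_pair_lich L hX hY' hZ, D.lichForm_add_mid L hX hY hY' hZ]

theorem lich_smul_left {X Y f} (hf : F Set.univ f) (hX : C.Smooth X) (hY : C.Smooth Y) :
    C.lich ξ ξ' J (fun x => f x • X x) Y = fun x => f x • C.lich ξ ξ' J X Y x := by
  refine ext_of_four_pair L fun Z hZ => ?_
  rw [pair_smul_left, D.four_pair_lich L (L.smooth_smul hf hX) hY hZ,
    D.lichForm_smul_left L hX hY hZ hf, ← D.four_pair_lich L hX hY hZ]
  ring

theorem lich_leibniz {X Y f} (hf : F Set.univ f) (hX : C.Smooth X) (hY : C.Smooth Y) :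
    C.lich ξ ξ' J X (fun x => f x • Y x) =
      fun x => f x • C.lich ξ ξ' J X Y x + C.der X f x • Y x := by
  refine ext_of_four_pair L fun Z hZ => ?_
  have : (fun x => f x • C.lich ξ ξ' J X Y x + C.der X f x • Y x) =
    (fun x => f x • C.lich ξ ξ' J X Y x) + fun x => C.der X f x • Y x := rfl
  rw [this, pair_add_left, pair_smul_left, pair_smul_left,
    D.four_pair_lich L hX (L.smooth_smul hf hY) hZ,
    D.lichForm_leibniz L hX hY hZ hf, ← D.four_pair_lich L hX hY hZ]
  ring

theorem lich_metric {X Y Z} (hX : C.Smooth X) (hY : C.Smooth Y) (hZ : C.Smooth Z) :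
    C.der X (C.pair Y Z) = C.pair (C.lich ξ ξ' J X Y) Z + C.pair Y (C.lich ξ ξ' J X Z) := by
  refine four_mul_cancel ?_
  rw [mul_add, L.pair_comm Y (C.lich ξ ξ' J X Z), D.four_pair_lich L hX hY hZ, D.four_pair_lich L hX hZ hY,
    D.lichForm_antisymm L hX hY hZ]

/-- Projecting Y to R or Z to R* leaves the same single term of `lichForm`, and adjointness moves
the projection from Z to the connection. -/
theorem lich_line {X Y} (hX : C.Smooth X) (hY : C.Smooth Y) :
    C.lich ξ ξ' J X (endo (C.lineProj ξ ξ') Y) =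
      endo (C.lineProj ξ ξ') (C.lich ξ ξ' J X Y) := by
  have s1 := D.smooth_line L
  have s2 := D.smooth_line' L
  have s3 := D.smooth_screen L
  have s5 := D.smooth_J
  refine ext_of_four_pair L fun Z hZ => ?_
  rw [D.adjoint_line L, D.four_pair_lich L hX (s1 _ hY) hZ, D.four_pair_lich L hX hY (s2 _ hZ)]
  simp only [lichForm, D.line_line L, D.line'_line L, D.line_line' L, D.line'_line' L,
    D.screen_line L, D.screen_line' L, D.J_line L, D.J_line' L,
    L.koszulWith_zero_mid hX (s1 _ hZ), L.koszulWith_zero_mid hX (s3 _ hZ),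
    L.koszulWith_zero_mid hX (s5 _ hZ), L.koszulWith_zero_right hX (s2 _ hY),
    L.koszulWith_zero_right hX (s3 _ hY), L.koszulWith_zero_right hX (s5 _ hY)]

theorem lich_line' {X Y} (hX : C.Smooth X) (hY : C.Smooth Y) :
    C.lich ξ ξ' J X (endo (C.lineProj ξ' ξ) Y) =
      endo (C.lineProj ξ' ξ) (C.lich ξ ξ' J X Y) := by
  have s1 := D.smooth_line L
  have s2 := D.smooth_line' L
  have s3 := D.smooth_screen L
  have s5 := D.smooth_J
  refine ext_of_four_pair L fun Z hZ => ?_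
  rw [D.adjoint_line' L, D.four_pair_lich L hX (s2 _ hY) hZ, D.four_pair_lich L hX hY (s1 _ hZ)]
  simp only [lichForm, D.line_line L, D.line'_line L, D.line_line' L, D.line'_line' L,
    D.screen_line L, D.screen_line' L, D.J_line L, D.J_line' L,
    L.koszulWith_zero_mid hX (s2 _ hZ), L.koszulWith_zero_mid hX (s3 _ hZ),
    L.koszulWith_zero_mid hX (s5 _ hZ), L.koszulWith_zero_right hX (s1 _ hY),
    L.koszulWith_zero_right hX (s3 _ hY), L.koszulWith_zero_right hX (s5 _ hY)]

theorem lich_screen {X Y} (hX : C.Smooth X) (hY : C.Smooth Y) :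
    C.lich ξ ξ' J X (endo (C.screenProj ξ ξ') Y) =
      endo (C.screenProj ξ ξ') (C.lich ξ ξ' J X Y) := by
  have s1 := D.smooth_line L
  have s2 := D.smooth_line' L
  have s3 := D.smooth_screen L
  refine ext_of_four_pair L fun Z hZ => ?_
  rw [D.adjoint_screen L, D.four_pair_lich L hX (s3 _ hY) hZ, D.four_pair_lich L hX hY (s3 _ hZ)]
  simp only [lichForm, D.line_screen L, D.line'_screen L, D.screen_screen L, D.J_screen L,
    L.koszulWith_zero_mid hX (s2 _ hZ), L.koszulWith_zero_mid hX (s1 _ hZ),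
    L.koszulWith_zero_right hX (s1 _ hY), L.koszulWith_zero_right hX (s2 _ hY)]

omit D in
theorem koszulWith_neg_mid {T X Y Z} (hX : C.Smooth X) (hY : C.Smooth Y) (hZ : C.Smooth Z) :
    C.koszulWith T X (-Y) Z = -C.koszulWith T X Y Z := by
  have := L.koszulWith_add_mid (T := T) hX hY (L.smooth_neg hY) hZ
  rw [add_neg_cancel, L.koszulWith_zero_mid hX hZ] at this
  linear_combination -this

omit D in
theorem koszulWith_neg_right {T X Y Z} (hX : C.Smooth X) (hY : C.Smooth Y) (hZ : C.Smooth Z) :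
    C.koszulWith T X Y (-Z) = -C.koszulWith T X Y Z := by
  have := L.koszulWith_add_right (T := T) hX hY hZ (L.smooth_neg hZ)
  rw [add_neg_cancel, L.koszulWith_zero_right hX hY] at this
  linear_combination -this

/-- Since J² = -1 on the screen, moving J from Y to Z exchanges the two screen terms of `lichForm`
up to sign, while the null terms vanish. The J-average is there for this purpose. -/
theorem lich_J {X Y} (hX : C.Smooth X) (hY : C.Smooth Y) :
    C.lich ξ ξ' J X (endo J Y) = endo J (C.lich ξ ξ' J X Y) := by
  have s1 := D.smooth_line L
  have s2 := D.smooth_line' L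
  have s3 := D.smooth_screen L
  have s5 := D.smooth_J
  refine ext_of_four_pair L fun Z hZ => ?_
  rw [D.adjoint_J, mul_neg, D.four_pair_lich L hX (s5 _ hY) hZ, D.four_pair_lich L hX hY (s5 _ hZ)]
  simp only [lichForm, D.line_J L, D.line'_J L, D.screen_J L, D.J_J L,
    L.koszulWith_zero_mid hX (s2 _ hZ), L.koszulWith_zero_mid hX (s1 _ hZ),
    L.koszulWith_zero_right hX (s1 _ hY), L.koszulWith_zero_right hX (s2 _ hY),
    koszulWith_neg_mid L hX (s3 _ hY) (s5 _ hZ), koszulWith_neg_right L hX (s5 _ hY) (s3 _ hZ)]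
  ring

end IsScreenData
end Calculus
end Koszul


/-! ### Torsion of the Lichnerowicz connection paired with test sections. -/

section Torsion

variable {𝕜 : Type*} [Field 𝕜] {M : Type*} [TopologicalSpace M] {W : M → Type*}
  [∀ x, AddCommGroup (W x)] [∀ x, Module 𝕜 (W x)]

theorem endo_neg (A : Π x, W x →ₗ[𝕜] W x) (X : Π x, W x) : endo A (-X) = -endo A X := by
  funext x; simp [endo]

namespace Calculus

theorem IsLawful.der_neg_left {C : Calculus 𝕜 M W} {F : Set M → (M → 𝕜) → Prop}
    (L : C.IsLawful F) (X f) : C.der (-X) f = -C.der X f := by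
  have := L.der_smul_left (fun _ => -1) X f
  simp only [neg_one_smul] at this
  change C.der (-X) f = _ at this
  rw [this]
  funext x
  simp

/-- `X` is orthogonal to `ξ` and `ξ'`. -/
structure IsOrth (C : Calculus 𝕜 M W) (ξ ξ' X : Π x, W x) : Prop where
  left : C.pair X ξ = 0
  right : C.pair X ξ' = 0

namespace IsOrth

variable {C : Calculus 𝕜 M W} {ξ ξ' X : Π x, W x} (h : C.IsOrth ξ ξ' X)
include h

theorem line : endo (C.lineProj ξ ξ') X = 0 := by
  funext x
  change C.pair X ξ' x • ξ x = 0
  simp [h.right]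

theorem line' : endo (C.lineProj ξ' ξ) X = 0 := by
  funext x
  change C.pair X ξ x • ξ' x = 0
  simp [h.left]

theorem screen : endo (C.screenProj ξ ξ') X = X := by
  change X - endo (C.lineProj ξ ξ') X - endo (C.lineProj ξ' ξ) X = X
  rw [h.line, h.line', sub_zero, sub_zero]

theorem plane : endo (C.planeProj ξ ξ') X = 0 := by
  change endo (C.lineProj ξ ξ') X + endo (C.lineProj ξ' ξ) X = 0
  rw [h.line, h.line', zero_add]

end IsOrth

/-- The `2`-form `g(J·, ·)`. -/
def fundForm (C : Calculus 𝕜 M W) (J : Π x, W x →ₗ[𝕜] W x) (X Y : Π x, W x) : M → 𝕜 :=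
  C.pair (endo J X) Y

namespace IsScreenData

variable {C : Calculus 𝕜 M W} {F : Set M → (M → 𝕜) → Prop} (L : C.IsLawful F)
  {ξ ξ' : Π x, W x} {J : Π x, W x →ₗ[𝕜] W x} (D : C.IsScreenData ξ ξ' J)
include L D

theorem isOrth_J (X : Π x, W x) : C.IsOrth ξ ξ' (endo J X) :=
  ⟨funext fun x => D.pair_J_left L x _, funext fun x => D.pair_J_right L x _⟩

theorem isOrth_screen (X) : C.IsOrth ξ ξ' (endo (C.screenProj ξ ξ') X) := by
  constructor <;> funext x <;>
    simp [pair, endo, screenProj, lineProj, D.null, D.null', D.dual, D.dual' L]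

theorem J_J_of_isOrth {X} (hX : C.IsOrth ξ ξ' X) : endo J (endo J X) = -X := by
  rw [D.J_J L, hX.screen]

theorem isOrth_iff_screen {X} : C.IsOrth ξ ξ' X ↔ endo (C.screenProj ξ ξ') X = X :=
  ⟨fun h => h.screen, fun h => h ▸ D.isOrth_screen L X⟩

/-- The construction is symmetric in the two null sections, so with `lich_swap` every statement
about ξ yields the one about ξ'. -/
theorem swap : C.IsScreenData ξ' ξ J where
  smooth := D.smooth'
  smooth' := D.smooth
  null := D.null'
  null' := D.null
  dual := D.dual' L
  smooth_J := D.smooth_J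
  J_left := D.J_right
  J_right := D.J_left
  skew := D.skew
  sq x v := by rw [D.sq, sub_right_comm]

omit L D in
theorem screenProj_swap : C.screenProj ξ' ξ = C.screenProj ξ ξ' :=
  funext fun _ => sub_right_comm _ _ _

omit L D in
theorem planeProj_swap : C.planeProj ξ' ξ = C.planeProj ξ ξ' :=
  funext fun _ => add_comm _ _

omit L D in
theorem lich_swap : C.lich ξ' ξ J = C.lich ξ ξ' J := by
  funext X Y
  simp only [lich, lichForm, screenProj_swap (ξ := ξ) (ξ' := ξ'),
    planeProj_swap (ξ := ξ) (ξ' := ξ')]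
  congr 1
  funext Z
  ring

variable [NeZero (4 : 𝕜)]

theorem isOrth_lich {X Y} (hX : C.Smooth X) (hY : C.Smooth Y) (oY : C.IsOrth ξ ξ' Y) :
    C.IsOrth ξ ξ' (C.lich ξ ξ' J X Y) := by
  rw [D.isOrth_iff_screen L, ← D.lich_screen L hX hY, oY.screen]

theorem line_left : endo (C.lineProj ξ ξ') ξ = ξ := by
  funext x; simp [endo, lineProj, D.dual]

theorem lich_left {X} (hX : C.Smooth X) :
    endo (C.lineProj ξ ξ') (C.lich ξ ξ' J X ξ) = C.lich ξ ξ' J X ξ := by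
  rw [← D.lich_line L hX D.smooth, D.line_left L]

/-- The line R is parallel, so ∇_X ξ is a multiple of ξ. -/
theorem pair_lich_left {X Z} (hX : C.Smooth X) (hZ : C.pair ξ Z = 0) :
    C.pair (C.lich ξ ξ' J X ξ) Z = 0 := by
  rw [← D.lich_left L hX]
  change C.pair (fun x => C.pair (C.lich ξ ξ' J X ξ) ξ' x • ξ x) Z = 0
  rw [pair_smul_left, hZ, mul_zero]

theorem pair_lich_right {X Z} (hX : C.Smooth X) (hZ : C.pair ξ' Z = 0) :
    C.pair (C.lich ξ ξ' J X ξ') Z = 0 := by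
  have := (D.swap L).pair_lich_left L hX hZ
  rwa [lich_swap] at this

omit L D in
theorem pair_torsion (X Y Z) : C.pair (C.torsion (C.lich ξ ξ' J) X Y) Z =
    C.pair (C.lich ξ ξ' J X Y) Z - C.pair (C.lich ξ ξ' J Y X) Z - C.pair (C.bracket X Y) Z := by
  simp only [torsion, pair_sub_left]

theorem four_pair_lich_of_isOrth {X Y Z} (hX : C.Smooth X) (hY : C.Smooth Y) (hZ : C.Smooth Z)
    (oY : C.IsOrth ξ ξ' Y) (oZ : C.IsOrth ξ ξ' Z) :
    4 * C.pair (C.lich ξ ξ' J X Y) Z =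
      C.koszulWith (endo (C.planeProj ξ ξ') X) X Y Z
        + C.koszulWith (endo (C.planeProj ξ ξ') X) X (endo J Y) (endo J Z) := by
  rw [D.four_pair_lich L hX hY hZ]
  simp only [lichForm, oY.line, oY.line', oY.screen, oZ.line, oZ.line', oZ.screen,
    L.koszulWith_zero_mid hX L.smooth_zero]
  ring

/-- For Y in R and Z in R* only the first term of `lichForm` survives. -/
theorem two_pair_lich_null {X Y Z} (hX : C.Smooth X) (hY : C.Smooth Y) (hZ : C.Smooth Z)
    (lY : endo (C.lineProj ξ ξ') Y = Y) (lZ : endo (C.lineProj ξ' ξ) Z = Z) :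
    2 * C.pair (C.lich ξ ξ' J X Y) Z = C.koszulWith (endo (C.screenProj ξ ξ') X) X Y Z := by
  have h2 := D.four_pair_lich L hX hY hZ
  have y1 : endo (C.lineProj ξ' ξ) Y = 0 := by rw [← lY, D.line'_line L]
  have y2 : endo (C.screenProj ξ ξ') Y = 0 := by rw [← lY, D.screen_line L]
  have y3 : endo J Y = 0 := by rw [← lY, D.J_line L]
  simp only [lichForm, y1, y2, y3, L.koszulWith_zero_mid hX (D.smooth_line L _ hZ),
    L.koszulWith_zero_mid hX (D.smooth_screen L _ hZ), L.koszulWith_zero_mid hX (D.smooth_J _ hZ),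
    lY, lZ] at h2
  refine four_mul_cancel (𝕜 := 𝕜) ?_
  linear_combination 2 * h2

theorem two_pair_lich_null' {X Y Z} (hX : C.Smooth X) (hY : C.Smooth Y) (hZ : C.Smooth Z)
    (lY : endo (C.lineProj ξ' ξ) Y = Y) (lZ : endo (C.lineProj ξ ξ') Z = Z) :
    2 * C.pair (C.lich ξ ξ' J X Y) Z = C.koszulWith (endo (C.screenProj ξ ξ') X) X Y Z := by
  have := (D.swap L).two_pair_lich_null L hX hY hZ lY lZ
  rwa [lich_swap, screenProj_swap] at this

theorem line'_right : endo (C.lineProj ξ' ξ) ξ' = ξ' := (D.swap L).line_left L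

/-- The torsion of the Lichnerowicz connection along the screen bundle. -/
theorem four_pair_torsion_screen {X Y Z} (hX : C.Smooth X) (hY : C.Smooth Y) (hZ : C.Smooth Z)
    (oX : C.IsOrth ξ ξ' X) (oY : C.IsOrth ξ ξ' Y) (oZ : C.IsOrth ξ ξ' Z) :
    4 * C.pair (C.torsion (C.lich ξ ξ' J) X Y) Z =
      -C.pair (endo (C.screenProj ξ ξ') (C.bracket X Y - C.bracket (endo J X) (endo J Y))
          + endo J (C.bracket (endo J X) Y) + endo J (C.bracket X (endo J Y))) Z
        + (C.d₂ (C.fundForm J) (endo J X) (endo J Y) (endo J Z)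
          + C.d₂ (C.fundForm J) (endo J (endo J X)) (endo J (endo J Y)) (endo J Z)) := by
  have jX := D.smooth_J _ hX
  have jY := D.smooth_J _ hY
  have jZ := D.smooth_J _ hZ
  have l1 := D.four_pair_lich_of_isOrth L hX hY hZ oY oZ
  have l2 := D.four_pair_lich_of_isOrth L hY hX hZ oX oZ
  -- These four identities fix one order for each symmetric or skew expression, so that both
  -- expansions share their atoms and the claim becomes linear in them.
  have c1 : C.pair Y (endo J X) = -C.pair X (endo J Y) := by rw [L.pair_comm, D.adjoint_J]
  have c2 : C.pair Y X = C.pair X Y := L.pair_comm _ _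
  have c3 : C.bracket Y X = -C.bracket X Y := L.bracket_comm _ _
  have c4 : C.bracket Y (endo J X) = -C.bracket (endo J X) Y := L.bracket_comm _ _
  rw [pair_torsion]
  simp only [oX.plane, oY.plane, koszulWith, pair_zero_right, add_zero, koszul, D.adjoint_J,
    D.J_J_of_isOrth L oZ, pair_neg_right, pair_neg_left,
    neg_neg, c1, c2, c3, c4] at l1 l2
  simp only [d₂, fundForm, pair_add_left, D.adjoint_screen L, oZ.screen, pair_sub_left,
    D.J_J_of_isOrth L oX, D.J_J_of_isOrth L oY, D.J_J_of_isOrth L oZ, D.adjoint_J,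
    pair_neg_right, pair_neg_left, endo_neg, L.der_neg_left, neg_neg,
    L.bracket_neg_left hX (L.smooth_neg hY), L.bracket_neg_right hX hY, L.bracket_neg_left hX jZ,
    L.bracket_neg_left hY jZ,
    L.der_neg _ (L.smooth_pair hY hZ), L.der_neg _ (L.smooth_pair hX hZ),
    L.der_neg _ (L.smooth_pair hX jY), L.der_neg _ (L.smooth_pair hY jZ),
    L.der_neg _ (L.smooth_pair hX jZ)] at l1 l2 ⊢
  linear_combination l1 - l2

/-- The torsion of the Lichnerowicz connection in a null direction and a screen direction. -/
theorem four_pair_torsion_null {η X Z} (hη : C.Smooth η) (hX : C.Smooth X) (hZ : C.Smooth Z)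
    (pη : endo (C.planeProj ξ ξ') η = η)
    (oX : C.IsOrth ξ ξ' X) (oZ : C.IsOrth ξ ξ' Z) (hd : C.pair (C.lich ξ ξ' J X η) Z = 0) :
    4 * C.pair (C.torsion (C.lich ξ ξ' J) η X) Z =
      2 * (C.lie₁ η (C.flat X) Z - C.pair (C.bracket η X) Z)
        + (C.lie₂ η (C.fundForm J) (endo J X) Z
          - C.lie₂ η (C.fundForm J) (endo J (endo J X)) (endo J Z)) := by
  have jX := D.smooth_J _ hX
  have jZ := D.smooth_J _ hZ
  have l1 := D.four_pair_lich_of_isOrth L hη hX hZ oX oZ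
  -- Because η lies in the null plane, its products with screen fields vanish, and the correction
  -- with T = η cancels the Koszul terms g([X,Z],η) and g([JX,JZ],η).
  have perp : ∀ A, C.IsOrth ξ ξ' A → C.pair η A = 0 := by
    intro A oA
    rw [← pη, L.pair_comm]
    exact plane_perp L _ _ oA.line oA.line'
  have c2 : C.pair Z X = C.pair X Z := L.pair_comm _ _
  rw [pair_torsion, hd]
  simp only [pη, koszulWith, koszul, perp _ oX, perp _ oZ, perp _ (D.isOrth_J L X),
    perp _ (D.isOrth_J L Z), L.der_zero, D.adjoint_J, D.J_J_of_isOrth L oZ,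
    pair_neg_right, neg_neg, L.pair_comm (C.bracket η Z) X,
    L.pair_comm (C.bracket η (endo J Z)) (endo J X)] at l1
  simp only [lie₁, lie₂, flat, fundForm, D.J_J_of_isOrth L oX, D.J_J_of_isOrth L oZ, D.adjoint_J,
    pair_neg_right, pair_neg_left, endo_neg, neg_neg, L.bracket_neg_right hη hX,
    L.der_neg _ (L.smooth_pair hX hZ)]
  linear_combination l1

/-- Only the bracket contributes: ∇_ξ X lies in S and ∇_X ξ in R, both orthogonal to ξ. -/
theorem pair_torsion_null_left {X} (hX : C.Smooth X) (oX : C.IsOrth ξ ξ' X) :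
    C.pair (C.torsion (C.lich ξ ξ' J) ξ X) ξ = -C.pair (C.bracket ξ X) ξ := by
  have h1 := (D.isOrth_lich L D.smooth hX oX).left
  have h2 := D.pair_lich_left L hX (Z := ξ) (funext D.null)
  rw [pair_torsion, h1, h2]
  ring

/-- Here ∇_X ξ contributes. As g(ξ,ξ') is constant, no derivatives remain in the Koszul expression,
and the correction with T = X removes g([ξ,ξ'],X); the remaining brackets form the Lie derivative of
g. -/
theorem two_pair_torsion_null_right {X} (hX : C.Smooth X) (oX : C.IsOrth ξ ξ' X) :
    2 * C.pair (C.torsion (C.lich ξ ξ' J) ξ X) ξ' = -C.lie₂ X C.pair ξ ξ' := by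
  have h1 := (D.isOrth_lich L D.smooth hX oX).right
  have h2 := D.two_pair_lich_null L hX D.smooth D.smooth' (D.line_left L) (D.line'_right L)
  have hdual : C.pair ξ ξ' = fun _ => 1 := funext D.dual
  simp only [oX.screen, koszulWith, koszul, oX.left, oX.right, hdual, L.der_const, L.der_zero] at h2
  refine four_mul_cancel (𝕜 := 𝕜) ?_
  rw [pair_torsion, h1]
  simp only [lie₂, hdual, L.der_const, L.bracket_comm ξ X, pair_neg_left,
    L.pair_comm ξ (C.bracket X ξ')]
  linear_combination -4 * h2

theorem pair_torsion_null_dual_left :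
    C.pair (C.torsion (C.lich ξ ξ' J) ξ ξ') ξ = 0 := by
  have h1 := D.pair_lich_left L D.smooth' (Z := ξ) (funext D.null)
  have h2 := D.two_pair_lich_null' L D.smooth D.smooth' D.smooth (D.line'_right L) (D.line_left L)
  have hnull : C.pair ξ ξ = 0 := funext D.null
  have hdual : C.pair ξ ξ' = fun _ => 1 := funext D.dual
  have e3 : endo (C.screenProj ξ ξ') ξ = 0 := by
    have := D.screen_line L ξ
    rwa [D.line_left L] at this
  -- The Koszul expression contains [ξ,ξ], which the rules give only as its own negative. Twice it
  -- vanishes, which is enough after multiplication by four.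
  have hself : C.bracket ξ ξ = -C.bracket ξ ξ := L.bracket_comm _ _
  have hself' := congrArg (fun A => C.pair A ξ') hself
  simp only [pair_neg_left] at hself'
  simp only [e3, koszulWith, koszul, L.pair_comm ξ' ξ, pair_zero_right, L.bracket_comm ξ' ξ,
    pair_neg_left, hdual, hnull, L.der_const, L.der_zero] at h2
  refine four_mul_cancel (𝕜 := 𝕜) ?_
  rw [pair_torsion, h1]
  linear_combination 2 * h2 - hself'

theorem torsion_swap {X Y} :
    C.torsion (C.lich ξ ξ' J) X Y = -C.torsion (C.lich ξ ξ' J) Y X := by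
  simp only [torsion, L.bracket_comm Y X]
  abel

theorem pair_torsion_null_dual_right :
    C.pair (C.torsion (C.lich ξ ξ' J) ξ ξ') ξ' = 0 := by
  have := (D.swap L).pair_torsion_null_dual_left L
  rw [lich_swap] at this
  rw [D.torsion_swap L, pair_neg_left, this, neg_zero]

theorem pair_torsion_null_dual_screen {Z} (oZ : C.IsOrth ξ ξ' Z) :
    C.pair (C.torsion (C.lich ξ ξ' J) ξ ξ') Z = -C.pair (C.bracket ξ ξ') Z := by
  have h1 := D.pair_lich_left L D.smooth' (Z := Z) (by rw [L.pair_comm, oZ.left])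
  have h2 := D.pair_lich_right L D.smooth (Z := Z) (by rw [L.pair_comm, oZ.right])
  rw [pair_torsion, h1, h2]
  ring

/-- Two sections agree if their products with `ξ`, `ξ'` and the screen sections do. -/
theorem ext_of_pair_frame {A B : Π x, W x} (h1 : C.pair A ξ = C.pair B ξ)
    (h2 : C.pair A ξ' = C.pair B ξ')
    (h : ∀ Z, C.Smooth Z → C.IsOrth ξ ξ' Z → C.pair A Z = C.pair B Z) : A = B := by
  refine L.ext_of_pair fun Z hZ => ?_
  have hs := h _ (D.smooth_screen L Z hZ) (D.isOrth_screen L Z)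
  have e : Z = endo (C.screenProj ξ ξ') Z + (fun x => C.pair Z ξ' x • ξ x)
      + fun x => C.pair Z ξ x • ξ' x := by
    funext x; simp [endo, screenProj, lineProj, pair]; abel
  rw [e]
  simp only [pair_add_right, pair_smul_right, hs, h1, h2]

/-- The Lichnerowicz connection on eigensections of `J`. -/
theorem two_pair_lich_eigen {i : 𝕜} (hi : i * i = -1) {X Y Z} (hX : C.Smooth X) (hY : C.Smooth Y)
    (hZ : C.Smooth Z) (jY : endo J Y = fun x => i • Y x) (jZ : endo J Z = fun x => (-i) • Z x) :
    2 * C.pair (C.lich ξ ξ' J X Y) Z = C.koszulWith (endo (C.planeProj ξ ξ') X) X Y Z := by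
  -- An eigensection with invertible eigenvalue lies in the image of J, hence in the screen.
  have key : ∀ (c : 𝕜) A, c * c = -1 → endo J A = (fun x => c • A x) → C.IsOrth ξ ξ' A := by
    intro c A hc hA
    have h := D.isOrth_J L A
    have e : A = fun x => (fun _ => -c) x • endo J A x := by
      funext x
      simp [hA, smul_smul, hc]
    constructor
    · rw [e, pair_smul_left, h.left, mul_zero]
    · rw [e, pair_smul_left, h.right, mul_zero]
  have oY := key i Y hi jY
  have oZ := key (-i) Z (by rw [neg_mul_neg, hi]) jZ
  have l := D.four_pair_lich_of_isOrth L hX hY hZ oY oZ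
  have cs := L.fun_const Set.univ
  rw [jY, jZ, L.koszulWith_smul_mid hX hY (L.smooth_smul (cs _) hZ) (cs i)
      (plane_perp L _ _ oY.line oY.line'),
    L.koszulWith_smul_right hX hY hZ (cs (-i)) (plane_perp L _ _ oZ.line oZ.line'),
    L.der_const] at l
  -- The eigenvalues i and -i multiply to 1, so the J-term of the average repeats the plain term.
  have hii : (fun _ : M => i) * (fun _ : M => -i) = 1 := by funext x; simp [hi]
  refine four_mul_cancel (𝕜 := 𝕜) ?_
  linear_combination 2 * l
    + 2 * C.koszulWith (endo (C.planeProj ξ ξ') X) X Y Z * hii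

end IsScreenData
end Calculus
end Torsion


/-! ### The tangent bundle obeys the rules. -/

section RealLaws

variable {E : Type*} [NormedAddCommGroup E] [NormedSpace ℝ E]
  {M : Type*} [TopologicalSpace M] [ChartedSpace E M] [IsManifold 𝓘(ℝ, E) ∞ M]

variable (E) in
/-- Smoothness on `U` of a function. -/
def SmoothFunOn (G : Type*) [NormedAddCommGroup G] [NormedSpace ℝ G] (U : Set M) (f : M → G) :
    Prop := ContMDiffOn 𝓘(ℝ, E) 𝓘(ℝ, G) ∞ f U

theorem SmoothFunOn.mdifferentiableAt {G : Type*} [NormedAddCommGroup G] [NormedSpace ℝ G]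
    {f : M → G} (hf : SmoothFunOn E G Set.univ f) (x : M) :
    MDifferentiableAt 𝓘(ℝ, E) 𝓘(ℝ, G) f x :=
  (contMDiffOn_univ.mp hf).mdifferentiable (by simp) x

theorem SmoothFieldOn.mdifferentiableAt {X : Π x : M, TangentSpace 𝓘(ℝ, E) x}
    (hX : SmoothFieldOn Set.univ X) (x : M) :
    MDifferentiableAt 𝓘(ℝ, E) 𝓘(ℝ, E).tangent
      (fun x => (⟨x, X x⟩ : TangentBundle 𝓘(ℝ, E) M)) x :=
  (contMDiffOn_univ.mp hX).mdifferentiable (by simp) x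

/-- The function df(X) is the fibre part of the tangent map of f composed with X, and both maps are
smooth. -/
theorem SmoothFunOn.mvfderiv_apply {G : Type*} [NormedAddCommGroup G] [NormedSpace ℝ G]
    {f : M → G} (hf : SmoothFunOn E G Set.univ f) {X : Π x : M, TangentSpace 𝓘(ℝ, E) x}
    (hX : SmoothFieldOn Set.univ X) :
    SmoothFunOn E G Set.univ (fun x => mvfderiv 𝓘(ℝ, E) f x (X x)) := by
  have h1 : ContMDiff 𝓘(ℝ, E).tangent 𝓘(ℝ, G).tangent ∞ (tangentMap 𝓘(ℝ, E) 𝓘(ℝ, G) f) :=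
    (contMDiffOn_univ.mp hf).contMDiff_tangentMap (by simp)
  have h2 := (contMDiff_snd_tangentBundle_modelSpace (n := ∞) G 𝓘(ℝ, G)).comp
    (h1.comp (contMDiffOn_univ.mp hX))
  exact contMDiffOn_univ.mpr h2

theorem contMDiffOn_univ_of_local {H' : Type*} [TopologicalSpace H'] {E' : Type*}
    [NormedAddCommGroup E'] [NormedSpace ℝ E'] {I' : ModelWithCorners ℝ E' H'} {M' : Type*}
    [TopologicalSpace M'] [ChartedSpace H' M'] {f : M → M'}
    (h : ∀ x, ∃ U, IsOpen U ∧ x ∈ U ∧ ContMDiffOn 𝓘(ℝ, E) I' ∞ f U) :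
    ContMDiffOn 𝓘(ℝ, E) I' ∞ f Set.univ := by
  refine contMDiffOn_univ.mpr fun x => ?_
  obtain ⟨U, hU, hx, hf⟩ := h x
  exact hf.contMDiffAt (hU.mem_nhds hx)

theorem SmoothFieldOn.smul {U : Set M} {f : M → ℝ} {X : Π x : M, TangentSpace 𝓘(ℝ, E) x}
    (hf : SmoothFunOn E ℝ U f) (hX : SmoothFieldOn U X) :
    SmoothFieldOn U (fun x => f x • X x) :=
  ContMDiffOn.smul_section hf hX

theorem SmoothFieldOn.add {U : Set M} {X Y : Π x : M, TangentSpace 𝓘(ℝ, E) x}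
    (hX : SmoothFieldOn U X) (hY : SmoothFieldOn U Y) :
    SmoothFieldOn U (fun x => X x + Y x) :=
  ContMDiffOn.add_section hX hY

theorem SmoothFieldOn.sub {U : Set M} {X Y : Π x : M, TangentSpace 𝓘(ℝ, E) x}
    (hX : SmoothFieldOn U X) (hY : SmoothFieldOn U Y) :
    SmoothFieldOn U (fun x => X x - Y x) :=
  ContMDiffOn.sub_section hX hY

theorem smoothFieldOn_zero (U : Set M) :
    SmoothFieldOn U (fun x : M => (0 : TangentSpace 𝓘(ℝ, E) x)) :=
  (Bundle.contMDiff_zeroSection ℝ (fun x : M => TangentSpace 𝓘(ℝ, E) x)).contMDiffOn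

theorem SmoothFieldOn.congr {U : Set M} {X Y : Π x : M, TangentSpace 𝓘(ℝ, E) x}
    (hX : SmoothFieldOn U X) (h : ∀ x ∈ U, Y x = X x) : SmoothFieldOn U Y :=
  ContMDiffOn.congr hX fun x hx => by rw [h x hx]

/-- A bump function with closed support inside U. Products with it are smooth on U, and zero on the
open complement of that support; these two sets cover M. The target G is arbitrary so that the same
real function also serves complex-valued functions. -/
theorem exists_cutoff [FiniteDimensional ℝ E] [T2Space M] {U : Set M} {x : M} (hU : IsOpen U)
    (hx : x ∈ U) : ∃ χ : M → ℝ, SmoothFunOn E ℝ Set.univ χ ∧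
    (∃ V, IsOpen V ∧ x ∈ V ∧ V ⊆ U ∧ ∀ y ∈ V, χ y = 1) ∧ (∀ y ∉ U, χ y = 0) ∧
    (∀ (G : Type) [NormedAddCommGroup G] [NormedSpace ℝ G] (f : M → G), SmoothFunOn E G U f →
      SmoothFunOn E G Set.univ (fun y => χ y • f y)) ∧
    ∀ X : Π x : M, TangentSpace 𝓘(ℝ, E) x, SmoothFieldOn U X →
      SmoothFieldOn Set.univ (fun y => χ y • X y) := by
  obtain ⟨χ, -, hχ⟩ := (SmoothBumpFunction.nhds_basis_tsupport (I := 𝓘(ℝ, E)) x).mem_iff.mp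
    (hU.mem_nhds hx)
  obtain ⟨V, hV1, hV, hxV⟩ := eventually_nhds_iff.mp χ.eventuallyEq_one
  refine ⟨χ, contMDiffOn_univ.mpr χ.contMDiff, ⟨V ∩ U, hV.inter hU, ⟨hxV, hx⟩,
    Set.inter_subset_right, fun y hy => hV1 y hy.1⟩, fun y hy => ?_, fun G _ _ f hf => ?_,
    fun X hX => ?_⟩
  · exact image_eq_zero_of_notMem_tsupport fun h => hy (hχ h)
  · refine contMDiffOn_univ_of_local fun y => ?_
    by_cases hy : y ∈ U
    · exact ⟨U, hU, hy, χ.contMDiff.contMDiffOn.smul hf⟩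
    · refine ⟨(tsupport χ)ᶜ, (isClosed_tsupport χ).isOpen_compl, fun h => hy (hχ h), ?_⟩
      refine ContMDiffOn.congr (contMDiffOn_const (c := (0 : G))) fun z hz => ?_
      simp [image_eq_zero_of_notMem_tsupport hz]
  · refine contMDiffOn_univ_of_local fun y => ?_
    by_cases hy : y ∈ U
    · exact ⟨U, hU, hy, SmoothFieldOn.smul χ.contMDiff.contMDiffOn hX⟩
    · refine ⟨(tsupport χ)ᶜ, (isClosed_tsupport χ).isOpen_compl, fun h => hy (hχ h), ?_⟩
      refine SmoothFieldOn.congr (smoothFieldOn_zero _) fun z hz => ?_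
      simp [image_eq_zero_of_notMem_tsupport hz]

theorem exists_frame [FiniteDimensional ℝ E] (x₀ : M) :
    ∃ U : Set M, IsOpen U ∧ x₀ ∈ U ∧
      ∃ e : Fin (Module.finrank ℝ E) → Π x : M, TangentSpace 𝓘(ℝ, E) x,
      (∀ a, SmoothFieldOn U (e a)) ∧ ∀ x ∈ U, LinearIndependent ℝ (fun a => e a x) ∧
        Submodule.span ℝ (Set.range fun a => e a x) = ⊤ := by
  let t := trivializationAt E (TangentSpace 𝓘(ℝ, E) : M → Type _) x₀
  have h := t.isLocalFrameOn_localFrame_baseSet 𝓘(ℝ, E) ∞ (Module.finBasis ℝ E)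
  exact ⟨t.baseSet, t.open_baseSet, FiberBundle.mem_baseSet_trivializationAt' x₀,
    t.localFrame (Module.finBasis ℝ E), h.contMDiffOn,
    fun x hx => ⟨h.linearIndependent hx, top_le_iff.mp (h.generating hx)⟩⟩

theorem realCalculus_isLawful [FiniteDimensional ℝ E] [CompleteSpace E] [T2Space M]
    (g : PseudoMetric E M) : (realCalculus g).IsLawful (SmoothFunOn E ℝ) where
  fun_const U c := contMDiffOn_const
  fun_add hf hh := ContMDiffOn.add hf hh
  fun_mul hf hh := ContMDiffOn.mul hf hh
  fun_inv hf h := ContMDiffOn.inv₀ hf h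
  fun_mono h hf := ContMDiffOn.mono hf h
  fun_congr hf h := ContMDiffOn.congr hf h
  fun_ne {U f x} hf hU hx h0 := by
    have hc : ContinuousOn f U := ContMDiffOn.continuousOn hf
    exact ⟨U ∩ f ⁻¹' {0}ᶜ, hc.isOpen_inter_preimage hU isOpen_compl_singleton, ⟨hx, h0⟩,
      Set.inter_subset_left, fun y hy => hy.2⟩
  sec_zero U := smoothFieldOn_zero U
  sec_add hX hY := SmoothFieldOn.add hX hY
  sec_smul hf hX := SmoothFieldOn.smul hf hX
  sec_mono h hX := ContMDiffOn.mono hX h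
  sec_congr hX h := SmoothFieldOn.congr hX h
  sec_local h := contMDiffOn_univ_of_local h
  cutoff hU hx := by
    obtain ⟨χ, h1, h2, h3, h4, h5⟩ := exists_cutoff (E := E) hU hx
    exact ⟨χ, h1, h2, h3, h4 ℝ, h5⟩
  frame x₀ := ⟨_, exists_frame x₀⟩
  pair_smooth {U X Y} hX hY := by
    have := ContMDiffOn.clm_bundle_apply₂ (g.contMDiff.contMDiffOn (s := U)) hX hY
    intro x hx
    have := this x hx
    rw [Bundle.contMDiffWithinAt_section] at this
    exact this
  symm x v w := g.symm x v w
  nondeg x v h := g.nondegenerate x v h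
  der_smooth hX hf := SmoothFunOn.mvfderiv_apply hf hX
  der_add_left X Y f := by funext x; simp [realCalculus]
  der_smul_left h X f := by funext x; simp [realCalculus]
  der_add X {f h} hf hh := by
    funext x
    simp [realCalculus, mvfderiv_add (hf.mdifferentiableAt x) (hh.mdifferentiableAt x)]
  der_mul X {f h} hf hh := by
    funext x
    simp [realCalculus, mvfderiv_mul (hf.mdifferentiableAt x) (hh.mdifferentiableAt x)]
  der_const X c := by funext x; simp [realCalculus, mvfderiv_const]
  bracket_smooth {X Y} hX hY := by
    have : IsManifold 𝓘(ℝ, E) (minSmoothness ℝ 2) M := by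
      rw [minSmoothness_of_isRCLikeNormedField]; infer_instance
    -- The bracket loses one derivative, which costs nothing since ∞ + 1 = ∞.
    have : IsManifold 𝓘(ℝ, E) (((⊤ : ℕ∞) : WithTop ℕ∞) + 1) M :=
      IsManifold.of_le (n := ∞) le_rfl
    refine contMDiffOn_univ.mpr fun x => ?_
    exact ContMDiffAt.mlieBracket_vectorField (n := ⊤) (m := ⊤) (contMDiffOn_univ.mp hX x)
      (contMDiffOn_univ.mp hY x) (by simp)
  bracket_swap X Y x := VectorField.mlieBracket_swap_apply
  bracket_add hX hY hZ x := VectorField.mlieBracket_add_right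
    (SmoothFieldOn.mdifferentiableAt hY x) (SmoothFieldOn.mdifferentiableAt hZ x)
  bracket_smul {X Y f} hX hY hf x := by
    have := VectorField.mlieBracket_smul_right (V := X) (hf.mdifferentiableAt x)
      (SmoothFieldOn.mdifferentiableAt hY x)
    rw [add_comm]
    exact this

end RealLaws


/-! ### Complexified tangent spaces; complex fields obey the rules. -/

section ComplexTangent

variable {E : Type*} [NormedAddCommGroup E] [NormedSpace ℝ E]
  {M : Type*} [TopologicalSpace M] [ChartedSpace E M]

@[simp] theorem rePart_tmul (x : M) (c : ℂ) (v : TangentSpace 𝓘(ℝ, E) x) :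
    rePart x (c ⊗ₜ v) = c.re • v := by simp [rePart]

@[simp] theorem imPart_tmul (x : M) (c : ℂ) (v : TangentSpace 𝓘(ℝ, E) x) :
    imPart x (c ⊗ₜ v) = c.im • v := by simp [imPart]

@[simp] theorem rePart_ofReal (x : M) (v : TangentSpace 𝓘(ℝ, E) x) :
    rePart x (ofReal x v) = v := by simp [ofReal]

@[simp] theorem imPart_ofReal (x : M) (v : TangentSpace 𝓘(ℝ, E) x) :
    imPart x (ofReal x v) = 0 := by simp [ofReal]

theorem rePart_smul (x : M) (c : ℂ) (z : CTangent E x) :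
    rePart x (c • z) = c.re • rePart x z - c.im • imPart x z := by
  induction z using TensorProduct.induction_on with
  | zero => simp
  | tmul a v => simp [TensorProduct.smul_tmul', sub_smul, mul_smul]
  | add a b ha hb => simp only [smul_add, map_add, ha, hb]; abel

theorem imPart_smul (x : M) (c : ℂ) (z : CTangent E x) :
    imPart x (c • z) = c.re • imPart x z + c.im • rePart x z := by
  induction z using TensorProduct.induction_on with
  | zero => simp
  | tmul a v => simp [TensorProduct.smul_tmul', add_smul, mul_smul]
  | add a b ha hb => simp only [smul_add, map_add, ha, hb]; abel

theorem re_add_im (x : M) (z : CTangent E x) :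
    z = ofReal x (rePart x z) + Complex.I • ofReal x (imPart x z) := by
  induction z using TensorProduct.induction_on with
  | zero => simp
  | tmul a v =>
    simp only [rePart_tmul, imPart_tmul, ofReal, TensorProduct.mk_apply,
      TensorProduct.tmul_smul, TensorProduct.smul_tmul', ← TensorProduct.add_tmul]
    congr 1
    apply Complex.ext <;> simp
  | add a b ha hb =>
    nth_rewrite 1 [ha, hb]
    simp only [map_add, smul_add]
    abel

theorem CTangent.ext {x : M} {z w : CTangent E x} (h : rePart x z = rePart x w)
    (h' : imPart x z = imPart x w) : z = w := by
  rw [re_add_im x z, re_add_im x w, h, h']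

@[simp] theorem rePart_conj (x : M) (z : CTangent E x) :
    rePart x (conjTangent x z) = rePart x z := by
  induction z using TensorProduct.induction_on with
  | zero => simp
  | tmul a v => simp [conjTangent]
  | add a b ha hb => simp only [map_add, ha, hb]

@[simp] theorem imPart_conj (x : M) (z : CTangent E x) :
    imPart x (conjTangent x z) = -imPart x z := by
  induction z using TensorProduct.induction_on with
  | zero => simp
  | tmul a v => simp [conjTangent]
  | add a b ha hb => simp only [map_add, ha, hb]; abel

@[simp] theorem conj_conj (x : M) (z : CTangent E x) : conjTangent x (conjTangent x z) = z :=
  CTangent.ext (by simp) (by simp)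

@[simp] theorem conj_ofReal (x : M) (v : TangentSpace 𝓘(ℝ, E) x) :
    conjTangent x (ofReal x v) = ofReal x v :=
  CTangent.ext (by simp) (by simp)

/-- The condition on real and imaginary parts is stable under complex scalars, since these only mix
the two parts with real coefficients. -/
theorem mem_baseChange_iff (x : M) (U : Submodule ℝ (TangentSpace 𝓘(ℝ, E) x))
    (z : CTangent E x) : z ∈ U.baseChange ℂ ↔ rePart x z ∈ U ∧ imPart x z ∈ U := by
  constructor
  · intro hz
    rw [Submodule.baseChange_eq_span] at hz
    induction hz using Submodule.span_induction with
    | mem z hz =>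
      obtain ⟨v, hv, rfl⟩ := hz
      exact ⟨by simpa using hv, by simp⟩
    | zero => simp
    | add a b _ _ ha hb =>
      simp only [map_add]
      exact ⟨U.add_mem ha.1 hb.1, U.add_mem ha.2 hb.2⟩
    | smul c a _ ha =>
      rw [rePart_smul, imPart_smul]
      exact ⟨U.sub_mem (U.smul_mem _ ha.1) (U.smul_mem _ ha.2),
        U.add_mem (U.smul_mem _ ha.2) (U.smul_mem _ ha.1)⟩
  · rintro ⟨h1, h2⟩
    rw [re_add_im x z]
    exact Submodule.add_mem _ (Submodule.tmul_mem_baseChange_of_mem 1 h1)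
      (Submodule.smul_mem _ _ (Submodule.tmul_mem_baseChange_of_mem 1 h2))

theorem mem_conjSubspace (x : M) (N : Submodule ℂ (CTangent E x)) (z : CTangent E x) :
    z ∈ conjSubspace x N ↔ conjTangent x z ∈ N := Iff.rfl

variable [IsManifold 𝓘(ℝ, E) ∞ M]

theorem complexMetric_apply (g : PseudoMetric E M) (x : M) (z w : CTangent E x) :
    (complexCalculus g).metric x z w =
      ((g.val x (rePart x z) (rePart x w) - g.val x (imPart x z) (imPart x w) : ℝ) : ℂ)
        + Complex.I * ((g.val x (rePart x z) (imPart x w) + g.val x (imPart x z) (rePart x w) : ℝ) :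
          ℂ) := by
  have key : ∀ v v', (complexCalculus g).metric x (ofReal x v) (ofReal x v') =
      ((g.val x v v' : ℝ) : ℂ) := by
    intro v v'
    change LinearMap.BilinForm.baseChange ℂ _ (1 ⊗ₜ v) (1 ⊗ₜ v') = _
    rw [LinearMap.BilinForm.baseChange_tmul]
    simp
  nth_rewrite 1 [re_add_im x z, re_add_im x w]
  simp only [map_add, map_smul, LinearMap.add_apply, LinearMap.smul_apply, key, smul_eq_mul]
  push_cast
  linear_combination
    ((g.val x (imPart x z) (imPart x w) : ℝ) : ℂ) * Complex.I_mul_I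

theorem complexMetric_ofReal (g : PseudoMetric E M) (x : M) (v w : TangentSpace 𝓘(ℝ, E) x) :
    (complexCalculus g).metric x (ofReal x v) (ofReal x w) = ((g.val x v w : ℝ) : ℂ) := by
  simp [complexMetric_apply]

theorem complexMetric_conj (g : PseudoMetric E M) (x : M) (z w : CTangent E x) :
    (complexCalculus g).metric x (conjTangent x z) (conjTangent x w) =
      starRingEnd ℂ ((complexCalculus g).metric x z w) := by
  simp only [complexMetric_apply, rePart_conj, imPart_conj]
  apply Complex.ext <;> simp
  ring

theorem reField_complexify (X : Π x : M, TangentSpace 𝓘(ℝ, E) x) :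
    reField (complexify X) = X := by funext x; simp [reField, complexify]

theorem imField_complexify (X : Π x : M, TangentSpace 𝓘(ℝ, E) x) :
    imField (complexify X) = 0 := by funext x; simp [imField, complexify]

theorem rePart_bracket (g : PseudoMetric E M) (Z Z' : Π x : M, CTangent E x) (x : M) :
    rePart x ((complexCalculus g).bracket Z Z' x) =
      (realCalculus g).bracket (reField Z) (reField Z') x
        - (realCalculus g).bracket (imField Z) (imField Z') x := by
  simp [complexCalculus, realCalculus, complexify, rePart_smul]

theorem imPart_bracket (g : PseudoMetric E M) (Z Z' : Π x : M, CTangent E x) (x : M) :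
    imPart x ((complexCalculus g).bracket Z Z' x) =
      (realCalculus g).bracket (reField Z) (imField Z') x
        + (realCalculus g).bracket (imField Z) (reField Z') x := by
  simp [complexCalculus, realCalculus, complexify, imPart_smul]

theorem mvfderiv_clm {G H : Type*} [NormedAddCommGroup G] [NormedSpace ℝ G]
    [NormedAddCommGroup H] [NormedSpace ℝ H] (ℓ : G →L[ℝ] H) {f : M → G} {x : M}
    (hf : MDifferentiableAt 𝓘(ℝ, E) 𝓘(ℝ, G) f x) (v : TangentSpace 𝓘(ℝ, E) x) :
    mvfderiv 𝓘(ℝ, E) (fun y => ℓ (f y)) x v = ℓ (mvfderiv 𝓘(ℝ, E) f x v) := by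
  have h := (ℓ.hasMFDerivAt (x := f x)).comp x hf.hasMFDerivAt
  change mfderiv 𝓘(ℝ, E) 𝓘(ℝ, H) (ℓ ∘ f) x v = ℓ (mfderiv 𝓘(ℝ, E) 𝓘(ℝ, G) f x v)
  rw [h.mfderiv]
  rfl

/-- Real part of a function. -/
def reFun (f : M → ℂ) : M → ℝ := fun x => (f x).re

/-- Imaginary part of a function. -/
def imFun (f : M → ℂ) : M → ℝ := fun x => (f x).im

theorem smoothFunOn_re {U : Set M} {f : M → ℂ} (hf : SmoothFunOn E ℂ U f) :
    SmoothFunOn E ℝ U (reFun f) :=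
  Complex.reCLM.contDiff.contMDiff.comp_contMDiffOn hf

theorem smoothFunOn_im {U : Set M} {f : M → ℂ} (hf : SmoothFunOn E ℂ U f) :
    SmoothFunOn E ℝ U (imFun f) :=
  Complex.imCLM.contDiff.contMDiff.comp_contMDiffOn hf

theorem smoothFunOn_ofReal {U : Set M} {f : M → ℝ} (hf : SmoothFunOn E ℝ U f) :
    SmoothFunOn E ℂ U (fun x => (f x : ℂ)) :=
  Complex.ofRealCLM.contDiff.contMDiff.comp_contMDiffOn hf

theorem smoothFunOn_complex {U : Set M} {f : M → ℂ} (h1 : SmoothFunOn E ℝ U (reFun f))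
    (h2 : SmoothFunOn E ℝ U (imFun f)) : SmoothFunOn E ℂ U f := by
  have : SmoothFunOn E ℂ U (fun x => (reFun f x : ℂ) + Complex.I • (imFun f x : ℂ)) :=
    ContMDiffOn.add (smoothFunOn_ofReal h1)
      ((contDiff_const_smul Complex.I).contMDiff.comp_contMDiffOn (smoothFunOn_ofReal h2))
  refine ContMDiffOn.congr this fun x _ => ?_
  apply Complex.ext <;> simp [reFun, imFun]

theorem re_mvfderiv {f : M → ℂ} {x : M} (hf : MDifferentiableAt 𝓘(ℝ, E) 𝓘(ℝ, ℂ) f x)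
    (v : TangentSpace 𝓘(ℝ, E) x) :
    (mvfderiv 𝓘(ℝ, E) f x v).re = mvfderiv 𝓘(ℝ, E) (reFun f) x v :=
  (mvfderiv_clm Complex.reCLM hf v).symm

theorem im_mvfderiv {f : M → ℂ} {x : M} (hf : MDifferentiableAt 𝓘(ℝ, E) 𝓘(ℝ, ℂ) f x)
    (v : TangentSpace 𝓘(ℝ, E) x) :
    (mvfderiv 𝓘(ℝ, E) f x v).im = mvfderiv 𝓘(ℝ, E) (imFun f) x v :=
  (mvfderiv_clm Complex.imCLM hf v).symm

theorem re_der (g : PseudoMetric E M) {f : M → ℂ} (hf : SmoothFunOn E ℂ Set.univ f)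
    (Z : Π x : M, CTangent E x) (x : M) : ((complexCalculus g).der Z f x).re =
      (realCalculus g).der (reField Z) (reFun f) x
        - (realCalculus g).der (imField Z) (imFun f) x := by
  simp [complexCalculus, realCalculus, re_mvfderiv (hf.mdifferentiableAt x),
    im_mvfderiv (hf.mdifferentiableAt x), sub_eq_add_neg]

theorem im_der (g : PseudoMetric E M) {f : M → ℂ} (hf : SmoothFunOn E ℂ Set.univ f)
    (Z : Π x : M, CTangent E x) (x : M) : ((complexCalculus g).der Z f x).im =
      (realCalculus g).der (reField Z) (imFun f) x
        + (realCalculus g).der (imField Z) (reFun f) x := by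
  simp [complexCalculus, realCalculus, re_mvfderiv (hf.mdifferentiableAt x),
    im_mvfderiv (hf.mdifferentiableAt x)]

theorem re_pair (g : PseudoMetric E M) (Z W : Π x : M, CTangent E x) :
    reFun ((complexCalculus g).pair Z W) =
      (realCalculus g).pair (reField Z) (reField W) -
        (realCalculus g).pair (imField Z) (imField W) := by
  funext x
  simp [reFun, Calculus.pair, complexMetric_apply, realCalculus, reField, imField]

theorem im_pair (g : PseudoMetric E M) (Z W : Π x : M, CTangent E x) :
    imFun ((complexCalculus g).pair Z W) =
      (realCalculus g).pair (reField Z) (imField W) +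
        (realCalculus g).pair (imField Z) (reField W) := by
  funext x
  simp [imFun, Calculus.pair, complexMetric_apply, realCalculus, reField, imField]

theorem reField_smul (f : M → ℂ) (Z : Π x : M, CTangent E x) :
    reField (fun x => f x • Z x) =
      (fun x => reFun f x • reField Z x) - fun x => imFun f x • imField Z x := by
  funext x; simp [reField, imField, rePart_smul, reFun, imFun]

theorem imField_smul (f : M → ℂ) (Z : Π x : M, CTangent E x) :
    imField (fun x => f x • Z x) =
      (fun x => reFun f x • imField Z x) + fun x => imFun f x • reField Z x := by
  funext x; simp [reField, imField, imPart_smul, reFun, imFun]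

theorem reField_add (Z W : Π x : M, CTangent E x) :
    reField (fun x => Z x + W x) = reField Z + reField W := by
  funext x; simp [reField]

theorem imField_add (Z W : Π x : M, CTangent E x) :
    imField (fun x => Z x + W x) = imField Z + imField W := by
  funext x; simp [imField]

theorem reFun_mul (f h : M → ℂ) : reFun (f * h) = reFun f * reFun h - imFun f * imFun h := by
  funext x; simp [reFun, imFun]

theorem imFun_mul (f h : M → ℂ) : imFun (f * h) = reFun f * imFun h + imFun f * reFun h := by
  funext x; simp [reFun, imFun]

theorem complexify_smooth (g : PseudoMetric E M) {U : Set M}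
    {X : Π x : M, TangentSpace 𝓘(ℝ, E) x} (hX : SmoothFieldOn U X) :
    (complexCalculus g).SmoothOn U (complexify X) := by
  refine ⟨?_, ?_⟩
  · rwa [reField_complexify]
  · rw [imField_complexify]; exact smoothFieldOn_zero U

/-- Most rules are complex (bi)linear extensions: they split into real and imaginary parts, each a
combination of instances of the real rule. -/
theorem complexCalculus_isLawful [FiniteDimensional ℝ E] [CompleteSpace E] [T2Space M]
    (g : PseudoMetric E M) : (complexCalculus g).IsLawful (SmoothFunOn E ℂ) :=
  have L := realCalculus_isLawful g
  have smul_on : ∀ {U : Set M} {f : M → ℂ} {X : Π x : M, CTangent E x}, SmoothFunOn E ℂ U f →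
      (complexCalculus g).SmoothOn U X → (complexCalculus g).SmoothOn U (fun x => f x • X x) := by
    intro U f X hf hX
    refine ⟨?_, ?_⟩
    · rw [reField_smul]
      exact SmoothFieldOn.sub (SmoothFieldOn.smul (smoothFunOn_re hf) hX.1)
        (SmoothFieldOn.smul (smoothFunOn_im hf) hX.2)
    · rw [imField_smul]
      exact SmoothFieldOn.add (SmoothFieldOn.smul (smoothFunOn_re hf) hX.2)
        (SmoothFieldOn.smul (smoothFunOn_im hf) hX.1)
  have mul_on : ∀ {U : Set M} {f h : M → ℂ}, SmoothFunOn E ℂ U f → SmoothFunOn E ℂ U h →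
      SmoothFunOn E ℂ U (f * h) := by
    intro U f h hf hh
    refine smoothFunOn_complex ?_ ?_
    · rw [reFun_mul]
      exact L.fun_sub (L.fun_mul (smoothFunOn_re hf) (smoothFunOn_re hh))
        (L.fun_mul (smoothFunOn_im hf) (smoothFunOn_im hh))
    · rw [imFun_mul]
      exact L.fun_add (L.fun_mul (smoothFunOn_re hf) (smoothFunOn_im hh))
        (L.fun_mul (smoothFunOn_im hf) (smoothFunOn_re hh))
  { fun_const := fun U c => contMDiffOn_const
    fun_add := fun hf hh => ContMDiffOn.add hf hh
    fun_mul := mul_on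
    fun_inv := fun {U f} hf h => by
      intro x hx
      exact ((contDiffAt_inv ℝ (h x hx)).contMDiffAt (n := ∞)).comp_contMDiffWithinAt x (hf x hx)
    fun_mono := fun h hf => ContMDiffOn.mono hf h
    fun_congr := fun hf h => ContMDiffOn.congr hf h
    fun_ne := fun {U f x} hf hU hx h0 => by
      have hc : ContinuousOn f U := ContMDiffOn.continuousOn hf
      exact ⟨U ∩ f ⁻¹' {0}ᶜ, hc.isOpen_inter_preimage hU isOpen_compl_singleton, ⟨hx, h0⟩,
        Set.inter_subset_left, fun y hy => hy.2⟩
    sec_zero := fun U => by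
      have : (fun x : M => (0 : CTangent E x)) = complexify 0 := by
        funext x; simp [complexify]
      rw [this]
      exact complexify_smooth g (smoothFieldOn_zero U)
    sec_add := fun hX hY => ⟨by rw [reField_add]; exact SmoothFieldOn.add hX.1 hY.1,
      by rw [imField_add]; exact SmoothFieldOn.add hX.2 hY.2⟩
    sec_smul := smul_on
    sec_mono := fun h hX => ⟨ContMDiffOn.mono hX.1 h, ContMDiffOn.mono hX.2 h⟩
    sec_congr := fun hX h =>
      ⟨SmoothFieldOn.congr hX.1 fun x hx => by simp only [reField, h x hx],
        SmoothFieldOn.congr hX.2 fun x hx => by simp only [imField, h x hx]⟩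
    sec_local := fun h =>
      ⟨contMDiffOn_univ_of_local fun x => by
          obtain ⟨U, hU, hx, h1, -⟩ := h x; exact ⟨U, hU, hx, h1⟩,
        contMDiffOn_univ_of_local fun x => by
          obtain ⟨U, hU, hx, -, h1⟩ := h x; exact ⟨U, hU, hx, h1⟩⟩
    cutoff := fun {U x} hU hx => by
      obtain ⟨χ, h1, ⟨V, hV, hxV, hVU, hV1⟩, h3, h4, h5⟩ := exists_cutoff (E := E) hU hx
      refine ⟨fun x => (χ x : ℂ), smoothFunOn_ofReal h1,
        ⟨V, hV, hxV, hVU, fun y hy => by simp [hV1 y hy]⟩, fun y hy => by simp [h3 y hy],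
        fun f hf => ?_, fun X hX => ?_⟩
      · refine ContMDiffOn.congr (h4 ℂ f hf) fun y _ => ?_
        simp
      · refine ⟨?_, ?_⟩
        · refine SmoothFieldOn.congr (h5 _ hX.1) fun y _ => ?_
          rw [reField, rePart_smul]; simp [reField]
        · refine SmoothFieldOn.congr (h5 _ hX.2) fun y _ => ?_
          rw [imField, imPart_smul]; simp [imField]
    frame := fun x₀ => by
      obtain ⟨U, hU, hx, e, he, hb⟩ := exists_frame (E := E) x₀
      refine ⟨_, U, hU, hx, fun a => complexify (e a), fun a => complexify_smooth g (he a),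
        fun x hx => ?_⟩
      -- The base change of a real basis is a complex basis, so the complexified real frame is a
      -- complex frame.
      let b := Module.Basis.mk (hb x hx).1 (hb x hx).2.ge
      have hbc : (fun a => complexify (e a) x) = ⇑(b.baseChange ℂ) := by
        funext a
        rw [Module.Basis.baseChange_apply]
        simp [b, complexify, ofReal]
      constructor
      · rw [hbc]
        exact (b.baseChange ℂ).linearIndependent
      · rw [hbc]
        exact (b.baseChange ℂ).span_eq
    pair_smooth := fun hX hY => by
      refine smoothFunOn_complex ?_ ?_
      · rw [re_pair]; exact L.fun_sub (L.pair_smooth hX.1 hY.1) (L.pair_smooth hX.2 hY.2)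
      · rw [im_pair]; exact L.fun_add (L.pair_smooth hX.1 hY.2) (L.pair_smooth hX.2 hY.1)
    symm := fun x v w => by
      simp only [complexMetric_apply, g.symm x (rePart x v), g.symm x (imPart x v)]
      push_cast
      ring
    nondeg := fun x v h => by
      have key : ∀ w, g.val x (rePart x v) w = 0 ∧ g.val x (imPart x v) w = 0 := by
        intro w
        have := h (ofReal x w)
        rw [complexMetric_apply] at this
        simp only [rePart_ofReal, imPart_ofReal, map_zero, sub_zero, zero_add] at this
        exact ⟨by simpa using congrArg Complex.re this, by simpa using congrArg Complex.im this⟩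
      refine CTangent.ext ?_ ?_
      · rw [g.nondegenerate x _ fun w => (key w).1]; simp
      · rw [g.nondegenerate x _ fun w => (key w).2]; simp
    der_smooth := fun {X f} hX hf => by
      refine smoothFunOn_complex ?_ ?_
      · exact L.fun_congr (L.fun_sub (L.der_smooth hX.1 (smoothFunOn_re hf))
          (L.der_smooth hX.2 (smoothFunOn_im hf))) fun x _ => re_der g hf X x
      · exact L.fun_congr (L.fun_add (L.der_smooth hX.1 (smoothFunOn_im hf))
          (L.der_smooth hX.2 (smoothFunOn_re hf))) fun x _ => im_der g hf X x
    der_add_left := fun X Y f => by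
      funext x
      simp [complexCalculus, reField, imField]
      ring
    der_smul_left := fun h X f => by
      funext x
      simp only [complexCalculus, reField, imField, rePart_smul, imPart_smul, map_sub, map_add,
        map_smul, Complex.real_smul, Pi.mul_apply]
      -- The first four occurrences of h x sit inside real and imaginary parts; only the bare scalar
      -- on the right is split, and the identity then amounts to I² = -1.
      nth_rewrite 5 [← Complex.re_add_im (h x)]
      linear_combination (((h x).im : ℂ) * (mvfderiv 𝓘(ℝ, E) f x) (imPart x (X x))) *
        (-Complex.I_mul_I)
    der_add := fun X {f h} hf hh => by
      funext x
      simp only [complexCalculus, Pi.add_apply,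
        mvfderiv_add (hf.mdifferentiableAt x) (hh.mdifferentiableAt x),
        add_apply]
      ring
    der_mul := fun X {f h} hf hh => by
      funext x
      have hfh := mul_on hf hh
      have r1 := smoothFunOn_re hf
      have r2 := smoothFunOn_re hh
      have i1 := smoothFunOn_im hf
      have i2 := smoothFunOn_im hh
      apply Complex.ext
      · rw [re_der g hfh, reFun_mul, imFun_mul,
          L.der_sub _ (L.fun_mul r1 r2) (L.fun_mul i1 i2), L.der_add _ (L.fun_mul r1 i2)
          (L.fun_mul i1 r2), L.der_mul _ r1 r2, L.der_mul _ i1 i2, L.der_mul _ r1 i2,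
          L.der_mul _ i1 r2]
        simp only [Pi.add_apply, Pi.mul_apply, Complex.add_re, Complex.mul_re, Pi.sub_apply,
          re_der g hf, re_der g hh, im_der g hf, im_der g hh, reFun, imFun]
        ring
      · rw [im_der g hfh, reFun_mul, imFun_mul,
          L.der_sub _ (L.fun_mul r1 r2) (L.fun_mul i1 i2), L.der_add _ (L.fun_mul r1 i2)
          (L.fun_mul i1 r2), L.der_mul _ r1 r2, L.der_mul _ i1 i2, L.der_mul _ r1 i2,
          L.der_mul _ i1 r2]
        simp only [Pi.add_apply, Pi.mul_apply, Complex.add_im, Complex.mul_im, Pi.sub_apply,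
          re_der g hf, re_der g hh, im_der g hf, im_der g hh, reFun, imFun]
        ring
    der_const := fun X c => by
      funext x
      simp [complexCalculus, mvfderiv_const]
    bracket_smooth := fun {X Y} hX hY => by
      refine ⟨?_, ?_⟩
      · exact SmoothFieldOn.congr (SmoothFieldOn.sub (L.bracket_smooth hX.1 hY.1)
          (L.bracket_smooth hX.2 hY.2)) fun x _ => rePart_bracket g X Y x
      · exact SmoothFieldOn.congr (SmoothFieldOn.add (L.bracket_smooth hX.1 hY.2)
          (L.bracket_smooth hX.2 hY.1)) fun x _ => imPart_bracket g X Y x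
    bracket_swap := fun X Y x => by
      refine CTangent.ext ?_ ?_
      · rw [map_neg, rePart_bracket, rePart_bracket, L.bracket_swap (reField X),
          L.bracket_swap (imField X)]
        abel
      · rw [map_neg, imPart_bracket, imPart_bracket, L.bracket_swap (reField X),
          L.bracket_swap (imField X)]
        abel
    bracket_add := fun {X Y Z} hX hY hZ x => by
      refine CTangent.ext ?_ ?_
      · rw [map_add, rePart_bracket, rePart_bracket, rePart_bracket, reField_add, imField_add,
          L.bracket_add_right hX.1 hY.1 hZ.1, L.bracket_add_right hX.2 hY.2 hZ.2]
        simp only [Pi.add_apply]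
        abel
      · rw [map_add, imPart_bracket, imPart_bracket, imPart_bracket, reField_add, imField_add,
          L.bracket_add_right hX.2 hY.1 hZ.1, L.bracket_add_right hX.1 hY.2 hZ.2]
        simp only [Pi.add_apply]
        abel
    bracket_smul := fun {X Y f} hX hY hf x => by
      have u := smoothFunOn_re hf
      have v := smoothFunOn_im hf
      have sub : ∀ {A B D : Π x : M, TangentSpace 𝓘(ℝ, E) x}, (realCalculus g).Smooth A →
          (realCalculus g).Smooth B → (realCalculus g).Smooth D →
          (realCalculus g).bracket A (B - D) =
            (realCalculus g).bracket A B - (realCalculus g).bracket A D := by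
        intro A B D hA hB hD
        rw [sub_eq_add_neg, L.bracket_add_right hA hB (L.smooth_neg hD),
          L.bracket_neg_right hA hD, sub_eq_add_neg]
      refine CTangent.ext ?_ ?_
      · rw [map_add, rePart_smul, rePart_smul, rePart_bracket, rePart_bracket, imPart_bracket,
          reField_smul, imField_smul,
          sub hX.1 (L.smooth_smul u hY.1) (L.smooth_smul v hY.2),
          L.bracket_add_right hX.2 (L.smooth_smul u hY.2) (L.smooth_smul v hY.1)]
        simp only [Pi.add_apply, Pi.sub_apply, L.bracket_smul hX.1 hY.1 u,
          L.bracket_smul hX.1 hY.2 v, L.bracket_smul hX.2 hY.2 u, L.bracket_smul hX.2 hY.1 v,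
          re_der g hf, im_der g hf]
        simp only [reFun, imFun, reField, imField]
        module
      · rw [map_add, imPart_smul, imPart_smul, imPart_bracket, imPart_bracket, rePart_bracket,
          reField_smul, imField_smul,
          sub hX.2 (L.smooth_smul u hY.1) (L.smooth_smul v hY.2),
          L.bracket_add_right hX.1 (L.smooth_smul u hY.2) (L.smooth_smul v hY.1)]
        simp only [Pi.add_apply, Pi.sub_apply, L.bracket_smul hX.1 hY.1 v,
          L.bracket_smul hX.1 hY.2 u, L.bracket_smul hX.2 hY.2 v, L.bracket_smul hX.2 hY.1 u,
          re_der g hf, im_der g hf]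
        simp only [reFun, imFun, reField, imField]
        module }

end ComplexTangent


/-! ### Linear algebra of internal direct sums. -/

section Internal

variable {𝕜 : Type*} [Field 𝕜] {ι : Type*} [Fintype ι] [DecidableEq ι]

section Space

variable {W : Type*} [AddCommGroup W] [Module 𝕜 W] {V : ι → Submodule 𝕜 W}

theorem iSupIndep_of_sum (h0 : ∀ v : ι → W, (∀ i, v i ∈ V i) → ∑ i, v i = 0 → ∀ i, v i = 0) :
    iSupIndep V := by
  rw [iSupIndep_iff_finsetSum_eq_zero_imp_eq_zero]
  intro s v hv hs i hi
  have := h0 (fun i => if i ∈ s then v i else 0) (fun i => ?_) ?_ i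
  · simpa [hi] using this
  · split_ifs with h
    · exact hv i h
    · exact (V i).zero_mem
  · rw [Finset.sum_ite_mem, Finset.univ_inter, hs]

theorem isInternal_of_sum (h0 : ∀ v : ι → W, (∀ i, v i ∈ V i) → ∑ i, v i = 0 → ∀ i, v i = 0)
    (h1 : ∀ w, ∃ v : ι → W, (∀ i, v i ∈ V i) ∧ ∑ i, v i = w) : DirectSum.IsInternal V := by
  rw [DirectSum.isInternal_submodule_iff_iSupIndep_and_iSup_eq_top]
  refine ⟨iSupIndep_of_sum h0, eq_top_iff.mpr fun w _ => ?_⟩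
  obtain ⟨v, hv, rfl⟩ := h1 w
  exact Submodule.sum_mem _ fun i _ => Submodule.mem_iSup_of_mem i (hv i)

theorem finrank_of_isInternal [FiniteDimensional 𝕜 W] (h : DirectSum.IsInternal V) :
    ∑ i, Module.finrank 𝕜 (V i) = Module.finrank 𝕜 W := by
  rw [← Module.finrank_directSum]
  exact (LinearEquiv.ofBijective (DirectSum.coeLinearMap V) h).finrank_eq

theorem isInternal_of_finrank [FiniteDimensional 𝕜 W]
    (h0 : ∀ v : ι → W, (∀ i, v i ∈ V i) → ∑ i, v i = 0 → ∀ i, v i = 0)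
    (h1 : ∑ i, Module.finrank 𝕜 (V i) = Module.finrank 𝕜 W) : DirectSum.IsInternal V := by
  have hinj : Function.Injective (DirectSum.coeLinearMap V) :=
    (iSupIndep_of_sum h0).dfinsupp_lsum_injective
  refine ⟨hinj, (LinearMap.injective_iff_surjective_of_finrank_eq_finrank ?_).mp hinj⟩
  rw [Module.finrank_directSum, h1]

end Space

variable {M : Type*} {W : M → Type*} [∀ x, AddCommGroup (W x)] [∀ x, Module 𝕜 (W x)]
  {V : ι → Π x, Submodule 𝕜 (W x)} {x : M}

omit [Fintype ι] [DecidableEq ι] in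
theorem component_mem (k : ι) (x : M) (w : W x) : component V k x w ∈ V k x := by
  unfold component
  split_ifs with h
  · exact Submodule.projection_apply_mem h w
  · exact (V k x).zero_mem

-- For an internal sum the condition in the definition of `component` always holds, so its default
-- value 0 does not occur.
omit [Fintype ι] in
theorem isCompl_of_isInternal (h : DirectSum.IsInternal fun i => V i x) (k : ι) :
    IsCompl (V k x) (⨆ (j : ι) (_ : j ≠ k), V j x) := by
  refine ⟨h.submodule_iSupIndep k, codisjoint_iff.mpr ?_⟩
  rw [eq_top_iff, ← h.submodule_iSup_eq_top]
  refine iSup_le fun j => ?_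
  by_cases hj : j = k
  · exact hj ▸ le_sup_left
  · exact le_sup_of_le_right (le_iSup₂_of_le j hj le_rfl)

omit [Fintype ι] in
theorem component_of_mem (h : DirectSum.IsInternal fun i => V i x) {k : ι} {w : W x}
    (hw : w ∈ V k x) : component V k x w = w := by
  unfold component
  rw [dif_pos (isCompl_of_isInternal h k)]
  exact Submodule.projection_apply_of_mem_left _ hw

omit [Fintype ι] in
theorem component_of_mem_ne (h : DirectSum.IsInternal fun i => V i x) {j k : ι} (hjk : j ≠ k)
    {w : W x} (hw : w ∈ V j x) : component V k x w = 0 := by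
  unfold component
  rw [dif_pos (isCompl_of_isInternal h k), Submodule.projection_apply_eq_zero_iff]
  exact Submodule.mem_iSup_of_mem j (Submodule.mem_iSup_of_mem hjk hw)

theorem component_sum (h : DirectSum.IsInternal fun i => V i x) {v : ι → W x}
    (hv : ∀ i, v i ∈ V i x) (k : ι) : component V k x (∑ i, v i) = v k := by
  rw [map_sum, Finset.sum_eq_single k]
  · exact component_of_mem h (hv k)
  · exact fun j _ hj => component_of_mem_ne h hj (hv j)
  · simp

theorem sum_component (h : DirectSum.IsInternal fun i => V i x) (w : W x) :
    ∑ i, component V i x w = w := by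
  obtain ⟨f, hf⟩ := (Submodule.mem_iSup_iff_exists_finsupp _ w).mp
    (h.submodule_iSup_eq_top ▸ Submodule.mem_top)
  have e : w = ∑ i, f i := by
    rw [← hf.2, Finsupp.sum_fintype _ _ fun _ => rfl]
  rw [e]
  exact Finset.sum_congr rfl fun i _ => component_sum h hf.1 i

end Internal

/-! ### Frames adapted to a decomposition. -/

section AdaptedFrame

variable {𝕜 : Type*} [Field 𝕜] {M : Type*} [TopologicalSpace M] {W : M → Type*}
  [∀ x, AddCommGroup (W x)] [∀ x, Module 𝕜 (W x)] {ι : Type*} [Fintype ι] [DecidableEq ι]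

/-- A frame adapted to a decomposition into subbundles. -/
theorem Calculus.IsLawful.exists_adapted_frame {C : Calculus 𝕜 M W}
    {F : Set M → (M → 𝕜) → Prop} (L : C.IsLawful F) {V : ι → Π x, Submodule 𝕜 (W x)} {r : ι → ℕ}
    (hV : ∀ i, C.IsSubbundle (V i) (r i)) (hd : ∀ x, DirectSum.IsInternal fun i => V i x)
    (x₀ : M) : ∃ U, IsOpen U ∧ x₀ ∈ U ∧ ∃ s : (Σ i, Fin (r i)) → Π x, W x,
      (∀ p, C.SmoothOn U (s p)) ∧ ∀ x ∈ U, (∀ p, s p x ∈ V p.1 x) ∧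
        LinearIndependent 𝕜 (fun p => s p x) ∧
        Submodule.span 𝕜 (Set.range fun p => s p x) = ⊤ := by
  choose U hU hx s hs hsp using fun i => hV i x₀
  refine ⟨⋂ i, U i, isOpen_iInter_of_finite hU, Set.mem_iInter.mpr hx, fun p => s p.1 p.2,
    fun p => L.sec_mono (Set.iInter_subset _ _) (hs p.1 p.2), fun x hxU => ?_⟩
  have hxU := Set.mem_iInter.mp hxU
  have hfin := L.finite x
  have hle : ∀ i, V i x ≤ Submodule.span 𝕜 (Set.range fun p : Σ i, Fin (r i) => s p.1 p.2 x) := by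
    intro i
    rw [← (hsp i x (hxU i)).2, Submodule.span_le]
    rintro _ ⟨a, rfl⟩
    exact Submodule.subset_span ⟨⟨i, a⟩, rfl⟩
  have htop : ⊤ ≤ Submodule.span 𝕜 (Set.range fun p : Σ i, Fin (r i) => s p.1 p.2 x) := by
    rw [← (hd x).submodule_iSup_eq_top]
    exact iSup_le hle
  -- Independence comes from counting: there are exactly as many spanning vectors as the dimension.
  refine ⟨fun p => ?_, linearIndependent_of_top_le_span_of_card_eq_finrank htop ?_,
    eq_top_iff.mpr htop⟩
  · rw [← (hsp p.1 x (hxU p.1)).2]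
    exact Submodule.subset_span ⟨p.2, rfl⟩
  · rw [← finrank_of_isInternal (hd x), Fintype.card_sigma]
    refine Finset.sum_congr rfl fun i _ => ?_
    rw [← (hsp i x (hxU i)).2, finrank_span_eq_card (hsp i x (hxU i)).1]

theorem Calculus.IsSubbundle.finrank_eq {C : Calculus 𝕜 M W} {V : Π x, Submodule 𝕜 (W x)} {r : ℕ}
    (h : C.IsSubbundle V r) (x : M) : Module.finrank 𝕜 (V x) = r := by
  obtain ⟨U, -, hx, s, -, hs⟩ := h x
  rw [← (hs x hx).2, finrank_span_eq_card (hs x hx).1, Fintype.card_fin]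

end AdaptedFrame



/-! ### Pointwise algebra of an almost Robinson structure. -/

section Robinson

variable {E : Type*} [NormedAddCommGroup E] [NormedSpace ℝ E]
  {M : Type*} [TopologicalSpace M] [ChartedSpace E M]

instance [FiniteDimensional ℝ E] (x : M) : FiniteDimensional ℝ (TangentSpace 𝓘(ℝ, E) x) :=
  inferInstanceAs (FiniteDimensional ℝ E)

theorem finrank_cTangent [FiniteDimensional ℝ E] (x : M) :
    Module.finrank ℂ (CTangent E x) = Module.finrank ℝ E :=
  Module.finrank_baseChange

theorem ofReal_injective (x : M) :
    Function.Injective (ofReal x : TangentSpace 𝓘(ℝ, E) x → CTangent E x) := fun v w h => by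
  rw [← rePart_ofReal x v, h, rePart_ofReal]

variable [IsManifold 𝓘(ℝ, E) ∞ M]

theorem complexMetric_symm (g : PseudoMetric E M) (x : M) (z w : CTangent E x) :
    (complexCalculus g).metric x z w = (complexCalculus g).metric x w z := by
  simp only [complexMetric_apply, g.symm x (rePart x z), g.symm x (imPart x z)]
  push_cast
  ring

instance : Fintype RealIndex where
  elems := {.R, .Rdual, .S}
  complete i := by cases i <;> simp

theorem RealIndex.sum_univ {A : Type*} [AddCommMonoid A] (f : RealIndex → A) :
    ∑ i, f i = f .R + f .Rdual + f .S := by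
  change ∑ i ∈ {RealIndex.R, .Rdual, .S}, f i = _
  simp [add_assoc]

theorem ComplexIndex.sum_univ {A : Type*} [AddCommMonoid A] (f : ComplexIndex → A) :
    ∑ i, f i = f .R + f .Rdual + f .T10 + f .T01 := by
  change ∑ i ∈ {ComplexIndex.R, .Rdual, .T10, .T01}, f i = _
  simp [add_assoc]

theorem ComplexIndex.star_star (i : ComplexIndex) : i.star.star = i := by cases i <;> rfl

theorem ComplexIndex.star_ne (i : ComplexIndex) : i.star ≠ i := by cases i <;> simp [star]

theorem RealIndex.star_star (i : RealIndex) : i.star.star = i := by cases i <;> rfl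

variable {m : ℕ} {g : PseudoMetric E M} {N : Π x : M, Submodule ℂ (CTangent E x)}
  {ξ ξ' : Π x : M, TangentSpace 𝓘(ℝ, E) x} (hN : IsAlmostRobinson m g N)
  (hξ : IsNullFrame g N ξ ξ')

include hN hξ

theorem null (x : M) : g.val x (ξ x) (ξ x) = 0 := by
  have := hN.isotropic x _ (hξ.mem x) _ (hξ.mem x)
  rw [complexMetric_ofReal] at this
  exact_mod_cast this

omit hN in
theorem dual' (x : M) : g.val x (ξ' x) (ξ x) = 1 := by rw [g.symm, hξ.dual]

omit hN in
theorem ofReal_null_ne (x : M) : ofReal x (ξ x) ≠ 0 := by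
  intro h
  have h1 := hξ.dual x
  rw [ofReal_injective x (h.trans (map_zero _).symm)] at h1
  simp at h1

/-- The space N ∩ N̄ is a complex line and contains ξ, which is nonzero because g(ξ,ξ') = 1. -/
theorem exists_smul_of_mem_inter {x : M} {z : CTangent E x} (h : z ∈ N x)
    (h' : conjTangent x z ∈ N x) : ∃ c : ℂ, c • ofReal x (ξ x) = z := by
  have hmem : ofReal x (ξ x) ∈ N x ⊓ conjSubspace x (N x) :=
    ⟨hξ.mem x, by
      change conjTangent x _ ∈ N x
      rw [conj_ofReal]
      exact hξ.mem x⟩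
  have hne : (⟨_, hmem⟩ : (N x ⊓ conjSubspace x (N x) : Submodule ℂ (CTangent E x))) ≠ 0 :=
    fun h => ofReal_null_ne hξ x (congrArg Subtype.val h)
  obtain ⟨c, hc⟩ := (finrank_eq_one_iff_of_nonzero' _ hne).mp (hN.rank_inter x) ⟨z, h, h'⟩
  exact ⟨c, congrArg Subtype.val hc⟩

/-- A real vector of N is its own conjugate, hence a complex multiple of ξ; its real part is then a
real multiple. -/
theorem nullLine_eq (x : M) : nullLine N x = Submodule.span ℝ {ξ x} := by
  refine le_antisymm (fun v hv => ?_) ((Submodule.span_singleton_le_iff_mem _ _).mpr (hξ.mem x))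
  have hv : ofReal x v ∈ N x := hv
  obtain ⟨c, hc⟩ := exists_smul_of_mem_inter hN hξ hv (by rwa [conj_ofReal])
  refine Submodule.mem_span_singleton.mpr ⟨c.re, ?_⟩
  have := congrArg (rePart x) hc
  simpa [rePart_smul] using this

theorem mem_nullLineC {x : M} {z : CTangent E x} :
    z ∈ complexWitt g N ξ' .R x ↔ ∃ c : ℂ, c • ofReal x (ξ x) = z := by
  change z ∈ (nullLine N x).baseChange ℂ ↔ _
  rw [nullLine_eq hN hξ, Submodule.baseChange_span, Set.image_singleton,
    Submodule.mem_span_singleton]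
  rfl

omit hN hξ in
theorem mem_dualLineC {x : M} {z : CTangent E x} :
    z ∈ complexWitt g N ξ' .Rdual x ↔ ∃ c : ℂ, c • ofReal x (ξ' x) = z := by
  change z ∈ (dualLine ξ' x).baseChange ℂ ↔ _
  rw [dualLine, Submodule.baseChange_span, Set.image_singleton, Submodule.mem_span_singleton]
  rfl

theorem mem_screen {x : M} {w : TangentSpace 𝓘(ℝ, E) x} :
    w ∈ screen g N ξ' x ↔ g.val x w (ξ x) = 0 ∧ g.val x w (ξ' x) = 0 := by
  rw [screen, nullLine_eq hN hξ, dualLine, ← Submodule.span_union, LinearMap.BilinForm.mem_orthogonal_iff]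
  constructor
  · intro h
    rw [g.symm x w, g.symm x w]
    exact ⟨h _ (Submodule.subset_span (by simp)), h _ (Submodule.subset_span (by simp))⟩
  · rintro ⟨h1, h2⟩ v hv
    induction hv using Submodule.span_induction with
    | mem v hv =>
      rcases hv with rfl | rfl
      · change g.val x _ w = 0; rwa [g.symm]
      · change g.val x _ w = 0; rwa [g.symm]
    | zero =>
      change (g.val x).toBilinForm 0 w = 0
      rw [LinearMap.BilinForm.zero_left]
    | add a b _ _ ha hb =>
      change (g.val x).toBilinForm (a + b) w = 0
      rw [LinearMap.BilinForm.add_left, show (g.val x).toBilinForm a w = 0 from ha,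
        show (g.val x).toBilinForm b w = 0 from hb, add_zero]
    | smul c a _ ha =>
      change (g.val x).toBilinForm (c • a) w = 0
      rw [LinearMap.BilinForm.smul_left, show (g.val x).toBilinForm a w = 0 from ha, mul_zero]

omit hN hξ in
theorem complexMetric_ofReal_right_eq_zero {x : M} {z : CTangent E x}
    {v : TangentSpace 𝓘(ℝ, E) x} : (complexCalculus g).metric x z (ofReal x v) = 0 ↔
      g.val x (rePart x z) v = 0 ∧ g.val x (imPart x z) v = 0 := by
  rw [complexMetric_apply, Complex.ext_iff]
  simp

theorem mem_screenC {x : M} {z : CTangent E x} : z ∈ (screen g N ξ' x).baseChange ℂ ↔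
    (complexCalculus g).metric x z (ofReal x (ξ x)) = 0 ∧
      (complexCalculus g).metric x z (ofReal x (ξ' x)) = 0 := by
  rw [mem_baseChange_iff, mem_screen hN hξ, mem_screen hN hξ, complexMetric_ofReal_right_eq_zero,
    complexMetric_ofReal_right_eq_zero]
  tauto

/-- Orthogonality to ξ is automatic, because N is isotropic and contains ξ. -/
theorem mem_tangent10 {x : M} {z : CTangent E x} : z ∈ tangent10 g N ξ' x ↔
    z ∈ N x ∧ (complexCalculus g).metric x z (ofReal x (ξ' x)) = 0 := by
  rw [tangent10, Submodule.mem_inf, mem_screenC hN hξ]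
  exact ⟨fun h => ⟨h.1, h.2.2⟩, fun h => ⟨h.1, hN.isotropic x _ h.1 _ (hξ.mem x), h.2⟩⟩

omit hN hξ in
theorem mem_tangent01 {x : M} {z : CTangent E x} : z ∈ complexWitt g N ξ' .T01 x ↔
    conjTangent x z ∈ complexWitt g N ξ' .T10 x := Iff.rfl

theorem tangent10_perp {x : M} {z : CTangent E x} (hz : z ∈ complexWitt g N ξ' .T10 x) :
    (complexCalculus g).metric x z (ofReal x (ξ x)) = 0 ∧
      (complexCalculus g).metric x z (ofReal x (ξ' x)) = 0 :=
  (mem_screenC hN hξ).mp hz.2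

theorem tangent01_perp {x : M} {z : CTangent E x} (hz : z ∈ complexWitt g N ξ' .T01 x) :
    (complexCalculus g).metric x z (ofReal x (ξ x)) = 0 ∧
      (complexCalculus g).metric x z (ofReal x (ξ' x)) = 0 := by
  have h := tangent10_perp hN hξ (mem_tangent01.mp hz)
  rw [← conj_ofReal x (ξ x), ← conj_ofReal x (ξ' x), complexMetric_conj, complexMetric_conj] at h
  simpa only [map_eq_zero] using h

/-- Summands of the complex Witt structure are orthogonal unless they are in duality. -/
theorem complexWitt_orthogonal {i j : ComplexIndex} (hij : j ≠ i.star) {x : M}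
    {v w : CTangent E x} (hv : v ∈ complexWitt g N ξ' i x) (hw : w ∈ complexWitt g N ξ' j x) :
    (complexCalculus g).metric x v w = 0 := by
  have key : ∀ a b : TangentSpace 𝓘(ℝ, E) x, g.val x a b = 0 → ∀ c d : ℂ,
      (complexCalculus g).metric x (c • ofReal x a) (d • ofReal x b) = 0 := by
    intro a b h c d
    simp [complexMetric_ofReal, h]
  have sw : ∀ (a : TangentSpace 𝓘(ℝ, E) x) (c : ℂ) (z : CTangent E x),
      (complexCalculus g).metric x z (ofReal x a) = 0 →
        (complexCalculus g).metric x z (c • ofReal x a) = 0 := by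
    intro a c z h
    rw [map_smul, h, smul_zero]
  cases i <;> cases j <;> simp only [ComplexIndex.star, ne_eq, not_true_eq_false, reduceCtorEq,
    not_false_eq_true] at hij
  · obtain ⟨c, rfl⟩ := (mem_nullLineC hN hξ).mp hv
    obtain ⟨d, rfl⟩ := (mem_nullLineC hN hξ).mp hw
    exact key _ _ (null hN hξ x) c d
  · obtain ⟨c, rfl⟩ := (mem_nullLineC hN hξ).mp hv
    rw [complexMetric_symm]
    exact sw _ _ _ (tangent10_perp hN hξ hw).1
  · obtain ⟨c, rfl⟩ := (mem_nullLineC hN hξ).mp hv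
    rw [complexMetric_symm]
    exact sw _ _ _ (tangent01_perp hN hξ hw).1
  · obtain ⟨c, rfl⟩ := mem_dualLineC.mp hv
    obtain ⟨d, rfl⟩ := mem_dualLineC.mp hw
    exact key _ _ (hξ.null' x) c d
  · obtain ⟨c, rfl⟩ := mem_dualLineC.mp hv
    rw [complexMetric_symm]
    exact sw _ _ _ (tangent10_perp hN hξ hw).2
  · obtain ⟨c, rfl⟩ := mem_dualLineC.mp hv
    rw [complexMetric_symm]
    exact sw _ _ _ (tangent01_perp hN hξ hw).2
  · obtain ⟨d, rfl⟩ := (mem_nullLineC hN hξ).mp hw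
    exact sw _ _ _ (tangent10_perp hN hξ hv).1
  · obtain ⟨d, rfl⟩ := mem_dualLineC.mp hw
    exact sw _ _ _ (tangent10_perp hN hξ hv).2
  · exact hN.isotropic x _ hv.1 _ hw.1
  · obtain ⟨d, rfl⟩ := (mem_nullLineC hN hξ).mp hw
    exact sw _ _ _ (tangent01_perp hN hξ hv).1
  · obtain ⟨d, rfl⟩ := mem_dualLineC.mp hw
    exact sw _ _ _ (tangent01_perp hN hξ hv).2
  · have := hN.isotropic x _ (mem_tangent01.mp hv).1 _ (mem_tangent01.mp hw).1
    rw [complexMetric_conj] at this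
    simpa only [map_eq_zero] using this

/-- N is the direct sum of ℂξ and T^{1,0}: subtracting g(z,ξ')ξ from z in N makes it orthogonal to
ξ', and no nonzero multiple of ξ is orthogonal to ξ'. -/
theorem finrank_tangent10 [FiniteDimensional ℝ E] (x : M) :
    Module.finrank ℂ (tangent10 g N ξ' x) = m := by
  have h1 : Submodule.span ℂ {ofReal x (ξ x)} ⊔ tangent10 g N ξ' x = N x := by
    refine le_antisymm (sup_le ((Submodule.span_singleton_le_iff_mem _ _).mpr (hξ.mem x))
      inf_le_left) fun z hz => ?_
    refine Submodule.mem_sup.mpr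
      ⟨(complexCalculus g).metric x z (ofReal x (ξ' x)) • ofReal x (ξ x),
        Submodule.smul_mem _ _ (Submodule.mem_span_singleton_self _),
        z - (complexCalculus g).metric x z (ofReal x (ξ' x)) • ofReal x (ξ x), ?_, by abel⟩
    refine (mem_tangent10 hN hξ).mpr ⟨(N x).sub_mem hz ((N x).smul_mem _ (hξ.mem x)), ?_⟩
    simp [complexMetric_ofReal, hξ.dual x]
  have h2 : Submodule.span ℂ {ofReal x (ξ x)} ⊓ tangent10 g N ξ' x = ⊥ := by
    refine eq_bot_iff.mpr fun z hz => ?_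
    obtain ⟨c, rfl⟩ := Submodule.mem_span_singleton.mp hz.1
    have := ((mem_tangent10 hN hξ).mp hz.2).2
    simp only [map_smul, LinearMap.smul_apply, complexMetric_ofReal, hξ.dual x] at this
    simp_all
  have h3 := Submodule.finrank_sup_add_finrank_inf_eq (Submodule.span ℂ {ofReal x (ξ x)})
    (tangent10 g N ξ' x)
  rw [h1, h2, hN.subbundle.finrank_eq x, finrank_span_singleton (ofReal_null_ne hξ x),
    finrank_bot] at h3
  omega

-- Conjugation is only semilinear, so the ranks are compared through an additive equivalence over
-- the conjugation of ℂ.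
omit hN hξ in
theorem finrank_conjSubspace (x : M) (V : Submodule ℂ (CTangent E x)) :
    Module.finrank ℂ (conjSubspace x V) = Module.finrank ℂ V := by
  let e : conjSubspace x V ≃+ V :=
    { toFun := fun z => ⟨conjTangent x z, z.2⟩
      invFun := fun z => ⟨conjTangent x z, by rw [mem_conjSubspace, conj_conj]; exact z.2⟩
      left_inv := fun z => Subtype.ext (conj_conj x _)
      right_inv := fun z => Subtype.ext (conj_conj x _)
      map_add' := fun z w => Subtype.ext (map_add _ _ _) }
  refine congrArg Cardinal.toNat (rank_eq_of_equiv_equiv (starRingEnd ℂ) e ?_ fun c z => ?_)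
  · exact star_involutive.bijective
  · exact Subtype.ext (LinearMap.map_smulₛₗ _ _ _)

theorem complexWitt_finrank [FiniteDimensional ℝ E] (i : ComplexIndex) (x : M) :
    Module.finrank ℂ (complexWitt g N ξ' i x) = ComplexIndex.rank m i := by
  have hd : ofReal x (ξ' x) ≠ 0 := by
    intro h
    have h1 := hξ.dual x
    rw [ofReal_injective x (h.trans (map_zero _).symm)] at h1
    simp at h1
  cases i
  · have : complexWitt g N ξ' .R x = Submodule.span ℂ {ofReal x (ξ x)} := by
      ext z; rw [mem_nullLineC hN hξ, Submodule.mem_span_singleton]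
    rw [this, finrank_span_singleton (ofReal_null_ne hξ x)]; rfl
  · have : complexWitt g N ξ' .Rdual x = Submodule.span ℂ {ofReal x (ξ' x)} := by
      ext z; rw [mem_dualLineC, Submodule.mem_span_singleton]
    rw [this, finrank_span_singleton hd]; rfl
  · exact finrank_tangent10 hN hξ x
  · exact (finrank_conjSubspace x _).trans (finrank_tangent10 hN hξ x)

/-- The ranks add up to 2m + 2, so independence suffices. In a vanishing sum, pairing with ξ and ξ'
kills the two line components; what is left is a vector of T^{1,0} ∩ T^{0,1}, thus a multiple of ξ
that is orthogonal to ξ', hence zero. -/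
theorem complexWitt_isInternal [FiniteDimensional ℝ E] (x : M) :
    DirectSum.IsInternal fun i => complexWitt g N ξ' i x := by
  refine isInternal_of_finrank (fun v hv h0 => ?_) ?_
  · rw [ComplexIndex.sum_univ] at h0
    obtain ⟨a, ha⟩ := (mem_nullLineC hN hξ).mp (hv .R)
    obtain ⟨b, hb⟩ := mem_dualLineC.mp (hv .Rdual)
    have p1 := congrArg (fun z => (complexCalculus g).metric x z (ofReal x (ξ x))) h0
    have p2 := congrArg (fun z => (complexCalculus g).metric x z (ofReal x (ξ' x))) h0
    simp only [← ha, ← hb, map_add, map_smul, LinearMap.add_apply, LinearMap.smul_apply,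
      complexMetric_ofReal, (tangent10_perp hN hξ (hv .T10)).1, (tangent10_perp hN hξ (hv .T10)).2,
      (tangent01_perp hN hξ (hv .T01)).1, (tangent01_perp hN hξ (hv .T01)).2, null hN hξ x,
      hξ.null' x, hξ.dual x, dual' hξ x, map_zero, LinearMap.zero_apply] at p1 p2
    have hb0 : b = 0 := by simpa using p1
    have ha0 : a = 0 := by simpa using p2
    rw [← ha, ← hb, ha0, hb0, zero_smul, zero_smul, zero_add, zero_add] at h0
    have hs : v .T01 = -v .T10 := by rw [eq_neg_iff_add_eq_zero, add_comm]; exact h0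
    have ht := hv .T10
    have ht' := mem_tangent01.mp (hv .T01)
    rw [hs, map_neg, Submodule.neg_mem_iff] at ht'
    obtain ⟨c, hc⟩ := exists_smul_of_mem_inter hN hξ ht.1 ht'.1
    have hp := (tangent10_perp hN hξ ht).2
    rw [← hc, map_smul, LinearMap.smul_apply, complexMetric_ofReal, hξ.dual x] at hp
    have hc0 : c = 0 := by simpa using hp
    have ht0 : v .T10 = 0 := by rw [← hc, hc0, zero_smul]
    intro i
    cases i
    · rw [← ha, ha0, zero_smul]
    · rw [← hb, hb0, zero_smul]
    · exact ht0
    · rw [hs, ht0, neg_zero]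
  · simp only [complexWitt_finrank hN hξ, ComplexIndex.sum_univ, ComplexIndex.rank,
      finrank_cTangent, hN.dim]
    omega

/-! #### The real decomposition -/

theorem mem_nullLine {x : M} {v : TangentSpace 𝓘(ℝ, E) x} :
    v ∈ realWitt g N ξ' .R x ↔ ∃ c : ℝ, c • ξ x = v := by
  change v ∈ nullLine N x ↔ _
  rw [nullLine_eq hN hξ, Submodule.mem_span_singleton]

omit hN hξ in
theorem mem_dualLine {x : M} {v : TangentSpace 𝓘(ℝ, E) x} :
    v ∈ realWitt g N ξ' .Rdual x ↔ ∃ c : ℝ, c • ξ' x = v := Submodule.mem_span_singleton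

theorem realWitt_orthogonal {i j : RealIndex} (hij : j ≠ i.star) {x : M}
    {v w : TangentSpace 𝓘(ℝ, E) x} (hv : v ∈ realWitt g N ξ' i x) (hw : w ∈ realWitt g N ξ' j x) :
    g.val x v w = 0 := by
  cases i <;> cases j <;> simp only [RealIndex.star, ne_eq, not_true_eq_false, reduceCtorEq,
    not_false_eq_true] at hij
  · obtain ⟨c, rfl⟩ := (mem_nullLine hN hξ).mp hv
    obtain ⟨d, rfl⟩ := (mem_nullLine hN hξ).mp hw
    simp [null hN hξ x]
  · obtain ⟨c, rfl⟩ := (mem_nullLine hN hξ).mp hv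
    rw [g.symm, map_smul, ((mem_screen hN hξ).mp hw).1, smul_zero]
  · obtain ⟨c, rfl⟩ := mem_dualLine.mp hv
    obtain ⟨d, rfl⟩ := mem_dualLine.mp hw
    simp [hξ.null' x]
  · obtain ⟨c, rfl⟩ := mem_dualLine.mp hv
    rw [g.symm, map_smul, ((mem_screen hN hξ).mp hw).2, smul_zero]
  · obtain ⟨c, rfl⟩ := (mem_nullLine hN hξ).mp hw
    rw [map_smul, ((mem_screen hN hξ).mp hv).1, smul_zero]
  · obtain ⟨c, rfl⟩ := mem_dualLine.mp hw
    rw [map_smul, ((mem_screen hN hξ).mp hv).2, smul_zero]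

theorem screen_decomposition (x : M) (v : TangentSpace 𝓘(ℝ, E) x) :
    v - g.val x v (ξ' x) • ξ x - g.val x v (ξ x) • ξ' x ∈ screen g N ξ' x := by
  rw [mem_screen hN hξ]
  constructor <;> simp [null hN hξ x, hξ.null' x, hξ.dual x, dual' hξ x]

theorem realWitt_isInternal (x : M) : DirectSum.IsInternal fun i => realWitt g N ξ' i x := by
  refine isInternal_of_sum (fun v hv h0 => ?_) fun w => ?_
  · rw [RealIndex.sum_univ] at h0
    obtain ⟨a, ha⟩ := (mem_nullLine hN hξ).mp (hv .R)
    obtain ⟨b, hb⟩ := mem_dualLine.mp (hv .Rdual)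
    have hs := (mem_screen hN hξ).mp (hv .S)
    have p1 := congrArg (fun z => g.val x z (ξ x)) h0
    have p2 := congrArg (fun z => g.val x z (ξ' x)) h0
    simp only [← ha, ← hb, map_add, map_smul, add_apply, smul_apply,
      hs.1, hs.2, null hN hξ x, hξ.null' x, hξ.dual x, dual' hξ x, map_zero, zero_apply] at p1 p2
    have hb0 : b = 0 := by simpa using p1
    have ha0 : a = 0 := by simpa using p2
    rw [← ha, ← hb, ha0, hb0, zero_smul, zero_smul, zero_add, zero_add] at h0
    intro i
    cases i
    · rw [← ha, ha0, zero_smul]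
    · rw [← hb, hb0, zero_smul]
    · exact h0
  · refine ⟨fun i => match i with
      | .R => g.val x w (ξ' x) • ξ x
      | .Rdual => g.val x w (ξ x) • ξ' x
      | .S => w - g.val x w (ξ' x) • ξ x - g.val x w (ξ x) • ξ' x, fun i => ?_, ?_⟩
    · cases i
      · exact (mem_nullLine hN hξ).mpr ⟨_, rfl⟩
      · exact mem_dualLine.mpr ⟨_, rfl⟩
      · exact screen_decomposition hN hξ x w
    · rw [RealIndex.sum_univ]
      dsimp only
      abel

theorem realWitt_finrank [FiniteDimensional ℝ E] (i : RealIndex) (x : M) :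
    Module.finrank ℝ (realWitt g N ξ' i x) = RealIndex.rank m i := by
  have h1 : Module.finrank ℝ (realWitt g N ξ' .R x) = 1 := by
    change Module.finrank ℝ (nullLine N x) = 1
    rw [nullLine_eq hN hξ, finrank_span_singleton]
    exact fun h => ofReal_null_ne hξ x (by rw [h, map_zero])
  have h2 : Module.finrank ℝ (realWitt g N ξ' .Rdual x) = 1 := by
    change Module.finrank ℝ (Submodule.span ℝ {ξ' x}) = 1
    refine finrank_span_singleton fun h => ?_
    have := hξ.dual x
    simp [h] at this
  have h3 := finrank_of_isInternal (realWitt_isInternal hN hξ x)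
  rw [RealIndex.sum_univ, h1, h2, show Module.finrank ℝ (TangentSpace 𝓘(ℝ, E) x) = 2 * m + 2 from
    hN.dim] at h3
  cases i
  · exact h1
  · exact h2
  · simp only [RealIndex.rank]
    omega

/-- A Lorentzian metric is not negative semidefinite on any plane. If g(w,w) ≤ 0, the vector u in
the span of w and ξ - ξ' (of square -2) is built to be orthogonal to the timelike v, and g(u,u) ≤ 0,
so u = 0. Pairing u with ξ gives g(v,w) = 0, and then the signature makes g(w,w) positive after all.
-/
theorem screen_positive {x : M} {w : TangentSpace 𝓘(ℝ, E) x} (hw : w ∈ screen g N ξ' x)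
    (h0 : w ≠ 0) : 0 < g.val x w w := by
  obtain ⟨v, -, hv⟩ := hN.lorentzian x
  obtain ⟨h1, h2⟩ := (mem_screen hN hξ).mp hw
  by_contra hneg
  rw [not_lt] at hneg
  set a := g.val x v w with ha
  set b := g.val x v (ξ x - ξ' x) with hb
  set u := a • (ξ x - ξ' x) - b • w with hu
  have hvu : g.val x v u = 0 := by
    simp only [hu, map_sub, map_smul, smul_eq_mul, ← ha]
    rw [← map_sub, ← hb]
    ring
  have h1' : g.val x (ξ x) w = 0 := by rw [g.symm, h1]
  have h2' : g.val x (ξ' x) w = 0 := by rw [g.symm, h2]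
  have huu : g.val x u u = -2 * a ^ 2 + b ^ 2 * g.val x w w := by
    simp only [hu, map_sub, map_smul, smul_eq_mul, sub_apply, smul_apply, h1, h2, h1', h2',
      null hN hξ x, hξ.null' x, hξ.dual x, dual' hξ x]
    ring
  have hu0 : u = 0 := by
    by_contra hne
    have := hv u hvu hne
    rw [huu] at this
    nlinarith [sq_nonneg a, mul_nonneg (sq_nonneg b) (neg_nonneg.mpr hneg)]
  have ha0 : a = 0 := by
    have := congrArg (fun z => g.val x z (ξ x)) hu0
    simpa [hu, h1, null hN hξ x, dual' hξ x] using this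
  exact absurd (hv w ha0 h0) (not_lt.mpr hneg)

end Robinson


theorem eq_zero_of_eq_neg (𝕜 : Type*) [Field 𝕜] [CharZero 𝕜] {W : Type*} [AddCommGroup W]
    [Module 𝕜 W] {v : W} (h : v = -v) : v = 0 := by
  have h2 : (2 : 𝕜) • v = 0 := by rw [two_smul, ← eq_neg_iff_add_eq_zero]; exact h
  exact (smul_eq_zero.mp h2).resolve_left two_ne_zero

/-! ### The complex structure of the screen and the two Witt structures. -/

section Hermitian

variable {E : Type*} [NormedAddCommGroup E] [NormedSpace ℝ E] [FiniteDimensional ℝ E]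
  {M : Type*} [TopologicalSpace M] [ChartedSpace E M] [IsManifold 𝓘(ℝ, E) ∞ M]
  {m : ℕ} {g : PseudoMetric E M} {N : Π x : M, Submodule ℂ (CTangent E x)}
  {ξ ξ' : Π x : M, TangentSpace 𝓘(ℝ, E) x} (hN : IsAlmostRobinson m g N)
  (hξ : IsNullFrame g N ξ ξ')

/-- The endomorphism of `T^ℂ M` that is `i` on `T^{1,0} M`, `-i` on `T^{0,1} M` and `0` on the
two line bundles. -/
def complexJ (g : PseudoMetric E M) (N : Π x : M, Submodule ℂ (CTangent E x))
    (ξ' : Π x : M, TangentSpace 𝓘(ℝ, E) x) (x : M) : CTangent E x →ₗ[ℂ] CTangent E x :=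
  Complex.I • component (complexWitt g N ξ') .T10 x
    - Complex.I • component (complexWitt g N ξ') .T01 x

theorem screenJ_apply (x : M) (v : TangentSpace 𝓘(ℝ, E) x) :
    screenJ g N ξ' x v = rePart x (complexJ g N ξ' x (ofReal x v)) := rfl

include hN hξ

theorem complexJ_R {x : M} {z : CTangent E x} (hz : z ∈ complexWitt g N ξ' .R x) :
    complexJ g N ξ' x z = 0 := by
  have h := complexWitt_isInternal hN hξ x
  simp [complexJ, component_of_mem_ne h (j := .R) (k := .T10) (by simp) hz,
    component_of_mem_ne h (j := .R) (k := .T01) (by simp) hz]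

theorem complexJ_Rdual {x : M} {z : CTangent E x} (hz : z ∈ complexWitt g N ξ' .Rdual x) :
    complexJ g N ξ' x z = 0 := by
  have h := complexWitt_isInternal hN hξ x
  simp [complexJ, component_of_mem_ne h (j := .Rdual) (k := .T10) (by simp) hz,
    component_of_mem_ne h (j := .Rdual) (k := .T01) (by simp) hz]

theorem complexJ_T10 {x : M} {z : CTangent E x} (hz : z ∈ complexWitt g N ξ' .T10 x) :
    complexJ g N ξ' x z = Complex.I • z := by
  have h := complexWitt_isInternal hN hξ x
  simp [complexJ, component_of_mem h hz,
    component_of_mem_ne h (j := .T10) (k := .T01) (by simp) hz]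

theorem complexJ_T01 {x : M} {z : CTangent E x} (hz : z ∈ complexWitt g N ξ' .T01 x) :
    complexJ g N ξ' x z = -Complex.I • z := by
  have h := complexWitt_isInternal hN hξ x
  simp [complexJ, component_of_mem h hz,
    component_of_mem_ne h (j := .T01) (k := .T10) (by simp) hz]

/-- Induction over the complex Witt decomposition. -/
@[elab_as_elim]
theorem complexWitt_induction {x : M} {P : CTangent E x → Prop}
    (hP : ∀ i, ∀ z ∈ complexWitt g N ξ' i x, P z) (hadd : ∀ z w, P z → P w → P (z + w))
    (z : CTangent E x) : P z := by
  rw [← sum_component (complexWitt_isInternal hN hξ x) z, ComplexIndex.sum_univ]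
  exact hadd _ _ (hadd _ _ (hadd _ _ (hP _ _ (component_mem _ _ _)) (hP _ _ (component_mem _ _ _)))
    (hP _ _ (component_mem _ _ _))) (hP _ _ (component_mem _ _ _))

/-- Conjugation exchanges T^{1,0} with T^{0,1} and at the same time i with -i, and it preserves both
lines. This is why J is real. -/
theorem complexJ_conj {x : M} (z : CTangent E x) :
    complexJ g N ξ' x (conjTangent x z) = conjTangent x (complexJ g N ξ' x z) := by
  refine complexWitt_induction hN hξ (fun i z hz => ?_) (fun z w hz hw => ?_) z
  · cases i
    · have hz' : conjTangent x z ∈ complexWitt g N ξ' .R x := by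
        obtain ⟨c, rfl⟩ := (mem_nullLineC hN hξ).mp hz
        exact (mem_nullLineC hN hξ).mpr ⟨starRingEnd ℂ c, by rw [LinearMap.map_smulₛₗ, conj_ofReal]⟩
      rw [complexJ_R hN hξ hz, complexJ_R hN hξ hz', map_zero]
    · have hz' : conjTangent x z ∈ complexWitt g N ξ' .Rdual x := by
        obtain ⟨c, rfl⟩ := mem_dualLineC.mp hz
        exact mem_dualLineC.mpr ⟨starRingEnd ℂ c, by rw [LinearMap.map_smulₛₗ, conj_ofReal]⟩
      rw [complexJ_Rdual hN hξ hz, complexJ_Rdual hN hξ hz', map_zero]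
    · have hz' : conjTangent x z ∈ complexWitt g N ξ' .T01 x := by
        rw [mem_tangent01, conj_conj]; exact hz
      rw [complexJ_T10 hN hξ hz, complexJ_T01 hN hξ hz', LinearMap.map_smulₛₗ, Complex.conj_I]
    · rw [complexJ_T01 hN hξ hz, complexJ_T10 hN hξ (mem_tangent01.mp hz), LinearMap.map_smulₛₗ,
        map_neg, Complex.conj_I, neg_neg]
  · simp only [map_add, hz, hw]

/-- By compatibility with conjugation, the real part taken in the definition of `screenJ` discards
nothing. -/
theorem ofReal_screenJ {x : M} (v : TangentSpace 𝓘(ℝ, E) x) :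
    ofReal x (screenJ g N ξ' x v) = complexJ g N ξ' x (ofReal x v) := by
  have h : imPart x (complexJ g N ξ' x (ofReal x v)) = 0 := by
    have := congrArg (imPart x) (complexJ_conj hN hξ (ofReal x v))
    rw [conj_ofReal, imPart_conj] at this
    exact eq_zero_of_eq_neg ℝ this
  refine CTangent.ext ?_ ?_
  · rw [rePart_ofReal, screenJ_apply]
  · rw [imPart_ofReal, h]

theorem baseChange_screenJ (x : M) :
    (screenJ g N ξ' x).baseChange ℂ = complexJ g N ξ' x := by
  ext v
  change 1 ⊗ₜ[ℝ] screenJ g N ξ' x v = _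
  exact ofReal_screenJ hN hξ v

/-- If z is an eigenvector for i, then z is its T^{1,0}-component minus its T^{0,1}-component;
comparing T^{0,1}-components shows that the latter equals its own negative. -/
theorem complexJ_eq_iff_T10 {x : M} {z : CTangent E x} :
    z ∈ complexWitt g N ξ' .T10 x ↔ complexJ g N ξ' x z = Complex.I • z := by
  refine ⟨complexJ_T10 hN hξ, fun h => ?_⟩
  have hi := complexWitt_isInternal hN hξ x
  have h2 : z = component (complexWitt g N ξ') .T10 x z
      - component (complexWitt g N ξ') .T01 x z := by
    refine smul_right_injective _ Complex.I_ne_zero ?_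
    dsimp only
    rw [← h, smul_sub]
    rfl
  have h3 := congrArg (component (complexWitt g N ξ') .T01 x) h2
  rw [map_sub, component_of_mem_ne hi (j := .T10) (by simp) (component_mem _ _ _),
    component_of_mem hi (component_mem _ _ _), zero_sub] at h3
  rw [eq_zero_of_eq_neg ℂ h3, sub_zero] at h2
  exact h2 ▸ component_mem _ _ _

theorem complexJ_eq_iff_T01 {x : M} {z : CTangent E x} :
    z ∈ complexWitt g N ξ' .T01 x ↔ complexJ g N ξ' x z = -Complex.I • z := by
  rw [mem_tangent01, complexJ_eq_iff_T10 hN hξ, complexJ_conj hN hξ]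
  constructor
  · intro h
    have := congrArg (conjTangent x) h
    rwa [conj_conj, LinearMap.map_smulₛₗ, Complex.conj_I, conj_conj] at this
  · intro h
    rw [h, LinearMap.map_smulₛₗ, map_neg, Complex.conj_I, neg_neg]

/-- Only dual summands pair nontrivially, and on dual summands the eigenvalues are opposite: 0 and
0, or i and -i. -/
theorem complexJ_skew {x : M} (z w : CTangent E x) :
    (complexCalculus g).metric x (complexJ g N ξ' x z) w =
      -(complexCalculus g).metric x z (complexJ g N ξ' x w) := by
  have orth := fun {i j : ComplexIndex} (h : j ≠ i.star) {v w : CTangent E x} =>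
    complexWitt_orthogonal hN hξ h (v := v) (w := w)
  refine complexWitt_induction hN hξ (fun i z hz => ?_) (fun z w hz hw => ?_) z
  · refine complexWitt_induction hN hξ (fun j w hw => ?_) (fun z w hz hw => ?_) w
    · by_cases h : j = i.star
      · subst h
        cases i
        · rw [complexJ_R hN hξ hz, complexJ_Rdual hN hξ hw]; simp
        · rw [complexJ_Rdual hN hξ hz, complexJ_R hN hξ hw]; simp
        · rw [complexJ_T10 hN hξ hz, complexJ_T01 hN hξ hw]; simp
        · rw [complexJ_T01 hN hξ hz, complexJ_T10 hN hξ hw]; simp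
      · have hJ : ∀ k, ∀ v ∈ complexWitt g N ξ' k x, complexJ g N ξ' x v ∈ complexWitt g N ξ' k x := by
          intro k v hv
          cases k
          · rw [complexJ_R hN hξ hv]; exact Submodule.zero_mem _
          · rw [complexJ_Rdual hN hξ hv]; exact Submodule.zero_mem _
          · rw [complexJ_T10 hN hξ hv]; exact Submodule.smul_mem _ _ hv
          · rw [complexJ_T01 hN hξ hv]; exact Submodule.smul_mem _ _ hv
        rw [orth h (hJ _ _ hz) hw, orth h hz (hJ _ _ hw), neg_zero]
    · simp only [map_add, hz, hw]; ring
  · simp only [map_add, LinearMap.add_apply, hz, hw]; ring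

theorem complexJ_sq {x : M} (z : CTangent E x) :
    complexJ g N ξ' x (complexJ g N ξ' x z) =
      -(z - (complexCalculus g).metric x z (ofReal x (ξ' x)) • ofReal x (ξ x)
        - (complexCalculus g).metric x z (ofReal x (ξ x)) • ofReal x (ξ' x)) := by
  refine complexWitt_induction hN hξ (fun i z hz => ?_) (fun z w hz hw => ?_) z
  · cases i
    · rw [complexJ_R hN hξ hz, map_zero]
      obtain ⟨c, rfl⟩ := (mem_nullLineC hN hξ).mp hz
      simp [complexMetric_ofReal, null hN hξ x, hξ.dual x]
    · rw [complexJ_Rdual hN hξ hz, map_zero]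
      obtain ⟨c, rfl⟩ := mem_dualLineC.mp hz
      simp [complexMetric_ofReal, hξ.null' x, dual' hξ x]
    · rw [complexJ_T10 hN hξ hz, map_smul, complexJ_T10 hN hξ hz, smul_smul, Complex.I_mul_I,
        (tangent10_perp hN hξ hz).1, (tangent10_perp hN hξ hz).2]
      simp
    · rw [complexJ_T01 hN hξ hz, map_smul, complexJ_T01 hN hξ hz, smul_smul, neg_mul_neg,
        Complex.I_mul_I, (tangent01_perp hN hξ hz).1, (tangent01_perp hN hξ hz).2]
      simp
  · simp only [map_add, LinearMap.add_apply, hz, hw]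
    module

theorem screenJ_skew {x : M} (v w : TangentSpace 𝓘(ℝ, E) x) :
    g.val x (screenJ g N ξ' x v) w = -g.val x v (screenJ g N ξ' x w) := by
  have := complexJ_skew hN hξ (ofReal x v) (ofReal x w)
  rw [← ofReal_screenJ hN hξ, ← ofReal_screenJ hN hξ, complexMetric_ofReal,
    complexMetric_ofReal] at this
  exact_mod_cast this

theorem screenJ_sq {x : M} (v : TangentSpace 𝓘(ℝ, E) x) :
    screenJ g N ξ' x (screenJ g N ξ' x v) =
      -(v - g.val x v (ξ' x) • ξ x - g.val x v (ξ x) • ξ' x) := by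
  refine ofReal_injective x ?_
  rw [ofReal_screenJ hN hξ, ofReal_screenJ hN hξ, complexJ_sq hN hξ, complexMetric_ofReal,
    complexMetric_ofReal]
  have e : ∀ (r : ℝ) (w : TangentSpace 𝓘(ℝ, E) x),
      (r : ℂ) • ofReal x w = ofReal x (r • w) := fun r w =>
    CTangent.ext (by rw [rePart_smul]; simp) (by rw [imPart_smul]; simp)
  rw [e, e, map_neg, map_sub, map_sub]

theorem screenJ_left (x : M) : screenJ g N ξ' x (ξ x) = 0 := by
  refine ofReal_injective x ?_
  rw [ofReal_screenJ hN hξ, complexJ_R hN hξ ((mem_nullLineC hN hξ).mpr ⟨1, one_smul _ _⟩), map_zero]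

theorem screenJ_right (x : M) : screenJ g N ξ' x (ξ' x) = 0 := by
  refine ofReal_injective x ?_
  rw [ofReal_screenJ hN hξ, complexJ_Rdual hN hξ (mem_dualLineC.mpr ⟨1, one_smul _ _⟩), map_zero]

/-! #### Subbundles -/

variable [CompleteSpace E] [T2Space M]

theorem complexWitt_isSubbundle (i : ComplexIndex) :
    (complexCalculus g).IsSubbundle (complexWitt g N ξ' i) (ComplexIndex.rank m i) := by
  have L := complexCalculus_isLawful g
  have s1 : (complexCalculus g).Smooth (complexify ξ) := complexify_smooth g hξ.smooth
  have s2 : (complexCalculus g).Smooth (complexify ξ') := complexify_smooth g hξ.smooth'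
  -- A local frame of N is projected to T^{1,0} along ξ. This gives m + 1 spanning sections for a
  -- bundle of rank m, hence the detour through `isSubbundle_of_span`.
  have h10 : ∀ x₀ : M, ∃ U, IsOpen U ∧ x₀ ∈ U ∧ ∃ n : ℕ, ∃ t : Fin n → Π x : M, CTangent E x,
      (∀ a, (complexCalculus g).SmoothOn U (t a)) ∧ ∀ x ∈ U,
        Submodule.span ℂ (Set.range fun a => t a x) = complexWitt g N ξ' .T10 x := by
    intro x₀
    obtain ⟨U, hU, hx, s, hs, hsp⟩ := hN.subbundle x₀
    refine ⟨U, hU, hx, _, fun a x => s a x -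
      (complexCalculus g).pair (s a) (complexify ξ') x • complexify ξ x, fun a =>
      L.sec_sub (hs a) (L.sec_smul (L.pair_smooth (hs a) (L.sec_mono (Set.subset_univ U) s2))
        (L.sec_mono (Set.subset_univ U) s1)), fun x hxU => ?_⟩
    let Q : CTangent E x →ₗ[ℂ] CTangent E x := LinearMap.id -
      (((complexCalculus g).metric x).flip (ofReal x (ξ' x))).smulRight (ofReal x (ξ x))
    have hQ : ∀ z, Q z = z - (complexCalculus g).metric x z (ofReal x (ξ' x)) • ofReal x (ξ x) :=
      fun z => rfl
    have e : (Set.range fun a => s a x -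
        (complexCalculus g).pair (s a) (complexify ξ') x • complexify ξ x) =
        Q '' Set.range fun a => s a x := by
      rw [← Set.range_comp]; rfl
    rw [e, ← Submodule.map_span, (hsp x hxU).2]
    ext z
    constructor
    · rintro ⟨w, hw, rfl⟩
      refine (mem_tangent10 hN hξ).mpr
        ⟨(N x).sub_mem hw ((N x).smul_mem _ (hξ.mem x)), ?_⟩
      rw [hQ]
      simp [complexMetric_ofReal, hξ.dual x]
    · intro hz
      exact ⟨z, hz.1, by rw [hQ, (tangent10_perp hN hξ hz).2, zero_smul, sub_zero]⟩
  refine L.isSubbundle_of_span (complexWitt_finrank hN hξ i) fun x₀ => ?_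
  cases i
  · refine ⟨Set.univ, isOpen_univ, trivial, 1, fun _ => complexify ξ, fun _ => s1, fun x _ => ?_⟩
    ext z
    rw [mem_nullLineC hN hξ, Set.range_const, Submodule.mem_span_singleton]
    rfl
  · refine ⟨Set.univ, isOpen_univ, trivial, 1, fun _ => complexify ξ', fun _ => s2, fun x _ => ?_⟩
    ext z
    rw [mem_dualLineC, Set.range_const, Submodule.mem_span_singleton]
    rfl
  · exact h10 x₀
  · obtain ⟨U, hU, hx, n, t, ht, hsp⟩ := h10 x₀
    refine ⟨U, hU, hx, n, fun a x => conjTangent x (t a x), fun a => ⟨?_, ?_⟩, fun x hxU => ?_⟩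
    · exact SmoothFieldOn.congr (ht a).1 fun x _ => rePart_conj x _
    · exact SmoothFieldOn.congr ((realCalculus_isLawful g).sec_neg (ht a).2)
        fun x _ => imPart_conj x _
    · have e : (Set.range fun a => conjTangent x (t a x)) =
          conjTangent x '' Set.range fun a => t a x := by
        rw [← Set.range_comp]; rfl
      rw [e, ← Submodule.map_span, hsp x hxU]
      ext z
      constructor
      · rintro ⟨w, hw, rfl⟩
        rw [mem_tangent01, conj_conj]
        exact hw
      · intro hz
        exact ⟨conjTangent x z, hz, conj_conj x z⟩

theorem realWitt_isSubbundle (i : RealIndex) :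
    (realCalculus g).IsSubbundle (realWitt g N ξ' i) (RealIndex.rank m i) := by
  have L := realCalculus_isLawful g
  have s1 := hξ.smooth
  have s2 := hξ.smooth'
  refine L.isSubbundle_of_span (realWitt_finrank hN hξ i) fun x₀ => ?_
  cases i
  · refine ⟨Set.univ, isOpen_univ, trivial, 1, fun _ => ξ, fun _ => s1, fun x _ => ?_⟩
    ext z
    rw [mem_nullLine hN hξ, Set.range_const, Submodule.mem_span_singleton]
  · refine ⟨Set.univ, isOpen_univ, trivial, 1, fun _ => ξ', fun _ => s2, fun x _ => ?_⟩
    ext z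
    rw [mem_dualLine, Set.range_const, Submodule.mem_span_singleton]
  · obtain ⟨n, U, hU, hx, e, he, hsp⟩ := L.frame x₀
    have s1 := L.sec_mono (Set.subset_univ U) s1
    have s2 := L.sec_mono (Set.subset_univ U) s2
    refine ⟨U, hU, hx, n, fun a => endo ((realCalculus g).screenProj ξ ξ') (e a), fun a =>
      L.sec_sub (L.sec_sub (he a) (L.sec_smul (L.pair_smooth (he a) s2) s1))
        (L.sec_smul (L.pair_smooth (he a) s1) s2), fun x hxU => ?_⟩
    have er : (Set.range fun a => endo ((realCalculus g).screenProj ξ ξ') (e a) x) =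
        (realCalculus g).screenProj ξ ξ' x '' Set.range fun a => e a x := by
      rw [← Set.range_comp]; rfl
    rw [er, ← Submodule.map_span, (hsp x hxU).2]
    have hQ : ∀ z, (realCalculus g).screenProj ξ ξ' x z =
      z - g.val x z (ξ' x) • ξ x - g.val x z (ξ x) • ξ' x := fun z => rfl
    ext z
    constructor
    · rintro ⟨w, -, rfl⟩
      rw [hQ]
      exact screen_decomposition hN hξ x w
    · intro hz
      have hz' := (mem_screen hN hξ).mp hz
      exact ⟨z, trivial, by rw [hQ, hz'.1, hz'.2]; simp⟩

/-- An adapted frame consists of eigenvectors, and J is skew, so the products of JZ with the frame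
are constant multiples of those of Z. -/
theorem complexJ_smooth {Z : Π x : M, CTangent E x} (hZ : (complexCalculus g).Smooth Z) :
    (complexCalculus g).Smooth (endo (complexJ g N ξ') Z) := by
  have L := complexCalculus_isLawful g
  refine L.sec_local fun x₀ => ?_
  obtain ⟨U, hU, hx, s, hs, hsp⟩ := L.exists_adapted_frame (complexWitt_isSubbundle hN hξ)
    (complexWitt_isInternal hN hξ) x₀
  refine ⟨U, hU, hx, L.smoothOn_of_pair_frame hs (fun x hxU => (hsp x hxU).2) _ fun p => ?_⟩
  have hp := L.pair_smooth (L.sec_mono (Set.subset_univ U) hZ) (hs p)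
  have : ∃ c : ℂ, ∀ x ∈ U, complexJ g N ξ' x (s p x) = c • s p x := by
    obtain ⟨i, a⟩ := p
    cases i
    · exact ⟨0, fun x hxU => by rw [zero_smul, complexJ_R hN hξ ((hsp x hxU).1 ⟨.R, a⟩)]⟩
    · exact ⟨0, fun x hxU => by rw [zero_smul, complexJ_Rdual hN hξ ((hsp x hxU).1 ⟨.Rdual, a⟩)]⟩
    · exact ⟨Complex.I, fun x hxU => complexJ_T10 hN hξ ((hsp x hxU).1 ⟨.T10, a⟩)⟩
    · exact ⟨-Complex.I, fun x hxU => complexJ_T01 hN hξ ((hsp x hxU).1 ⟨.T01, a⟩)⟩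
  obtain ⟨c, hc⟩ := this
  refine L.fun_congr (L.fun_mul (L.fun_const U (-c)) hp) fun x hxU => ?_
  change (complexCalculus g).metric x (complexJ g N ξ' x (Z x)) (s p x) =
    -c * (complexCalculus g).metric x (Z x) (s p x)
  rw [complexJ_skew hN hξ, hc x hxU, map_smul, smul_eq_mul, neg_mul]

theorem fieldJ_smooth {X : Π x : M, TangentSpace 𝓘(ℝ, E) x} (hX : (realCalculus g).Smooth X) :
    (realCalculus g).Smooth (fieldJ g N ξ' X) :=
  (complexJ_smooth hN hξ (complexify_smooth g hX)).1

theorem realScreenData : (realCalculus g).IsScreenData ξ ξ' (screenJ g N ξ') where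
  smooth := hξ.smooth
  smooth' := hξ.smooth'
  null := null hN hξ
  null' := hξ.null'
  dual := hξ.dual
  smooth_J := fun _ hX => fieldJ_smooth hN hξ hX
  J_left := screenJ_left hN hξ
  J_right := screenJ_right hN hξ
  skew := fun _ => screenJ_skew hN hξ
  sq := fun _ => screenJ_sq hN hξ

theorem complexScreenData :
    (complexCalculus g).IsScreenData (complexify ξ) (complexify ξ') (complexJ g N ξ') where
  smooth := complexify_smooth g hξ.smooth
  smooth' := complexify_smooth g hξ.smooth'
  null := fun x => by rw [complexify, complexMetric_ofReal, null hN hξ, Complex.ofReal_zero]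
  null' := fun x => by rw [complexify, complexMetric_ofReal, hξ.null', Complex.ofReal_zero]
  dual := fun x => by
    rw [complexify, complexify, complexMetric_ofReal, hξ.dual, Complex.ofReal_one]
  smooth_J := fun _ hX => complexJ_smooth hN hξ hX
  J_left := fun _ => complexJ_R hN hξ ((mem_nullLineC hN hξ).mpr ⟨1, one_smul _ _⟩)
  J_right := fun _ => complexJ_Rdual hN hξ (mem_dualLineC.mpr ⟨1, one_smul _ _⟩)
  skew := fun _ => complexJ_skew hN hξ
  sq := fun _ => complexJ_sq hN hξ

theorem isScreenHermitian : IsScreenHermitian g N ξ ξ' where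
  smooth := fun _ hX => fieldJ_smooth hN hξ hX
  eigen10 := fun x z => by rw [baseChange_screenJ hN hξ]; exact complexJ_eq_iff_T10 hN hξ
  eigen01 := fun x z => by rw [baseChange_screenJ hN hξ]; exact complexJ_eq_iff_T01 hN hξ
  map_R := screenJ_left hN hξ
  map_Rdual := screenJ_right hN hξ
  map_S := fun x v _ => by
    rw [mem_screen hN hξ, screenJ_skew hN hξ, screenJ_skew hN hξ, screenJ_left hN hξ,
      screenJ_right hN hξ]
    simp
  sq := fun x v hv => by
    have h := (mem_screen hN hξ).mp hv
    rw [screenJ_sq hN hξ, h.1, h.2]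
    simp
  isometry := fun x v _ w hw => by
    have h := (mem_screen hN hξ).mp hw
    rw [screenJ_skew hN hξ, screenJ_sq hN hξ, h.1, h.2]
    simp
  positive := fun x v hv h0 => screen_positive hN hξ hv h0

theorem isWittStructure_real :
    IsWittStructure (realCalculus g) RealIndex.star (realWitt g N ξ') (RealIndex.rank m) where
  star_star := RealIndex.star_star
  subbundle := realWitt_isSubbundle hN hξ
  rank_star := fun i => by cases i <;> rfl
  direct := realWitt_isInternal hN hξ
  orthogonal := fun i j _ h x v hv w hw => realWitt_orthogonal hN hξ h hv hw
  isotropic := fun i h x v hv w hw => realWitt_orthogonal hN hξ h.symm hv hw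
  nondegenerate := fun i _ x v hv h => by
    refine g.nondegenerate x v fun w => ?_
    rw [← sum_component (realWitt_isInternal hN hξ x) w, map_sum]
    refine Finset.sum_eq_zero fun j _ => ?_
    by_cases hj : j = i.star
    · exact hj ▸ h _ (component_mem _ _ _)
    · exact realWitt_orthogonal hN hξ hj hv (component_mem _ _ _)
  anisotropic := fun i hi x v hv h => by
    cases i
    · simp [RealIndex.star] at hi
    · simp [RealIndex.star] at hi
    · by_contra h0
      exact absurd h (screen_positive hN hξ hv h0).ne'

/-- A vector of V_i is orthogonal to every summand except V_{i*}, so nondegeneracy of the whole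
metric passes to this pairing. -/
theorem complexWitt_nondegenerate {i : ComplexIndex} {x : M} {v : CTangent E x}
    (hv : v ∈ complexWitt g N ξ' i x)
    (h : ∀ w ∈ complexWitt g N ξ' i.star x, (complexCalculus g).metric x v w = 0) : v = 0 := by
  refine (complexCalculus_isLawful g).nondeg x v fun w => ?_
  rw [← sum_component (complexWitt_isInternal hN hξ x) w, map_sum]
  refine Finset.sum_eq_zero fun j _ => ?_
  by_cases hj : j = i.star
  · exact hj ▸ h _ (component_mem _ _ _)
  · exact complexWitt_orthogonal hN hξ hj hv (component_mem _ _ _)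

theorem isWittStructure_complex :
    IsWittStructure (complexCalculus g) ComplexIndex.star (complexWitt g N ξ')
      (ComplexIndex.rank m) where
  star_star := ComplexIndex.star_star
  subbundle := complexWitt_isSubbundle hN hξ
  rank_star := fun i => by cases i <;> rfl
  direct := complexWitt_isInternal hN hξ
  orthogonal := fun i j _ h x v hv w hw => complexWitt_orthogonal hN hξ h hv hw
  isotropic := fun i h x v hv w hw => complexWitt_orthogonal hN hξ h.symm hv hw
  nondegenerate := fun i _ x v hv h => complexWitt_nondegenerate hN hξ hv h
  anisotropic := fun i hi => absurd hi i.star_ne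

end Hermitian


/-! ### Tensoriality of the forms entering τ. -/

section Forms

variable {𝕜 : Type*} [Field 𝕜] {M : Type*} [TopologicalSpace M] {W : M → Type*}
  [∀ x, AddCommGroup (W x)] [∀ x, Module 𝕜 (W x)] {C : Calculus 𝕜 M W}
  {F : Set M → (M → 𝕜) → Prop}

namespace Calculus

theorem IsForm.add' (L : C.IsLawful F) {α β : (Π x, W x) → M → 𝕜} (hα : C.IsForm F α)
    (hβ : C.IsForm F β) : C.IsForm F (α + β) where
  smooth hZ := L.fun_add (hα.smooth hZ) (hβ.smooth hZ)
  add hY hZ := by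
    simp only [Pi.add_apply, hα.add hY hZ, hβ.add hY hZ]
    ring
  smul hf hZ := by
    simp only [Pi.add_apply, hα.smul hf hZ, hβ.smul hf hZ]
    ring

namespace IsLawful

variable (L : C.IsLawful F)
include L

theorem isForm_d₀ {f : M → 𝕜} (hf : F Set.univ f) : C.IsForm F (C.d₀ f) where
  smooth hZ := L.der_smooth hZ hf
  add _ _ := L.der_add_left _ _ f
  smul {h Z} _ _ := L.der_smul_left h Z f

/-- In the last argument, the derivative of f coming from the product rule cancels the one coming
from [X, fZ]. -/
theorem isForm_lie₁_flat {X Y : Π x, W x} (hX : C.Smooth X) (hY : C.Smooth Y) :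
    C.IsForm F (C.lie₁ X (C.flat Y)) where
  smooth hZ := L.fun_sub (L.der_smooth hX (L.pair_smooth hY hZ))
    (L.pair_smooth hY (L.bracket_smooth hX hZ))
  add {Z Z'} hZ hZ' := by
    change C.der X (C.pair Y (Z + Z')) - C.pair Y (C.bracket X (Z + Z')) = _
    rw [pair_add_right, L.der_add _ (L.pair_smooth hY hZ) (L.pair_smooth hY hZ'),
      L.bracket_add_right hX hZ hZ', pair_add_right]
    simp only [lie₁, flat]
    ring
  smul {f Z} hf hZ := by
    change C.der X (C.pair Y fun x => f x • Z x) - C.pair Y (C.bracket X fun x => f x • Z x) = _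
    rw [pair_smul_right, L.der_mul _ hf (L.pair_smooth hY hZ),
      L.pair_comm Y (C.bracket X fun x => f x • Z x),
      L.pair_bracket_smul_right hX hZ hf]
    simp only [lie₁, flat, L.pair_comm Y (C.bracket X Z), L.pair_comm Y Z]
    ring

end IsLawful
end Calculus

end Forms

/-! ### The cases of τ. -/

section Tau

variable {𝕜 : Type*} [Field 𝕜] {M : Type*} [TopologicalSpace M] {W : M → Type*}
  [∀ x, AddCommGroup (W x)] [∀ x, Module 𝕜 (W x)] {C : Calculus 𝕜 M W} {ι : Type*} [DecidableEq ι]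
  {star : ι → ι} {V : ι → Π x, Submodule 𝕜 (W x)} {i j : ι} {X Y : Π x, W x}

theorem tau_self (k : ι) (x : M) : tau C star V k i i X Y x = 0 := by rw [tau, if_pos (Or.inl rfl)]

theorem tau_of_dual (hij : i ≠ j) (hs : i = star j) (x : M) : tau C star V j i j X Y x =
    (2⁻¹ : 𝕜) •
      (component V j x (C.sharp (C.lie₁ X (C.flat Y) + C.lie₁ Y (C.flat X)) x)
        - component V j x (C.bracket X Y x)
        - component V j x (C.sharp (C.d₀ (C.pair X Y)) x)) := by
  rw [tau, if_neg (by simp [hij]), if_pos hs]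

theorem tau_of_not_dual (hij : i ≠ j) (hs : i ≠ star j) (x : M) : tau C star V j i j X Y x =
    (2⁻¹ : 𝕜) •
      (component V j x (C.sharp (C.lie₁ X (C.flat Y)) x) - component V j x (C.bracket X Y x)) := by
  rw [tau, if_neg (by simp [hij]), if_neg hs]

end Tau

instance : NeZero (4 : ℂ) := ⟨by norm_num⟩

theorem ComplexIndex.sum_filter_self {A : Type*} [AddCommGroup A] (f : ComplexIndex → A)
    (i : ComplexIndex) :
    ∑ k ∈ Finset.univ.filter (fun k => k ≠ i ∧ k ≠ i), f k = ∑ k, f k - f i := by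
  rw [Finset.sum_filter, sum_univ, sum_univ]
  cases i <;> simp <;> abel

theorem ComplexIndex.sum_filter_ne {A : Type*} [AddCommGroup A] (f : ComplexIndex → A)
    {i j : ComplexIndex} (hij : i ≠ j) :
    ∑ k ∈ Finset.univ.filter (fun k => k ≠ i ∧ k ≠ j), f k = ∑ k, f k - f i - f j := by
  rw [Finset.sum_filter, sum_univ, sum_univ]
  cases i <;> cases j <;> simp at hij ⊢ <;> abel

/-! ### Existence and uniqueness of the canonical complex Witt connection. -/

section ComplexConnection

open Calculus

variable {E : Type*} [NormedAddCommGroup E] [NormedSpace ℝ E] [FiniteDimensional ℝ E]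
  [CompleteSpace E]
  {M : Type*} [TopologicalSpace M] [ChartedSpace E M] [IsManifold 𝓘(ℝ, E) ∞ M] [T2Space M]
  {m : ℕ} {g : PseudoMetric E M} {N : Π x : M, Submodule ℂ (CTangent E x)}
  {ξ ξ' : Π x : M, TangentSpace 𝓘(ℝ, E) x} (hN : IsAlmostRobinson m g N)
  (hξ : IsNullFrame g N ξ ξ')

include hN hξ

/-- Both sides equal g(v_k, w_{k*}), because V_k pairs only with V_{k*}. -/
theorem component_adjoint (k : ComplexIndex) {x : M} (v w : CTangent E x) :
    (complexCalculus g).metric x (component (complexWitt g N ξ') k x v) w =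
      (complexCalculus g).metric x v (component (complexWitt g N ξ') k.star x w) := by
  have h := complexWitt_isInternal hN hξ x
  trans (complexCalculus g).metric x (component (complexWitt g N ξ') k x v)
    (component (complexWitt g N ξ') k.star x w)
  · nth_rewrite 1 [← sum_component h w]
    rw [map_sum, Finset.sum_eq_single k.star]
    · exact fun j _ hj => complexWitt_orthogonal hN hξ hj (component_mem _ _ _) (component_mem _ _ _)
    · simp
  · nth_rewrite 2 [← sum_component h v]
    rw [map_sum, LinearMap.sum_apply, Finset.sum_eq_single k]
    · intro j _ hj
      refine complexWitt_orthogonal hN hξ (fun hjk => hj ?_) (component_mem _ _ _)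
        (component_mem _ _ _)
      rw [← k.star_star, hjk, j.star_star]
    · simp

theorem metric_component (k : ComplexIndex) {x : M} (v : CTangent E x) {w : CTangent E x}
    (hw : w ∈ complexWitt g N ξ' k.star x) :
    (complexCalculus g).metric x (component (complexWitt g N ξ') k x v) w =
      (complexCalculus g).metric x v w := by
  rw [component_adjoint hN hξ, component_of_mem (complexWitt_isInternal hN hξ x) hw]

/-- Paired with a member s of an adapted frame, the component gives g(Z,s) or 0, according to
whether s belongs to V_{k*}. -/
theorem component_isSection (k : ComplexIndex) {Z : Π x : M, CTangent E x}
    (hZ : (complexCalculus g).Smooth Z) :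
    (complexCalculus g).IsSection (complexWitt g N ξ' k)
      (endo (component (complexWitt g N ξ') k) Z) := by
  have L := complexCalculus_isLawful g
  refine ⟨L.sec_local fun x₀ => ?_, fun x => component_mem _ _ _⟩
  obtain ⟨U, hU, hx, s, hs, hsp⟩ := L.exists_adapted_frame (complexWitt_isSubbundle hN hξ)
    (complexWitt_isInternal hN hξ) x₀
  refine ⟨U, hU, hx, L.smoothOn_of_pair_frame hs (fun x hxU => (hsp x hxU).2) _ fun p => ?_⟩
  have hp := L.pair_smooth (L.sec_mono (Set.subset_univ U) hZ) (hs p)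
  refine L.fun_congr (L.fun_mul (L.fun_const U (if p.1 = k.star then 1 else 0)) hp) fun x hxU => ?_
  change (complexCalculus g).metric x (component _ k x (Z x)) (s p x) =
    (if p.1 = k.star then 1 else 0) * (complexCalculus g).metric x (Z x) (s p x)
  rw [component_adjoint hN hξ]
  have h := complexWitt_isInternal hN hξ x
  split_ifs with hk
  · rw [component_of_mem h (hk ▸ (hsp x hxU).1 p), one_mul]
  · rw [component_of_mem_ne h hk ((hsp x hxU).1 p), map_zero, zero_mul]

theorem exists_section_extension (k : ComplexIndex) {x : M} {w : CTangent E x}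
    (hw : w ∈ complexWitt g N ξ' k x) :
    ∃ Z, (complexCalculus g).IsSection (complexWitt g N ξ' k) Z ∧ Z x = w := by
  obtain ⟨Z, hZ, hZx⟩ := (complexCalculus_isLawful g).exists_extension w
  refine ⟨_, component_isSection hN hξ k hZ, ?_⟩
  change component _ k x (Z x) = w
  rw [hZx, component_of_mem (complexWitt_isInternal hN hξ x) hw]

/-- Vectors in a summand agree if their products with all sections of the dual summand do. -/
theorem complexWitt_ext {k : ComplexIndex} {x : M} {v w : CTangent E x}
    (hv : v ∈ complexWitt g N ξ' k x) (hw : w ∈ complexWitt g N ξ' k x)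
    (h : ∀ Z, (complexCalculus g).IsSection (complexWitt g N ξ' k.star) Z →
      (complexCalculus g).metric x v (Z x) = (complexCalculus g).metric x w (Z x)) : v = w := by
  refine sub_eq_zero.mp (complexWitt_nondegenerate hN hξ (Submodule.sub_mem _ hv hw) fun u hu => ?_)
  obtain ⟨Z, hZ, rfl⟩ := exists_section_extension hN hξ _ hu
  rw [map_sub, LinearMap.sub_apply, h Z hZ, sub_self]

theorem lineProj_of_mem_R {Y : Π x : M, CTangent E x} (hY : ∀ x, Y x ∈ complexWitt g N ξ' .R x) :
    endo ((complexCalculus g).lineProj (complexify ξ) (complexify ξ')) Y = Y := by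
  funext x
  obtain ⟨c, hc⟩ := (mem_nullLineC hN hξ).mp (hY x)
  have := (complexScreenData hN hξ).dual x
  simp only [complexify] at this
  simp [endo, Calculus.lineProj, ← hc, complexify, this]

omit hN in
theorem lineProj_of_mem_Rdual {Y : Π x : M, CTangent E x}
    (hY : ∀ x, Y x ∈ complexWitt g N ξ' .Rdual x) :
    endo ((complexCalculus g).lineProj (complexify ξ') (complexify ξ)) Y = Y := by
  funext x
  obtain ⟨c, hc⟩ := mem_dualLineC.mp (hY x)
  simp [endo, Calculus.lineProj, ← hc, complexify, complexMetric_ofReal, dual' hξ x]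

theorem complexJ_of_mem_T10 {Y : Π x : M, CTangent E x}
    (hY : ∀ x, Y x ∈ complexWitt g N ξ' .T10 x) :
    endo (complexJ g N ξ') Y = fun x => Complex.I • Y x :=
  funext fun x => complexJ_T10 hN hξ (hY x)

theorem complexJ_of_mem_T01 {Y : Π x : M, CTangent E x}
    (hY : ∀ x, Y x ∈ complexWitt g N ξ' .T01 x) :
    endo (complexJ g N ξ') Y = fun x => (-Complex.I) • Y x :=
  funext fun x => complexJ_T01 hN hξ (hY x)

/-- The canonical connection of the complex Witt structure. -/
def complexLich (g : PseudoMetric E M) (N : Π x : M, Submodule ℂ (CTangent E x))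
    (ξ ξ' : Π x : M, TangentSpace 𝓘(ℝ, E) x) :
    (Π x : M, CTangent E x) → (Π x : M, CTangent E x) → Π x : M, CTangent E x :=
  (complexCalculus g).lich (complexify ξ) (complexify ξ') (complexJ g N ξ')

/-- On the summands, the connection is given by the Koszul formula, up to a correction in case the
direction is in the other block. -/
theorem two_pair_complexLich {i j : ComplexIndex} {X Y Z : Π x : M, CTangent E x}
    (hX : (complexCalculus g).IsSection (complexWitt g N ξ' i) X)
    (hY : (complexCalculus g).IsSection (complexWitt g N ξ' j) Y)
    (hZ : (complexCalculus g).IsSection (complexWitt g N ξ' j.star) Z) :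
    2 * (complexCalculus g).pair (complexLich g N ξ ξ' X Y) Z =
      (complexCalculus g).koszul X Y Z +
        if i = j ∨ i = j.star then 0 else (complexCalculus g).pair ((complexCalculus g).bracket Y Z) X := by
  have L := complexCalculus_isLawful g
  have D := complexScreenData hN hξ
  have hplane : ∀ {X}, (∀ x, X x ∈ complexWitt g N ξ' .R x) ∨ (∀ x, X x ∈ complexWitt g N ξ' .Rdual x) →
      endo ((complexCalculus g).screenProj (complexify ξ) (complexify ξ')) X = 0 ∧
      endo ((complexCalculus g).planeProj (complexify ξ) (complexify ξ')) X = X := by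
    intro X hX
    have hs : endo ((complexCalculus g).screenProj (complexify ξ) (complexify ξ')) X = 0 := by
      rcases hX with h | h
      · rw [← lineProj_of_mem_R hN hξ h, D.screen_line L]
      · rw [← lineProj_of_mem_Rdual hξ h, D.screen_line' L]
    refine ⟨hs, ?_⟩
    funext x
    have := congrFun hs x
    simp only [endo, Calculus.screenProj, Calculus.planeProj, LinearMap.sub_apply,
      LinearMap.add_apply, LinearMap.id_apply, Pi.zero_apply] at this ⊢
    rw [sub_sub, sub_eq_zero] at this
    exact this.symm
  have hscreen : ∀ {X}, (∀ x, X x ∈ complexWitt g N ξ' .T10 x) ∨ (∀ x, X x ∈ complexWitt g N ξ' .T01 x) →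
      endo ((complexCalculus g).screenProj (complexify ξ) (complexify ξ')) X = X ∧
      endo ((complexCalculus g).planeProj (complexify ξ) (complexify ξ')) X = 0 := by
    intro X hX
    have ho : (complexCalculus g).IsOrth (complexify ξ) (complexify ξ') X := by
      rcases hX with h | h
      · exact ⟨funext fun x => (tangent10_perp hN hξ (h x)).1,
          funext fun x => (tangent10_perp hN hξ (h x)).2⟩
      · exact ⟨funext fun x => (tangent01_perp hN hξ (h x)).1,
          funext fun x => (tangent01_perp hN hξ (h x)).2⟩
    exact ⟨ho.screen, ho.plane⟩
  -- On dual summands the formula collapses to one Koszul expression, corrected by the part of X in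
  -- the block without V_j. Since X itself lies in one block, that part is X or 0.
  have e1 : 2 * (complexCalculus g).pair (complexLich g N ξ ξ' X Y) Z =
      (complexCalculus g).koszul X Y Z + (complexCalculus g).pair ((complexCalculus g).bracket Y Z)
        (if j = .R ∨ j = .Rdual then
            endo ((complexCalculus g).screenProj (complexify ξ) (complexify ξ')) X
          else endo ((complexCalculus g).planeProj (complexify ξ) (complexify ξ')) X) := by
    cases j
    · exact D.two_pair_lich_null L hX.1 hY.1 hZ.1 (lineProj_of_mem_R hN hξ hY.2)
        (lineProj_of_mem_Rdual hξ hZ.2)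
    · exact D.two_pair_lich_null' L hX.1 hY.1 hZ.1 (lineProj_of_mem_Rdual hξ hY.2)
        (lineProj_of_mem_R hN hξ hZ.2)
    · exact D.two_pair_lich_eigen L Complex.I_mul_I hX.1 hY.1 hZ.1 (complexJ_of_mem_T10 hN hξ hY.2)
        (complexJ_of_mem_T01 hN hξ hZ.2)
    · refine D.two_pair_lich_eigen L (i := -Complex.I) (by simp) hX.1 hY.1 hZ.1
        (complexJ_of_mem_T01 hN hξ hY.2) ?_
      rw [neg_neg]
      exact complexJ_of_mem_T10 hN hξ hZ.2
  rw [e1]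
  have hX' : endo ((complexCalculus g).screenProj (complexify ξ) (complexify ξ')) X =
      (if i = .R ∨ i = .Rdual then 0 else X) ∧
      endo ((complexCalculus g).planeProj (complexify ξ) (complexify ξ')) X =
      (if i = .R ∨ i = .Rdual then X else 0) := by
    have h := hX.2
    cases i
    · exact hplane (Or.inl h)
    · exact hplane (Or.inr h)
    · exact hscreen (Or.inl h)
    · exact hscreen (Or.inr h)
  rw [hX'.1, hX'.2]
  cases i <;> cases j <;> simp [ComplexIndex.star, pair_zero_right]

theorem complexLich_isConnection : IsComplexConnection g (complexLich g N ξ ξ') := by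
  have L := complexCalculus_isLawful g
  have D := complexScreenData hN hξ
  exact
  { smooth := fun X Y hX hY => D.lich_smooth L hX hY
    add_left := fun X X' Y hX hX' hY => D.lich_add_left L hX hX' hY
    add_right := fun X Y Y' hX hY hY' => D.lich_add_right L hX hY hY'
    smul_left := fun f X Y hf hX hY => D.lich_smul_left L (contMDiffOn_univ.mpr hf) hX hY
    leibniz := fun f X Y hf hX hY => D.lich_leibniz L (contMDiffOn_univ.mpr hf) hX hY }

/-- The two lines are ranges of projections, and T^{1,0}, T^{0,1} are eigenbundles of J; all these
endomorphisms commute with the connection. -/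
theorem complexLich_isWittOperator :
    IsWittOperator (complexCalculus g) (complexWitt g N ξ') (complexLich g N ξ ξ') := by
  have L := complexCalculus_isLawful g
  have D := complexScreenData hN hξ
  have hsmul : ∀ (c : ℂ) {X Y}, (complexCalculus g).Smooth X → (complexCalculus g).Smooth Y →
      complexLich g N ξ ξ' X (fun x => c • Y x) = fun x => c • complexLich g N ξ ξ' X Y x := by
    intro c X Y hX hY
    have := D.lich_leibniz L (f := fun _ => c) (L.fun_const _ c) hX hY
    rw [L.der_const] at this
    simpa [complexLich] using this
  refine ⟨fun X Y Z hX hY hZ => D.lich_metric L hX hY hZ, fun i X Y hX hY => ?_⟩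
  refine ⟨D.lich_smooth L hX hY.1, fun x => ?_⟩
  cases i
  · have h := congrFun (D.lich_line L hX hY.1) x
    rw [lineProj_of_mem_R hN hξ hY.2] at h
    exact (mem_nullLineC hN hξ).mpr ⟨_, h.symm⟩
  · have h := congrFun (D.lich_line' L hX hY.1) x
    rw [lineProj_of_mem_Rdual hξ hY.2] at h
    exact mem_dualLineC.mpr ⟨_, h.symm⟩
  · have h := D.lich_J L hX hY.1
    rw [complexJ_of_mem_T10 hN hξ hY.2] at h
    exact (complexJ_eq_iff_T10 hN hξ).mpr
      ((congrFun h x).symm.trans (congrFun (hsmul Complex.I hX hY.1) x))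
  · have h := D.lich_J L hX hY.1
    rw [complexJ_of_mem_T01 hN hξ hY.2] at h
    exact (complexJ_eq_iff_T01 hN hξ).mpr
      ((congrFun h x).symm.trans (congrFun (hsmul (-Complex.I) hX hY.1) x))

/-- The mixed terms of the canonical connection. -/
theorem complexLich_of_ne {i j : ComplexIndex} (hij : i ≠ j) {X Y : Π x : M, CTangent E x}
    (hX : (complexCalculus g).IsSection (complexWitt g N ξ' i) X)
    (hY : (complexCalculus g).IsSection (complexWitt g N ξ' j) Y) (x : M) :
    complexLich g N ξ ξ' X Y x =
      component (complexWitt g N ξ') j x ((complexCalculus g).bracket X Y x) +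
        tau (complexCalculus g) ComplexIndex.star (complexWitt g N ξ') j i j X Y x := by
  have L := complexCalculus_isLawful g
  have f1 := L.sharp_spec (L.isForm_lie₁_flat hX.1 hY.1)
  have f2 := L.sharp_spec ((L.isForm_lie₁_flat hX.1 hY.1).add' L (L.isForm_lie₁_flat hY.1 hX.1))
  have f3 := L.sharp_spec (L.isForm_d₀ (L.pair_smooth hX.1 hY.1))
  have c := fun {Z : Π x : M, CTangent E x}
    (hZ : (complexCalculus g).IsSection (complexWitt g N ξ' j.star) Z) v =>
      metric_component hN hξ j v (hZ.2 x)
  have hL := ((complexLich_isWittOperator hN hξ).preserves j X Y hX.1 hY).2 x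
  by_cases hs : i = j.star
  · rw [tau_of_dual hij hs]
    refine complexWitt_ext hN hξ hL (Submodule.add_mem _ (component_mem _ _ _)
      (Submodule.smul_mem _ _ (Submodule.sub_mem _ (Submodule.sub_mem _ (component_mem _ _ _)
        (component_mem _ _ _)) (component_mem _ _ _)))) fun Z hZ => ?_
    -- Dual summands: K(X,Y,Z) = (L_X Y♭ + L_Y X♭)(Z) - Z g(X,Y) + g([X,Y],Z), which is the pairing
    -- of Z with 2[X,Y]_j + 2τ_j(X,Y).
    have hk := congrFun (two_pair_complexLich hN hξ hX hY hZ) x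
    rw [if_pos (Or.inr hs)] at hk
    have g2 := congrFun (f2.2 Z hZ.1) x
    have g3 := congrFun (f3.2 Z hZ.1) x
    simp only [map_add, map_smul, map_sub, LinearMap.add_apply, LinearMap.smul_apply,
      LinearMap.sub_apply, c hZ, smul_eq_mul]
    simp only [Pi.add_apply, Pi.sub_apply, Pi.mul_apply, Pi.ofNat_apply, lie₁, flat,
      d₀, koszul, L.pair_comm Y (Calculus.bracket _ X Z),
      L.pair_comm X (Calculus.bracket _ Y Z)] at hk g2 g3
    simp only [pair] at hk g2 g3
    linear_combination (hk - g2 + g3) / 2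
  · rw [tau_of_not_dual hij hs]
    refine complexWitt_ext hN hξ hL (Submodule.add_mem _ (component_mem _ _ _)
      (Submodule.smul_mem _ _ (Submodule.sub_mem _ (component_mem _ _ _)
        (component_mem _ _ _)))) fun Z hZ => ?_
    have hk := congrFun (two_pair_complexLich hN hξ hX hY hZ) x
    have hne : ¬ (i = j ∨ i = j.star) := by tauto
    -- Otherwise X is orthogonal to Y and Z, and K(X,Y,Z) + g([Y,Z],X) = (L_X Y♭)(Z) + g([X,Y],Z).
    -- The bracket correction is needed exactly here.
    have o1 : (complexCalculus g).pair X Y = 0 := funext fun y =>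
      complexWitt_orthogonal hN hξ (fun h => hs (by rw [h, i.star_star])) (hX.2 y) (hY.2 y)
    have o2 : (complexCalculus g).pair X Z = 0 := funext fun y =>
      complexWitt_orthogonal hN hξ
        (fun h => hij (by rw [← i.star_star, ← h, j.star_star])) (hX.2 y) (hZ.2 y)
    rw [if_neg hne] at hk
    have g1 := congrFun (f1.2 Z hZ.1) x
    simp only [map_add, map_smul, map_sub, LinearMap.add_apply, LinearMap.smul_apply,
      LinearMap.sub_apply, c hZ, smul_eq_mul]
    simp only [koszul, o1, o2, L.der_zero] at hk
    simp only [Pi.add_apply, Pi.sub_apply, Pi.mul_apply, Pi.ofNat_apply, lie₁, flat,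
      L.pair_comm Y (Calculus.bracket _ X Z)] at hk g1
    simp only [pair] at hk g1
    linear_combination (hk - g1) / 2

/-- The diagonal terms of the canonical connection are torsion free inside the summand. -/
theorem complexLich_sub_swap {i : ComplexIndex} {X Y : Π x : M, CTangent E x}
    (hX : (complexCalculus g).IsSection (complexWitt g N ξ' i) X)
    (hY : (complexCalculus g).IsSection (complexWitt g N ξ' i) Y) (x : M) :
    complexLich g N ξ ξ' X Y x - complexLich g N ξ ξ' Y X x =
      component (complexWitt g N ξ') i x ((complexCalculus g).bracket X Y x) := by
  have L := complexCalculus_isLawful g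
  have W := complexLich_isWittOperator hN hξ
  refine complexWitt_ext hN hξ (Submodule.sub_mem _ ((W.preserves i X Y hX.1 hY).2 x)
    ((W.preserves i Y X hY.1 hX).2 x)) (component_mem _ _ _) fun Z hZ => ?_
  have h1 := congrFun (two_pair_complexLich hN hξ hX hY hZ) x
  have h2 := congrFun (two_pair_complexLich hN hξ hY hX hZ) x
  rw [if_pos (Or.inl rfl)] at h1 h2
  rw [metric_component hN hξ i _ (hZ.2 x), map_sub, LinearMap.sub_apply]
  simp only [koszul, L.bracket_comm Y X, L.pair_comm Y X, pair_neg_left] at h1 h2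
  simp only [Pi.add_apply, Pi.sub_apply, Pi.mul_apply, Pi.ofNat_apply,
    Pi.neg_apply] at h1 h2
  simp only [pair] at h1 h2
  linear_combination (h1 - h2) / 2

theorem complexLich_hasCanonicalTorsion : HasCanonicalTorsion (complexCalculus g)
    ComplexIndex.star (complexWitt g N ξ') (complexLich g N ξ ξ') := by
  intro i j X Y hX hY x
  have L := complexCalculus_isLawful g
  have hsum := sum_component (complexWitt_isInternal hN hξ x) ((complexCalculus g).bracket X Y x)
  have hT : (complexCalculus g).torsion (complexLich g N ξ ξ') X Y x =
    complexLich g N ξ ξ' X Y x - complexLich g N ξ ξ' Y X x - (complexCalculus g).bracket X Y x := rfl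
  by_cases hij : i = j
  · subst hij
    rw [hT, complexLich_sub_swap hN hξ hX hY, tau_self, tau_self, ComplexIndex.sum_filter_self, hsum]
    abel
  · rw [hT, complexLich_of_ne hN hξ hij hX hY, complexLich_of_ne hN hξ (Ne.symm hij) hY hX,
      L.bracket_comm Y X, Pi.neg_apply, map_neg, ComplexIndex.sum_filter_ne _ hij, hsum]
    abel

theorem complexLich_isCanonical : IsCanonicalComplexWitt g N ξ' (complexLich g N ξ ξ') :=
  ⟨complexLich_isConnection hN hξ, complexLich_isWittOperator hN hξ,
    complexLich_hasCanonicalTorsion hN hξ⟩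

/-- Equal torsions make the difference A of the connections symmetric. For i ≠ j the vector A_X Y =
A_Y X lies in V_i ∩ V_j = 0. For i = j, metricity against sections of V_{i*}, a different summand,
reduces to the mixed case. Additivity extends this to all fields. -/
theorem IsCanonicalComplexWitt.unique
    {nab nab' : (Π x : M, CTangent E x) → (Π x : M, CTangent E x) → Π x : M, CTangent E x}
    (h : IsCanonicalComplexWitt g N ξ' nab) (h' : IsCanonicalComplexWitt g N ξ' nab')
    {X Y : Π x : M, CTangent E x} (hX : (complexCalculus g).Smooth X)
    (hY : (complexCalculus g).Smooth Y) : nab X Y = nab' X Y := by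
  have L := complexCalculus_isLawful g
  have hswap : ∀ {i j X Y}, (complexCalculus g).IsSection (complexWitt g N ξ' i) X →
      (complexCalculus g).IsSection (complexWitt g N ξ' j) Y → ∀ x,
      nab X Y x - nab' X Y x = nab Y X x - nab' Y X x := by
    intro i j X Y hX hY x
    have := (h.torsion i j X Y hX hY x).trans (h'.torsion i j X Y hX hY x).symm
    change nab X Y x - nab Y X x - _ = nab' X Y x - nab' Y X x - _ at this
    have := sub_left_injective this
    rw [sub_eq_sub_iff_add_eq_add] at this ⊢
    rw [this]
    abel
  have hmem : ∀ {j X Y}, (complexCalculus g).Smooth X →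
      (complexCalculus g).IsSection (complexWitt g N ξ' j) Y → ∀ x,
      nab X Y x - nab' X Y x ∈ complexWitt g N ξ' j x := fun hX hY x =>
    Submodule.sub_mem _ ((h.witt.preserves _ _ _ hX hY).2 x) ((h'.witt.preserves _ _ _ hX hY).2 x)
  have hne : ∀ {i j X Y}, i ≠ j → (complexCalculus g).IsSection (complexWitt g N ξ' i) X →
      (complexCalculus g).IsSection (complexWitt g N ξ' j) Y → nab X Y = nab' X Y := by
    intro i j X Y hij hX hY
    funext x
    have h1 := hmem hX.1 hY x
    have h2 := hmem hY.1 hX x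
    rw [← hswap hX hY] at h2
    have hi := complexWitt_isInternal hN hξ x
    rw [← sub_eq_zero, ← component_of_mem hi h1, component_of_mem_ne hi hij h2]
  have hall : ∀ {i j X Y}, (complexCalculus g).IsSection (complexWitt g N ξ' i) X →
      (complexCalculus g).IsSection (complexWitt g N ξ' j) Y → nab X Y = nab' X Y := by
    intro i j X Y hX hY
    by_cases hij : i = j
    · subst hij
      funext x
      refine complexWitt_ext hN hξ ((h.witt.preserves _ _ _ hX.1 hY).2 x)
        ((h'.witt.preserves _ _ _ hX.1 hY).2 x) fun Z hZ => ?_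
      have e := hne (i := i) (j := i.star) (Ne.symm i.star_ne) hX hZ
      have h1 := congrFun (h.witt.metric X Y Z hX.1 hY.1 hZ.1) x
      have h2 := congrFun (h'.witt.metric X Y Z hX.1 hY.1 hZ.1) x
      rw [h1, e] at h2
      exact add_right_cancel h2
    · exact hne hij hX hY
  have hdec : ∀ {Z}, (complexCalculus g).Smooth Z → ∃ A B C D : Π x : M, CTangent E x,
      Z = A + B + C + D ∧ (complexCalculus g).IsSection (complexWitt g N ξ' .R) A ∧
      (complexCalculus g).IsSection (complexWitt g N ξ' .Rdual) B ∧
      (complexCalculus g).IsSection (complexWitt g N ξ' .T10) C ∧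
      (complexCalculus g).IsSection (complexWitt g N ξ' .T01) D := by
    intro Z hZ
    refine ⟨_, _, _, _, ?_, component_isSection hN hξ _ hZ, component_isSection hN hξ _ hZ,
      component_isSection hN hξ _ hZ, component_isSection hN hξ _ hZ⟩
    funext x
    exact ((ComplexIndex.sum_univ _).symm.trans
      (sum_component (complexWitt_isInternal hN hξ x) (Z x))).symm
  obtain ⟨A, B, C, D, rfl, hA, hB, hC, hD⟩ := hdec hX
  have key : ∀ {j Y}, (complexCalculus g).IsSection (complexWitt g N ξ' j) Y →
      nab (A + B + C + D) Y = nab' (A + B + C + D) Y := by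
    intro j Y hY
    have s1 := L.smooth_add hA.1 hB.1
    have s2 := L.smooth_add s1 hC.1
    rw [h.connection.add_left _ _ _ s2 hD.1 hY.1, h.connection.add_left _ _ _ s1 hC.1 hY.1,
      h.connection.add_left _ _ _ hA.1 hB.1 hY.1, h'.connection.add_left _ _ _ s2 hD.1 hY.1,
      h'.connection.add_left _ _ _ s1 hC.1 hY.1, h'.connection.add_left _ _ _ hA.1 hB.1 hY.1,
      hall hA hY, hall hB hY, hall hC hY, hall hD hY]
  obtain ⟨A', B', C', D', rfl, hA', hB', hC', hD'⟩ := hdec hY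
  have s1 := L.smooth_add hA'.1 hB'.1
  have s2 := L.smooth_add s1 hC'.1
  rw [h.connection.add_right _ _ _ hX s2 hD'.1, h.connection.add_right _ _ _ hX s1 hC'.1,
    h.connection.add_right _ _ _ hX hA'.1 hB'.1, h'.connection.add_right _ _ _ hX s2 hD'.1,
    h'.connection.add_right _ _ _ hX s1 hC'.1, h'.connection.add_right _ _ _ hX hA'.1 hB'.1,
    key hA', key hB', key hC', key hD']

end ComplexConnection


/-! ### From operators on smooth fields to covariant derivatives. -/

section RealConnection

open Calculus

variable {E : Type*} [NormedAddCommGroup E] [NormedSpace ℝ E] [FiniteDimensional ℝ E]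
  [CompleteSpace E]
  {M : Type*} [TopologicalSpace M] [ChartedSpace E M] [IsManifold 𝓘(ℝ, E) ∞ M] [T2Space M]
  {g : PseudoMetric E M}

theorem mvfderiv_congr {f h : M → ℝ} {x : M} (H : f =ᶠ[nhds x] h) :
    mvfderiv 𝓘(ℝ, E) f x = mvfderiv 𝓘(ℝ, E) h x := by
  ext v
  exact DFunLike.congr_fun H.mfderiv_eq v

/-- A connection on the tangent bundle, as an operation on smooth vector fields. -/
structure IsRealConnection (g : PseudoMetric E M)
    (nab : (Π x : M, TangentSpace 𝓘(ℝ, E) x) → (Π x : M, TangentSpace 𝓘(ℝ, E) x) →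
      Π x : M, TangentSpace 𝓘(ℝ, E) x) : Prop where
  smooth : ∀ {X Y}, (realCalculus g).Smooth X → (realCalculus g).Smooth Y →
    (realCalculus g).Smooth (nab X Y)
  add_left : ∀ {X X' Y}, (realCalculus g).Smooth X → (realCalculus g).Smooth X' →
    (realCalculus g).Smooth Y → nab (X + X') Y = nab X Y + nab X' Y
  add_right : ∀ {X Y Y'}, (realCalculus g).Smooth X → (realCalculus g).Smooth Y →
    (realCalculus g).Smooth Y' → nab X (Y + Y') = nab X Y + nab X Y'
  smul_left : ∀ {f X Y}, SmoothFunOn E ℝ Set.univ f → (realCalculus g).Smooth X →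
    (realCalculus g).Smooth Y → nab (fun x => f x • X x) Y = fun x => f x • nab X Y x
  leibniz : ∀ {f X Y}, SmoothFunOn E ℝ Set.univ f → (realCalculus g).Smooth X →
    (realCalculus g).Smooth Y → nab X (fun x => f x • Y x) =
      fun x => f x • nab X Y x + (realCalculus g).der X f x • Y x

namespace IsRealConnection

variable {nab : (Π x : M, TangentSpace 𝓘(ℝ, E) x) → (Π x : M, TangentSpace 𝓘(ℝ, E) x) →
  Π x : M, TangentSpace 𝓘(ℝ, E) x} (H : IsRealConnection g nab)
include H

/-- For a cutoff χ supported in V the fields χY and χY' coincide everywhere. Expanding both by the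
Leibniz rule at x, where χ = 1 and Y = Y', leaves the claim. -/
theorem congr_of_eqOn {X Y Y' : Π x : M, TangentSpace 𝓘(ℝ, E) x} (hX : (realCalculus g).Smooth X)
    (hY : (realCalculus g).Smooth Y) (hY' : (realCalculus g).Smooth Y') {V : Set M}
    (hV : IsOpen V) {x : M} (hx : x ∈ V) (h : ∀ y ∈ V, Y y = Y' y) : nab X Y x = nab X Y' x := by
  obtain ⟨χ, hχ, ⟨V', -, hxV', -, h1⟩, h0, -⟩ := (realCalculus_isLawful g).cutoff hV hx
  have e : (fun y => χ y • Y y) = fun y => χ y • Y' y := by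
    funext y
    by_cases hy : y ∈ V
    · rw [h y hy]
    · rw [h0 y hy, zero_smul, zero_smul]
  have e1 := congrFun (H.leibniz hχ hX hY) x
  have e2 := congrFun (H.leibniz hχ hX hY') x
  rw [e, e2, h x hx, h1 x hxV', one_smul, one_smul] at e1
  exact (add_right_cancel e1).symm

theorem zero_right {X : Π x : M, TangentSpace 𝓘(ℝ, E) x} (hX : (realCalculus g).Smooth X) :
    nab X 0 = 0 := by
  have h0 := (realCalculus_isLawful g).smooth_zero
  have := H.add_right hX h0 h0
  rw [add_zero] at this
  exact left_eq_add.mp this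

theorem sum_smul {κ : Type*} (s : Finset κ) {X : Π x : M, TangentSpace 𝓘(ℝ, E) x}
    {f : κ → M → ℝ} {Y : κ → Π x : M, TangentSpace 𝓘(ℝ, E) x} (hX : (realCalculus g).Smooth X)
    (hf : ∀ a, SmoothFunOn E ℝ Set.univ (f a)) (hY : ∀ a, (realCalculus g).Smooth (Y a)) :
    nab X (fun x => ∑ a ∈ s, f a x • Y a x) = fun x =>
      ∑ a ∈ s, (f a x • nab X (Y a) x + (realCalculus g).der X (f a) x • Y a x) := by
  classical
  have L := realCalculus_isLawful g
  induction s using Finset.induction_on with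
  | empty =>
    simp only [Finset.sum_empty]
    exact H.zero_right hX
  | insert a s ha ih =>
    simp only [Finset.sum_insert ha]
    have := H.add_right hX (L.smooth_smul (hf a) (hY a))
      (L.sec_sum s fun a => L.smooth_smul (hf a) (hY a))
    rw [ih, H.leibniz (hf a) hX (hY a)] at this
    exact this

/-- Tensoriality in the direction gives a linear map on the tangent space, continuous by finite
dimension. -/
theorem exists_pointwise {Y : Π x : M, TangentSpace 𝓘(ℝ, E) x} (hY : (realCalculus g).Smooth Y)
    (x : M) : ∃ A : TangentSpace 𝓘(ℝ, E) x →L[ℝ] TangentSpace 𝓘(ℝ, E) x,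
      ∀ X, (realCalculus g).Smooth X → A (X x) = nab X Y x := by
  have L := realCalculus_isLawful g
  have hc : ∀ {X X' : Π x : M, TangentSpace 𝓘(ℝ, E) x}, (realCalculus g).Smooth X →
      (realCalculus g).Smooth X' → X x = X' x → nab X Y x = nab X' Y x := by
    intro X X' hX hX' h
    refine L.congr_of_tensorial (x₀ := x) (α := fun X => nab X Y x) (fun X X' hX hX' => ?_)
      (fun f X hf hX => ?_) hX hX' h
    · exact congrFun (H.add_left hX hX' hY) x
    · exact congrFun (H.smul_left hf hX hY) x
  choose e he hex using fun v : TangentSpace 𝓘(ℝ, E) x => L.exists_extension v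
  have : T2Space (TangentSpace 𝓘(ℝ, E) x) := inferInstanceAs (T2Space E)
  refine ⟨LinearMap.toContinuousLinearMap
    { toFun := fun v => nab (e v) Y x
      map_add' := fun v w => ?_
      map_smul' := fun c v => ?_ }, fun X hX => ?_⟩
  · rw [hc (he (v + w)) (L.smooth_add (he v) (he w)) (by simp [hex]), H.add_left (he v) (he w) hY]
    rfl
  · rw [hc (he (c • v)) (L.smooth_smul (L.fun_const _ c) (he v)) (by simp [hex]),
      H.smul_left (L.fun_const _ c) (he v) hY]
    rfl
  · exact hc (he _) hX (hex _)

/-- A connection on smooth vector fields extends to differentiable vector fields. -/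
theorem exists_covariantDerivative :
    ∃ cov : CovariantDerivative 𝓘(ℝ, E) E (fun x : M => TangentSpace 𝓘(ℝ, E) x),
      ∀ X Y, (realCalculus g).Smooth X → (realCalculus g).Smooth Y →
        covOperator cov X Y = nab X Y := by
  have L := realCalculus_isLawful g
  let b := Module.finBasis ℝ E
  let t := fun x : M => trivializationAt E (TangentSpace 𝓘(ℝ, E) : M → Type _) x
  have hxt : ∀ x, x ∈ (t x).baseSet := fun x => FiberBundle.mem_baseSet_trivializationAt' x
  have hfr := fun x => (t x).isLocalFrameOn_localFrame_baseSet 𝓘(ℝ, E) ∞ b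
  -- Around each point, global fields that coincide with a local frame on a smaller neighbourhood,
  -- so that the operator can be applied to them.
  choose e he V hV hxV hVt hVe using fun x => L.globalize (t x).open_baseSet (hxt x)
    (X := (t x).localFrame b) (hfr x).contMDiffOn
  choose A hA using fun x a => H.exists_pointwise (he x a) x
  let c := fun (x : M) a (Y : Π x : M, TangentSpace 𝓘(ℝ, E) x) (y : M) =>
    (t x).localFrameCoeff 𝓘(ℝ, E) b a y (Y y)
  have hc : ∀ x a {Y : Π x : M, TangentSpace 𝓘(ℝ, E) x},
      MDifferentiableAt 𝓘(ℝ, E) 𝓘(ℝ, E).tangent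
        (fun x => (⟨x, Y x⟩ : TangentBundle 𝓘(ℝ, E) M)) x →
      MDifferentiableAt 𝓘(ℝ, E) 𝓘(ℝ, ℝ) (c x a Y) x := fun x a Y hY =>
    mdifferentiableAt_localFrameCoeff b (hxt x) hY a
  have hsum : ∀ x Y, ∀ y ∈ V x, ∑ a, c x a Y y • e x a y = Y y := by
    intro x Y y hy
    rw [(t x).eq_sum_localFrameCoeff_smul (I := 𝓘(ℝ, E)) (b := b) (s := Y) (hVt x hy)]
    exact Finset.sum_congr rfl fun a _ => by rw [hVe x a y hy]
  -- At x the derivative is defined by Σ (c_a ∇e_a + dc_a ⊗ e_a) in the frame chosen at x itself.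
  -- This makes sense for every field, satisfies the axioms wherever the field is differentiable,
  -- and needs no comparison of frames at different points.
  refine ⟨⟨fun Y x => ∑ a, (c x a Y x • A x a + (mvfderiv 𝓘(ℝ, E) (c x a Y) x).smulRight (e x a x)),
    ⟨fun {Y Y' x} hY hY' _ => ?_, fun {Y f x} hY hf _ => ?_⟩⟩, fun X Y hX hY => ?_⟩
  · rw [← Finset.sum_add_distrib]
    refine Finset.sum_congr rfl fun a _ => ?_
    have e1 : c x a (Y + Y') = c x a Y + c x a Y' := by
      funext y; simp [c]
    rw [e1, mvfderiv_add (hc x a hY) (hc x a hY')]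
    ext v
    simp [add_smul]
    abel
  · have e0 := hsum x Y x (hxV x)
    have e1 : ∀ a, c x a (f • Y) = f * c x a Y := by
      intro a; funext y; simp [c]
    ext v
    simp only [e1, mvfderiv_mul hf (hc x _ hY), _root_.sum_apply,
      _root_.add_apply, _root_.smul_apply, Pi.mul_apply,
      ContinuousLinearMap.smulRight_apply, smul_eq_mul, Finset.smul_sum]
    conv_rhs => rw [← e0]
    simp only [Finset.smul_sum, ← Finset.sum_add_distrib]
    refine Finset.sum_congr rfl fun a _ => ?_
    module
  · funext x
    -- The coefficients of a smooth field are smooth only near x. After multiplication by χ they are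
    -- global, and locality of the operator permits the replacement.
    obtain ⟨χ, hχ, ⟨V', hV', hxV', hVV', h1⟩, -, hχf, -⟩ := L.cutoff (hV x) (hxV x)
    have hcs : ∀ a, SmoothFunOn E ℝ (V x) (c x a Y) := fun a =>
      contMDiffOn_localFrameCoeff b (hV x) (hVt x)
        ((contMDiffOn_univ.mp hY).contMDiffOn) a
    have hsm : ∀ a, SmoothFunOn E ℝ Set.univ (χ * c x a Y) := fun a => hχf _ (hcs a)
    have hY' := L.sec_sum Finset.univ fun a => L.smooth_smul (hsm a) (he x a)
    rw [H.congr_of_eqOn (Y' := fun y => ∑ a, (χ * c x a Y) y • e x a y) hX hY hY' hV' hxV'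
      fun y hy => ?_, H.sum_smul _ hX hsm (he x)]
    · simp only [covOperator, Pi.mul_apply, h1 x hxV', one_mul]
      change (∑ a, (c x a Y x • A x a + (mvfderiv 𝓘(ℝ, E) (c x a Y) x).smulRight (e x a x))) (X x)
        = _
      simp only [_root_.sum_apply, _root_.add_apply,
        _root_.smul_apply, ContinuousLinearMap.smulRight_apply, hA x _ X hX]
      refine Finset.sum_congr rfl fun a _ => ?_
      congr 2
      have : χ * c x a Y =ᶠ[nhds x] c x a Y := by
        filter_upwards [hV'.mem_nhds hxV'] with y hy
        simp [h1 y hy]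
      exact congrArg (fun A => A (X x)) (mvfderiv_congr this.symm)
    · rw [← hsum x Y y (hVV' hy)]
      simp [h1 y hy]

end IsRealConnection

/-- A linear map is the finite sum of the rank one maps built from the dual basis and its values on
the basis. -/
theorem contMDiffAt_clm_of_apply {κ : Type*} [Fintype κ] (b : Module.Basis κ ℝ E)
    {Φ : M → E →L[ℝ] E} {x : M}
    (h : ∀ a, ContMDiffAt 𝓘(ℝ, E) 𝓘(ℝ, E) ∞ (fun y => Φ y (b a)) x) :
    ContMDiffAt 𝓘(ℝ, E) 𝓘(ℝ, E →L[ℝ] E) ∞ Φ x := by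
  have e : Φ = fun y => ∑ a, ContinuousLinearMap.smulRightL ℝ E E
      (LinearMap.toContinuousLinearMap (b.coord a)) (Φ y (b a)) := by
    funext y
    refine ContinuousLinearMap.coe_injective (b.ext fun c => ?_)
    classical
    simp [Finsupp.single_apply]
  rw [e]
  exact contMDiffAt_finsetSum fun a _ =>
    (ContinuousLinearMap.contMDiff (ContinuousLinearMap.smulRightL ℝ E E
      (LinearMap.toContinuousLinearMap (b.coord a)))).contMDiffAt.comp x (h a)

/-- In a trivialization, smoothness is tested on constant basis vectors. These correspond to the
local frame, which near the point agrees with global smooth fields to which the hypothesis applies.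
-/
theorem contMDiffCovariantDerivative_of_smooth (g : PseudoMetric E M)
    {cov : CovariantDerivative 𝓘(ℝ, E) E (fun x : M => TangentSpace 𝓘(ℝ, E) x)}
    (h : ∀ X Y, (realCalculus g).Smooth X → (realCalculus g).Smooth Y →
      (realCalculus g).Smooth (covOperator cov X Y)) :
    CovariantDerivative.ContMDiffCovariantDerivative cov ∞ := by
  have L := realCalculus_isLawful g
  refine ⟨⟨fun {σ} hσ => ?_⟩⟩
  have hσ' : (realCalculus g).Smooth σ := hσ
  refine contMDiffOn_univ.mpr fun x₀ => (contMDiffAt_hom_bundle _).mpr ⟨contMDiffAt_id, ?_⟩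
  let b := Module.finBasis ℝ E
  let t := trivializationAt E (TangentSpace 𝓘(ℝ, E) : M → Type _) x₀
  have hxt : x₀ ∈ t.baseSet := FiberBundle.mem_baseSet_trivializationAt' x₀
  obtain ⟨e, he, V, hV, hxV, hVt, hVe⟩ := L.globalize t.open_baseSet hxt
    (X := t.localFrame b) (t.isLocalFrameOn_localFrame_baseSet 𝓘(ℝ, E) ∞ b).contMDiffOn
  refine contMDiffAt_clm_of_apply b fun a => ?_
  have h1 := (t.contMDiffAt_section_iff hxt).mp ((contMDiffOn_univ.mp (h _ _ (he a) hσ')) x₀)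
  refine h1.congr_of_eventuallyEq ?_
  filter_upwards [hV.mem_nhds hxV] with x hx
  have hxb := hVt hx
  have hl : t.localFrame b a x = t.symm x (b a) := by
    rw [t.localFrame_apply_of_mem_baseSet b hxb]
    simp [Bundle.Trivialization.basisAt]
  simp only [ContinuousLinearMap.inCoordinates_eq hxb hxb, covOperator, hVe a x hx, hl]
  simp [t]

end RealConnection


/-! ### The real connection: compatibility with complexification, Witt property. -/

section Complexification

open Calculus

variable {E : Type*} [NormedAddCommGroup E] [NormedSpace ℝ E] [FiniteDimensional ℝ E]
  [CompleteSpace E]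
  {M : Type*} [TopologicalSpace M] [ChartedSpace E M] [IsManifold 𝓘(ℝ, E) ∞ M] [T2Space M]

/-- A real function as a complex function. -/
def castFun (f : M → ℝ) : M → ℂ := fun x => f x

theorem castFun_add (f h : M → ℝ) : castFun (f + h) = castFun f + castFun h := by
  funext x; simp [castFun]

theorem castFun_sub (f h : M → ℝ) : castFun (f - h) = castFun f - castFun h := by
  funext x; simp [castFun]

theorem castFun_mul (f h : M → ℝ) : castFun (f * h) = castFun f * castFun h := by
  funext x; simp [castFun]

theorem castFun_ofNat (n : ℕ) [n.AtLeastTwo] :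
    castFun (OfNat.ofNat n : M → ℝ) = OfNat.ofNat n := by
  funext x; simp [castFun]

variable (g : PseudoMetric E M)

theorem pair_complexify (X Y : Π x : M, TangentSpace 𝓘(ℝ, E) x) :
    (complexCalculus g).pair (complexify X) (complexify Y) = castFun ((realCalculus g).pair X Y) := by
  funext x
  exact complexMetric_ofReal g x (X x) (Y x)

theorem bracket_complexify {X Y : Π x : M, TangentSpace 𝓘(ℝ, E) x}
    (hX : (realCalculus g).Smooth X) (hY : (realCalculus g).Smooth Y) :
    (complexCalculus g).bracket (complexify X) (complexify Y) =
      complexify ((realCalculus g).bracket X Y) := by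
  have L := realCalculus_isLawful g
  funext x
  apply CTangent.ext
  · rw [rePart_bracket, reField_complexify, reField_complexify, imField_complexify,
      imField_complexify, L.bracket_zero_left L.smooth_zero]
    simp [complexify]
  · rw [imPart_bracket, reField_complexify, reField_complexify, imField_complexify,
      imField_complexify, L.bracket_zero_left hY, L.bracket_zero_right hX]
    simp [complexify]

theorem der_complexify (X : Π x : M, TangentSpace 𝓘(ℝ, E) x) {f : M → ℝ}
    (hf : SmoothFunOn E ℝ Set.univ f) :
    (complexCalculus g).der (complexify X) (castFun f) = castFun ((realCalculus g).der X f) := by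
  have L := realCalculus_isLawful g
  have h1 : reFun (castFun f) = f := by funext x; simp [reFun, castFun]
  have h2 : imFun (castFun f) = 0 := by funext x; simp [imFun, castFun]
  funext x
  apply Complex.ext
  · rw [re_der g (f := castFun f) (smoothFunOn_ofReal hf), reField_complexify, imField_complexify, h1,
      L.der_zero_left]
    simp [castFun]
  · rw [im_der g (f := castFun f) (smoothFunOn_ofReal hf), reField_complexify, imField_complexify, h2,
      L.der_zero_left, L.der_zero]
    simp [castFun]

theorem lineProj_complexify (ζ η X : Π x : M, TangentSpace 𝓘(ℝ, E) x) :
    endo ((complexCalculus g).lineProj (complexify ζ) (complexify η)) (complexify X) =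
      complexify (endo ((realCalculus g).lineProj ζ η) X) := by
  funext x
  change (complexCalculus g).metric x (ofReal x (X x)) (ofReal x (η x)) • ofReal x (ζ x) =
    ofReal x (g.val x (X x) (η x) • ζ x)
  rw [complexMetric_ofReal, map_smul]
  exact Complex.coe_smul _ _

theorem screenProj_complexify (ζ η X : Π x : M, TangentSpace 𝓘(ℝ, E) x) :
    endo ((complexCalculus g).screenProj (complexify ζ) (complexify η)) (complexify X) =
      complexify (endo ((realCalculus g).screenProj ζ η) X) := by
  funext x
  have h1 := congrFun (lineProj_complexify g ζ η X) x
  have h2 := congrFun (lineProj_complexify g η ζ X) x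
  simp only [endo, complexify, screenProj, LinearMap.sub_apply, map_sub, LinearMap.id_apply]
    at h1 h2 ⊢
  rw [← h1, ← h2]

theorem planeProj_complexify (ζ η X : Π x : M, TangentSpace 𝓘(ℝ, E) x) :
    endo ((complexCalculus g).planeProj (complexify ζ) (complexify η)) (complexify X) =
      complexify (endo ((realCalculus g).planeProj ζ η) X) := by
  funext x
  have h1 := congrFun (lineProj_complexify g ζ η X) x
  have h2 := congrFun (lineProj_complexify g η ζ X) x
  simp only [endo, complexify, planeProj, LinearMap.add_apply, map_add] at h1 h2 ⊢
  rw [← h1, ← h2]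

theorem koszulWith_complexify {T X Y Z : Π x : M, TangentSpace 𝓘(ℝ, E) x}
    (hX : (realCalculus g).Smooth X) (hY : (realCalculus g).Smooth Y)
    (hZ : (realCalculus g).Smooth Z) :
    (complexCalculus g).koszulWith (complexify T) (complexify X) (complexify Y) (complexify Z) =
      castFun ((realCalculus g).koszulWith T X Y Z) := by
  have L := realCalculus_isLawful g
  simp only [koszulWith, koszul, pair_complexify, bracket_complexify g hX hY,
    bracket_complexify g hX hZ, bracket_complexify g hY hZ,
    der_complexify g _ (L.smooth_pair hX hY), der_complexify g _ (L.smooth_pair hX hZ),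
    der_complexify g _ (L.smooth_pair hY hZ), castFun_add, castFun_sub]

variable {g} {m : ℕ} {N : Π x : M, Submodule ℂ (CTangent E x)}
  {ξ ξ' : Π x : M, TangentSpace 𝓘(ℝ, E) x}

instance : NeZero (4 : ℝ) := ⟨by norm_num⟩

/-- Metric, bracket, derivative, projections and J all commute with complexification, hence so does
`lichForm`. Pairing with real fields is enough because real vectors span over ℂ. -/
theorem complexLich_complexify (hN : IsAlmostRobinson m g N) (hξ : IsNullFrame g N ξ ξ')
    {X Y : Π x : M, TangentSpace 𝓘(ℝ, E) x} (hX : (realCalculus g).Smooth X)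
    (hY : (realCalculus g).Smooth Y) :
    complexLich g N ξ ξ' (complexify X) (complexify Y) =
      complexify ((realCalculus g).lich ξ ξ' (screenJ g N ξ') X Y) := by
  have L := realCalculus_isLawful g
  have LC := complexCalculus_isLawful g
  have D := realScreenData hN hξ
  have DC := complexScreenData hN hξ
  have s1 := D.smooth_line L
  have s2 := D.smooth_line' L
  have s3 := D.smooth_screen L
  have s5 := D.smooth_J
  have hJ : ∀ X, endo (complexJ g N ξ') (complexify X) = complexify (endo (screenJ g N ξ') X) :=
    fun X => funext fun x => (ofReal_screenJ hN hξ (X x)).symm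
  have c2 : castFun (2 : M → ℝ) = 2 := castFun_ofNat 2
  have key : ∀ Z, (realCalculus g).Smooth Z →
      (complexCalculus g).pair (complexLich g N ξ ξ' (complexify X) (complexify Y)) (complexify Z) =
      (complexCalculus g).pair
        (complexify ((realCalculus g).lich ξ ξ' (screenJ g N ξ') X Y)) (complexify Z) := by
    intro Z hZ
    refine IsScreenData.four_mul_cancel ?_
    rw [complexLich, DC.four_pair_lich LC (complexify_smooth g hX) (complexify_smooth g hY)
      (complexify_smooth g hZ), pair_complexify, ← castFun_ofNat, ← castFun_mul,
      D.four_pair_lich L hX hY hZ]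
    simp only [lichForm, lineProj_complexify, screenProj_complexify, planeProj_complexify, hJ,
      koszulWith_complexify g hX (s1 _ hY) (s2 _ hZ),
      koszulWith_complexify g hX (s2 _ hY) (s1 _ hZ),
      koszulWith_complexify g hX (s3 _ hY) (s3 _ hZ),
      koszulWith_complexify g hX (s5 _ hY) (s5 _ hZ), castFun_add, castFun_mul, c2]
  funext x
  rw [← sub_eq_zero]
  refine LC.nondeg x _ fun w => ?_
  have hr : ∀ v : TangentSpace 𝓘(ℝ, E) x, (complexCalculus g).metric x
      (complexLich g N ξ ξ' (complexify X) (complexify Y) x -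
        complexify ((realCalculus g).lich ξ ξ' (screenJ g N ξ') X Y) x) (ofReal x v) = 0 := by
    intro v
    obtain ⟨Z, hZ, rfl⟩ := L.exists_extension v
    have := congrFun (key Z hZ) x
    rw [map_sub, LinearMap.sub_apply]
    exact sub_eq_zero.mpr this
  rw [re_add_im x w, map_add, map_smul, hr, hr, smul_zero, add_zero]

theorem real_lich_isRealConnection (hN : IsAlmostRobinson m g N) (hξ : IsNullFrame g N ξ ξ') :
    IsRealConnection g ((realCalculus g).lich ξ ξ' (screenJ g N ξ')) where
  smooth := (realScreenData hN hξ).lich_smooth (realCalculus_isLawful g)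
  add_left := (realScreenData hN hξ).lich_add_left (realCalculus_isLawful g)
  add_right := (realScreenData hN hξ).lich_add_right (realCalculus_isLawful g)
  smul_left := (realScreenData hN hξ).lich_smul_left (realCalculus_isLawful g)
  leibniz := (realScreenData hN hξ).lich_leibniz (realCalculus_isLawful g)

theorem lineProj_null (hN : IsAlmostRobinson m g N) (hξ : IsNullFrame g N ξ ξ') {x : M}
    {v : TangentSpace 𝓘(ℝ, E) x} : v ∈ realWitt g N ξ' .R x ↔
      (realCalculus g).lineProj ξ ξ' x v = v := by
  refine (mem_nullLine hN hξ).trans ⟨?_, fun h => ⟨_, h⟩⟩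
  rintro ⟨c, rfl⟩
  rw [map_smul]
  exact congrArg (c • ·) (congrFun ((realScreenData hN hξ).line_left (realCalculus_isLawful g)) x)

theorem lineProj_dual (hN : IsAlmostRobinson m g N) (hξ : IsNullFrame g N ξ ξ') {x : M}
    {v : TangentSpace 𝓘(ℝ, E) x} : v ∈ realWitt g N ξ' .Rdual x ↔
      (realCalculus g).lineProj ξ' ξ x v = v := by
  refine mem_dualLine.trans ⟨?_, fun h => ⟨_, h⟩⟩
  rintro ⟨c, rfl⟩
  rw [map_smul]
  exact congrArg (c • ·) (congrFun ((realScreenData hN hξ).line'_right (realCalculus_isLawful g)) x)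

theorem isOrth_iff_mem_screen (hN : IsAlmostRobinson m g N) (hξ : IsNullFrame g N ξ ξ')
    {X : Π x : M, TangentSpace 𝓘(ℝ, E) x} :
    (realCalculus g).IsOrth ξ ξ' X ↔ ∀ x, X x ∈ screen g N ξ' x :=
  ⟨fun h x => (mem_screen hN hξ).mpr ⟨congrFun h.left x, congrFun h.right x⟩,
    fun h => ⟨funext fun x => ((mem_screen hN hξ).mp (h x)).1,
      funext fun x => ((mem_screen hN hξ).mp (h x)).2⟩⟩

theorem real_lich_isWittOperator (hN : IsAlmostRobinson m g N) (hξ : IsNullFrame g N ξ ξ') :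
    IsWittOperator (realCalculus g) (realWitt g N ξ')
      ((realCalculus g).lich ξ ξ' (screenJ g N ξ')) where
  metric X Y Z hX hY hZ := (realScreenData hN hξ).lich_metric (realCalculus_isLawful g) hX hY hZ
  preserves i X Y hX hY := by
    have L := realCalculus_isLawful g
    have D := realScreenData hN hξ
    refine ⟨D.lich_smooth L hX hY.1, ?_⟩
    cases i with
    | R =>
      have h : endo ((realCalculus g).lineProj ξ ξ') Y = Y :=
        funext fun x => (lineProj_null hN hξ).mp (hY.2 x)
      intro x
      have := congrFun (D.lich_line L hX hY.1) x
      rw [h] at this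
      exact (lineProj_null hN hξ).mpr this.symm
    | Rdual =>
      have h : endo ((realCalculus g).lineProj ξ' ξ) Y = Y :=
        funext fun x => (lineProj_dual hN hξ).mp (hY.2 x)
      intro x
      have := congrFun (D.lich_line' L hX hY.1) x
      rw [h] at this
      exact (lineProj_dual hN hξ).mpr this.symm
    | S =>
      exact (isOrth_iff_mem_screen hN hξ).mp
        (D.isOrth_lich L hX hY.1 ((isOrth_iff_mem_screen hN hξ).mpr hY.2))

/-- Along the screen bundle the component is the orthogonal projection. -/
theorem component_screen (hN : IsAlmostRobinson m g N) (hξ : IsNullFrame g N ξ ξ') {x : M}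
    (v : TangentSpace 𝓘(ℝ, E) x) :
    component (realWitt g N ξ') .S x v = (realCalculus g).screenProj ξ ξ' x v := by
  have h := realWitt_isInternal hN hξ x
  have D := realScreenData hN hξ
  have L := realCalculus_isLawful g
  have e : v = (realCalculus g).screenProj ξ ξ' x v + (realCalculus g).lineProj ξ ξ' x v
      + (realCalculus g).lineProj ξ' ξ x v := by
    simp only [screenProj, LinearMap.sub_apply, LinearMap.id_apply]
    abel
  obtain ⟨X, hX, rfl⟩ := L.exists_extension v
  have m1 : (realCalculus g).screenProj ξ ξ' x (X x) ∈ realWitt g N ξ' .S x :=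
    (isOrth_iff_mem_screen hN hξ).mp (D.isOrth_screen L X) x
  have m2 : (realCalculus g).lineProj ξ ξ' x (X x) ∈ realWitt g N ξ' .R x :=
    (mem_nullLine hN hξ).mpr ⟨_, rfl⟩
  have m3 : (realCalculus g).lineProj ξ' ξ x (X x) ∈ realWitt g N ξ' .Rdual x :=
    mem_dualLine.mpr ⟨_, rfl⟩
  conv_lhs => rw [e]
  rw [map_add, map_add, component_of_mem h m1, component_of_mem_ne h (by decide) m2,
    component_of_mem_ne h (by decide) m3, add_zero, add_zero]

theorem screenPart_eq (hN : IsAlmostRobinson m g N) (hξ : IsNullFrame g N ξ ξ')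
    (X : Π x : M, TangentSpace 𝓘(ℝ, E) x) :
    screenPart g N ξ' X = endo ((realCalculus g).screenProj ξ ξ') X :=
  funext fun x => component_screen hN hξ (X x)

end Complexification


/-! ### The torsion formulas as identities of sections. -/

section TorsionFormulas

namespace Calculus

variable {𝕜 : Type*} [Field 𝕜] {M : Type*} [TopologicalSpace M] {W : M → Type*}
  [∀ x, AddCommGroup (W x)] [∀ x, Module 𝕜 (W x)]
  {C : Calculus 𝕜 M W} {F : Set M → (M → 𝕜) → Prop}

namespace IsForm

variable (L : C.IsLawful F) {α : (Π x, W x) → M → 𝕜} (H : C.IsForm F α)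
include L H

theorem neg : C.IsForm F (fun Z => -α Z) where
  smooth hZ := L.fun_neg (H.smooth hZ)
  add hY hZ := by rw [H.add hY hZ]; ring
  smul hf hZ := by rw [H.smul hf hZ]; ring

theorem sub' {β : (Π x, W x) → M → 𝕜} (K : C.IsForm F β) : C.IsForm F (fun Z => α Z - β Z) where
  smooth hZ := L.fun_sub (H.smooth hZ) (K.smooth hZ)
  add hY hZ := by rw [H.add hY hZ, K.add hY hZ]; ring
  smul hf hZ := by rw [H.smul hf hZ, K.smul hf hZ]; ring

omit L in
theorem comp_endo {A : Π x, W x →ₗ[𝕜] W x} (hA : ∀ X, C.Smooth X → C.Smooth (endo A X)) :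
    C.IsForm F (fun Z => α (endo A Z)) where
  smooth hZ := H.smooth (hA _ hZ)
  add {Y Z} hY hZ := by
    rw [← H.add (hA _ hY) (hA _ hZ)]
    exact congrArg α (endo_add A Y Z)
  smul hf hZ := by
    rw [← H.smul hf (hA _ hZ), endo_smul]

theorem zero_apply : α 0 = 0 := by
  have := H.smul (L.fun_const _ 0) L.smooth_zero
  simp only [zero_smul] at this
  change α 0 = _ at this
  rw [this]
  funext x
  simp

end IsForm

namespace IsScreenData

variable (L : C.IsLawful F)
  {ξ ξ' : Π x, W x} {J : Π x, W x →ₗ[𝕜] W x} (D : C.IsScreenData ξ ξ' J)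
include L D

theorem isForm_lie₂_fundForm {X A : Π x, W x} (hX : C.Smooth X) (hA : C.Smooth A) :
    C.IsForm F (C.lie₂ X (C.fundForm J) A) := by
  have jA := D.smooth_J _ hA
  have hB := L.bracket_smooth hX hA
  refine ⟨fun {Z} hZ => ?_, fun {Y Z} hY hZ => ?_, fun {f Z} hf hZ => ?_⟩
  · exact L.fun_sub (L.fun_sub (L.der_smooth hX (L.smooth_pair jA hZ))
      (L.smooth_pair (D.smooth_J _ hB) hZ)) (L.smooth_pair jA (L.bracket_smooth hX hZ))
  · change C.lie₂ X (C.fundForm J) A (Y + Z) = _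
    simp only [lie₂, fundForm, pair_add_right, L.bracket_add_right hX hY hZ,
      L.der_add _ (L.smooth_pair jA hY) (L.smooth_pair jA hZ)]
    ring
  · simp only [lie₂, fundForm, pair_smul_right, L.der_mul _ hf (L.smooth_pair jA hZ),
      L.pair_comm (endo J A) (C.bracket X fun x => f x • Z x), L.pair_bracket_smul_right hX hZ hf,
      L.pair_comm Z (endo J A), L.pair_comm (endo J A) (C.bracket X Z)]
    ring

/-- Tensoriality in the last slot is what makes `sharp` meaningful in the torsion formula. -/
theorem isForm_d₂_fundForm {A B : Π x, W x} (hA : C.Smooth A) (hB : C.Smooth B) :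
    C.IsForm F (C.d₂ (C.fundForm J) A B) := by
  have jA := D.smooth_J _ hA
  have jB := D.smooth_J _ hB
  have hAB := L.bracket_smooth hA hB
  refine ⟨fun {Z} hZ => ?_, fun {Y Z} hY hZ => ?_, fun {f Z} hf hZ => ?_⟩
  · refine L.fun_sub (L.fun_add (L.fun_sub (L.fun_add (L.fun_sub ?_ ?_) ?_) ?_) ?_) ?_
    · exact L.der_smooth hA (L.smooth_pair jB hZ)
    · exact L.der_smooth hB (L.smooth_pair jA hZ)
    · exact L.der_smooth hZ (L.smooth_pair jA hB)
    · exact L.smooth_pair (D.smooth_J _ hAB) hZ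
    · exact L.smooth_pair (D.smooth_J _ (L.bracket_smooth hA hZ)) hB
    · exact L.smooth_pair (D.smooth_J _ (L.bracket_smooth hB hZ)) hA
  · change C.d₂ (C.fundForm J) A B (Y + Z) = _
    simp only [d₂, fundForm, pair_add_right, pair_add_left, endo_add, L.der_add',
      L.bracket_add_right hA hY hZ, L.bracket_add_right hB hY hZ,
      L.der_add _ (L.smooth_pair jA hY) (L.smooth_pair jA hZ),
      L.der_add _ (L.smooth_pair jB hY) (L.smooth_pair jB hZ)]
    ring
  · simp only [d₂, fundForm, pair_smul_right, endo_smul, L.der_smul_left,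
      D.adjoint_J (C.bracket _ _),
      L.der_mul _ hf (L.smooth_pair jA hZ), L.der_mul _ hf (L.smooth_pair jB hZ),
      L.pair_bracket_smul_right hA hZ hf, L.pair_bracket_smul_right hB hZ hf,
      L.pair_comm Z (endo J _)]
    ring

variable [NeZero (4 : 𝕜)]

omit L D in
theorem one_fourth_mul : ((1 / 4 : 𝕜) * 4 = 1) := by
  rw [one_div, inv_mul_cancel₀ (NeZero.ne _)]

omit L D in
theorem one_half_mul : ((1 / 2 : 𝕜) * 2 = 1) := by
  have h : (2 : 𝕜) ≠ 0 := fun h => NeZero.ne (4 : 𝕜) (by linear_combination (2 : 𝕜) * h)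
  rw [one_div, inv_mul_cancel₀ h]

theorem J_null : endo J ξ = 0 := funext D.J_left

theorem J_dual : endo J ξ' = 0 := funext D.J_right

omit D in
theorem d₁_flat_of_isOrth (ζ : Π x, W x) {X Y : Π x, W x}
    (hX : C.pair X ζ = 0) (hY : C.pair Y ζ = 0) :
    C.d₁ (C.flat ζ) X Y = -C.pair (C.bracket X Y) ζ := by
  simp only [d₁, flat, L.pair_comm ζ, hX, hY, L.der_zero]
  ring

/-- Against ξ and ξ' the connection drops out because S is parallel, the `sharp` term vanishes
because its form factors through J, and the bracket gives the dσ terms. Against screen sections this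
is `four_pair_torsion_screen`. -/
theorem torsion_screen_screen {X Y : Π x, W x} (hX : C.Smooth X) (hY : C.Smooth Y)
    (oX : C.IsOrth ξ ξ' X) (oY : C.IsOrth ξ ξ' Y) (x : M) :
    C.torsion (C.lich ξ ξ' J) X Y x =
      -(1 / 4 : 𝕜) • (endo (C.screenProj ξ ξ') (C.bracket X Y - C.bracket (endo J X) (endo J Y))
          + endo J (C.bracket (endo J X) Y) + endo J (C.bracket X (endo J Y))) x
        - (1 / 4 : 𝕜) • C.sharp (fun Z => -C.d₂ (C.fundForm J) (endo J X) (endo J Y) (endo J Z)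
          + -C.d₂ (C.fundForm J) (endo J (endo J X)) (endo J (endo J Y)) (endo J Z)) x
        + C.d₁ (C.flat ξ') X Y x • ξ x + C.d₁ (C.flat ξ) X Y x • ξ' x := by
  have jX := D.smooth_J _ hX
  have jY := D.smooth_J _ hY
  have F1 := (D.isForm_d₂_fundForm L jX jY).comp_endo D.smooth_J
  have F2 := (D.isForm_d₂_fundForm L (D.smooth_J _ jX) (D.smooth_J _ jY)).comp_endo D.smooth_J
  have Fs : C.IsForm F (fun Z => -C.d₂ (C.fundForm J) (endo J X) (endo J Y) (endo J Z)
      + -C.d₂ (C.fundForm J) (endo J (endo J X)) (endo J (endo J Y)) (endo J Z)) :=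
    (F1.neg L).add' L (F2.neg L)
  have hs := (L.sharp_spec Fs).2
  set Q := C.sharp (fun Z => -C.d₂ (C.fundForm J) (endo J X) (endo J Y) (endo J Z)
          + -C.d₂ (C.fundForm J) (endo J (endo J X)) (endo J (endo J Y)) (endo J Z))
  set P := endo (C.screenProj ξ ξ') (C.bracket X Y - C.bracket (endo J X) (endo J Y))
          + endo J (C.bracket (endo J X) Y) + endo J (C.bracket X (endo J Y)) with hP
  have z1 := (D.isForm_d₂_fundForm L jX jY).zero_apply L
  have z2 := (D.isForm_d₂_fundForm L (D.smooth_J _ jX) (D.smooth_J _ jY)).zero_apply L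
  have hpair : ∀ Z, C.pair (fun x => -(1 / 4 : 𝕜) • P x - (1 / 4 : 𝕜) • Q x
        + C.d₁ (C.flat ξ') X Y x • ξ x + C.d₁ (C.flat ξ) X Y x • ξ' x) Z =
      -(fun _ => (1 / 4 : 𝕜)) * C.pair P Z - (fun _ => (1 / 4 : 𝕜)) * C.pair Q Z
        - C.pair (C.bracket X Y) ξ' * C.pair ξ Z - C.pair (C.bracket X Y) ξ * C.pair ξ' Z := by
    intro Z
    rw [d₁_flat_of_isOrth L ξ oX.left oY.left, d₁_flat_of_isOrth L ξ' oX.right oY.right]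
    funext x
    simp [pair]
    ring
  have hXY := D.isOrth_lich L hX hY oY
  have hYX := D.isOrth_lich L hY hX oX
  refine congrFun (D.ext_of_pair_frame L (A := C.torsion (C.lich ξ ξ' J) X Y)
    (B := fun x => -(1 / 4 : 𝕜) • P x - (1 / 4 : 𝕜) • Q x
        + C.d₁ (C.flat ξ') X Y x • ξ x + C.d₁ (C.flat ξ) X Y x • ξ' x) ?_ ?_ fun Z hZ oZ => ?_) x
  · have e1 : C.pair P ξ = 0 := by
      simp only [hP, pair_add_left, (D.isOrth_J L _).left, (D.isOrth_screen L _).left, add_zero]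
    have e2 : C.pair Q ξ = 0 := by rw [hs ξ D.smooth, D.J_null L, z1, z2, neg_zero, add_zero]
    have e3 : C.pair ξ ξ = 0 := funext D.null
    have e4 : C.pair ξ' ξ = 1 := funext (D.dual' L)
    rw [hpair, pair_torsion, hXY.left, hYX.left, e1, e2, e3, e4]
    ring
  · have e1 : C.pair P ξ' = 0 := by
      simp only [hP, pair_add_left, (D.isOrth_J L _).right, (D.isOrth_screen L _).right, add_zero]
    have e2 : C.pair Q ξ' = 0 := by rw [hs ξ' D.smooth', D.J_dual L, z1, z2, neg_zero, add_zero]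
    have e3 : C.pair ξ' ξ' = 0 := funext D.null'
    have e4 : C.pair ξ ξ' = 1 := funext D.dual
    rw [hpair, pair_torsion, hXY.right, hYX.right, e1, e2, e3, e4]
    ring
  · have h4 := D.four_pair_torsion_screen L hX hY hZ oX oY oZ
    have hc : (fun _ => (1 / 4 : 𝕜)) * (4 : M → 𝕜) = 1 := funext fun _ => one_fourth_mul
    rw [hpair, hs Z hZ, L.pair_comm ξ, L.pair_comm ξ', oZ.left, oZ.right]
    linear_combination (fun _ => (1 / 4 : 𝕜)) * h4
      - C.pair (C.torsion (C.lich ξ ξ' J) X Y) Z * hc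

/-- Pairing with ξ yields the dσ* term, pairing with ξ' the Lie derivative of g, and pairing with
the screen τ_S and the Lie derivative of ω. The last `sharp` has to be projected to S, since its
form need not vanish on ξ'. -/
theorem torsion_null_screen {X : Π x, W x} (hX : C.Smooth X) (oX : C.IsOrth ξ ξ' X) (x : M) :
    C.torsion (C.lich ξ ξ' J) ξ X x =
      C.d₁ (C.flat ξ) ξ X x • ξ' x - (1 / 2 : 𝕜) • C.lie₂ X C.pair ξ ξ' x • ξ x
        + (2⁻¹ : 𝕜) • (C.screenProj ξ ξ' x (C.sharp (C.lie₁ ξ (C.flat X)) x)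
          - C.screenProj ξ ξ' x (C.bracket ξ X x))
        + (1 / 4 : 𝕜) • endo (C.screenProj ξ ξ') (C.sharp fun Z =>
          C.lie₂ ξ (C.fundForm J) (endo J X) Z
            - C.lie₂ ξ (C.fundForm J) (endo J (endo J X)) (endo J Z)) x := by
  have jX := D.smooth_J _ hX
  have Fs := (D.isForm_lie₂_fundForm L D.smooth jX).sub' L
    ((D.isForm_lie₂_fundForm L D.smooth (D.smooth_J _ jX)).comp_endo D.smooth_J)
  have hs := (L.sharp_spec Fs).2
  have ht := (L.sharp_spec (L.isForm_lie₁_flat D.smooth hX)).2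
  set Q := C.sharp fun Z => C.lie₂ ξ (C.fundForm J) (endo J X) Z
            - C.lie₂ ξ (C.fundForm J) (endo J (endo J X)) (endo J Z)
  set P := C.sharp (C.lie₁ ξ (C.flat X))
  have hpair : ∀ Z, C.pair (fun x => C.d₁ (C.flat ξ) ξ X x • ξ' x
        - (1 / 2 : 𝕜) • C.lie₂ X C.pair ξ ξ' x • ξ x
        + (2⁻¹ : 𝕜) • (C.screenProj ξ ξ' x (P x) - C.screenProj ξ ξ' x (C.bracket ξ X x))
        + (1 / 4 : 𝕜) • endo (C.screenProj ξ ξ') Q x) Z =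
      -C.pair (C.bracket ξ X) ξ * C.pair ξ' Z
        - (fun _ => (1 / 2 : 𝕜)) * C.lie₂ X C.pair ξ ξ' * C.pair ξ Z
        + (fun _ => (1 / 2 : 𝕜)) * (C.pair (endo (C.screenProj ξ ξ') P) Z
          - C.pair (endo (C.screenProj ξ ξ') (C.bracket ξ X)) Z)
        + (fun _ => (1 / 4 : 𝕜)) * C.pair (endo (C.screenProj ξ ξ') Q) Z := by
    intro Z
    rw [d₁_flat_of_isOrth L ξ (funext D.null) oX.left]
    funext x
    simp [pair, endo]
    ring
  have hc2 : (fun _ => (1 / 2 : 𝕜)) * (2 : M → 𝕜) = 1 := funext fun _ => one_half_mul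
  refine congrFun (D.ext_of_pair_frame L (A := C.torsion (C.lich ξ ξ' J) ξ X)
    (B := fun x => C.d₁ (C.flat ξ) ξ X x • ξ' x
        - (1 / 2 : 𝕜) • C.lie₂ X C.pair ξ ξ' x • ξ x
        + (2⁻¹ : 𝕜) • (C.screenProj ξ ξ' x (P x) - C.screenProj ξ ξ' x (C.bracket ξ X x))
        + (1 / 4 : 𝕜) • endo (C.screenProj ξ ξ') Q x) ?_ ?_ fun Z hZ oZ => ?_) x
  · have e3 : C.pair ξ ξ = 0 := funext D.null
    have e4 : C.pair ξ' ξ = 1 := funext (D.dual' L)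
    rw [hpair, D.pair_torsion_null_left L hX oX, (D.isOrth_screen L _).left,
      (D.isOrth_screen L _).left, (D.isOrth_screen L _).left, e3, e4]
    ring
  · have e3 : C.pair ξ' ξ' = 0 := funext D.null'
    have e4 : C.pair ξ ξ' = 1 := funext D.dual
    have h2 := D.two_pair_torsion_null_right L hX oX
    rw [hpair, (D.isOrth_screen L _).right, (D.isOrth_screen L _).right,
      (D.isOrth_screen L _).right, e3, e4]
    linear_combination (fun _ => (1 / 2 : 𝕜)) * h2
      - C.pair (C.torsion (C.lich ξ ξ' J) ξ X) ξ' * hc2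
  · have hl : endo (C.planeProj ξ ξ') ξ = ξ := by
      funext x; simp [endo, planeProj, lineProj, D.null, D.dual]
    have h4 := D.four_pair_torsion_null L D.smooth hX hZ hl oX oZ
      (D.pair_lich_left L hX (by rw [L.pair_comm, oZ.left]))
    have hc : (fun _ => (1 / 4 : 𝕜)) * (4 : M → 𝕜) = 1 := funext fun _ => one_fourth_mul
    rw [hpair, D.adjoint_screen L, D.adjoint_screen L, D.adjoint_screen L, oZ.screen, ht Z hZ,
      hs Z hZ, L.pair_comm ξ, L.pair_comm ξ', oZ.left, oZ.right]
    have hcc : (fun _ => (1 / 4 : 𝕜)) * (2 : M → 𝕜) = fun _ => (1 / 2 : 𝕜) := by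
      linear_combination (-(fun _ => (1 / 4 : 𝕜)) * (2 : M → 𝕜)) * hc2
        + (fun _ => (1 / 2 : 𝕜)) * hc
    linear_combination (fun _ => (1 / 4 : 𝕜)) * h4
      - C.pair (C.torsion (C.lich ξ ξ' J) ξ X) Z * hc
      + (C.lie₁ ξ (C.flat X) Z - C.pair (C.bracket ξ X) Z) * hcc

theorem torsion_null_dual (x : M) : C.torsion (C.lich ξ ξ' J) ξ ξ' x =
    -endo (C.screenProj ξ ξ') (C.bracket ξ ξ') x := by
  refine congrFun (D.ext_of_pair_frame L (A := C.torsion (C.lich ξ ξ' J) ξ ξ')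
    (B := -endo (C.screenProj ξ ξ') (C.bracket ξ ξ')) ?_ ?_ fun Z hZ oZ => ?_) x
  · rw [D.pair_torsion_null_dual_left L, pair_neg_left, (D.isOrth_screen L _).left, neg_zero]
  · rw [D.pair_torsion_null_dual_right L, pair_neg_left, (D.isOrth_screen L _).right, neg_zero]
  · rw [D.pair_torsion_null_dual_screen L oZ, pair_neg_left, D.adjoint_screen L, oZ.screen]

end IsScreenData
end Calculus
end TorsionFormulas


/-! ### Parallel ω and torsion of the Lichnerowicz connection. -/

section Lichnerowicz

open Calculus

variable {E : Type*} [NormedAddCommGroup E] [NormedSpace ℝ E] [FiniteDimensional ℝ E]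
  [CompleteSpace E]
  {M : Type*} [TopologicalSpace M] [ChartedSpace E M] [IsManifold 𝓘(ℝ, E) ∞ M] [T2Space M]
  {g : PseudoMetric E M} {m : ℕ} {N : Π x : M, Submodule ℂ (CTangent E x)}
  {ξ ξ' : Π x : M, TangentSpace 𝓘(ℝ, E) x}

theorem torsion_apply (g : PseudoMetric E M)
    (cov : CovariantDerivative 𝓘(ℝ, E) E (fun x : M => TangentSpace 𝓘(ℝ, E) x))
    {X Y : Π x : M, TangentSpace 𝓘(ℝ, E) x} (hX : (realCalculus g).Smooth X)
    (hY : (realCalculus g).Smooth Y) (x : M) :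
    cov.torsion x (X x) (Y x) = (realCalculus g).torsion (covOperator cov) X Y x :=
  cov.torsion_apply (SmoothFieldOn.mdifferentiableAt hX x) (SmoothFieldOn.mdifferentiableAt hY x)

theorem lich_fundForm_parallel (hN : IsAlmostRobinson m g N) (hξ : IsNullFrame g N ξ ξ')
    {X Y Z : Π x : M, TangentSpace 𝓘(ℝ, E) x} (hX : (realCalculus g).Smooth X)
    (hY : (realCalculus g).Smooth Y) (hZ : (realCalculus g).Smooth Z) :
    (realCalculus g).der X (omega g N ξ' Y Z)
      - omega g N ξ' ((realCalculus g).lich ξ ξ' (screenJ g N ξ') X Y) Z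
      - omega g N ξ' Y ((realCalculus g).lich ξ ξ' (screenJ g N ξ') X Z) = 0 := by
  have L := realCalculus_isLawful g
  have D := realScreenData hN hξ
  change (realCalculus g).der X ((realCalculus g).pair (endo (screenJ g N ξ') Y) Z)
    - (realCalculus g).pair (endo (screenJ g N ξ') _) Z
    - (realCalculus g).pair (endo (screenJ g N ξ') Y) _ = 0
  rw [D.lich_metric L hX (D.smooth_J _ hY) hZ, D.lich_J L hX hY]
  abel

theorem hasLichnerowiczTorsion (hN : IsAlmostRobinson m g N) (hξ : IsNullFrame g N ξ ξ')
    {cov : CovariantDerivative 𝓘(ℝ, E) E (fun x : M => TangentSpace 𝓘(ℝ, E) x)}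
    (h : ∀ X Y, (realCalculus g).Smooth X → (realCalculus g).Smooth Y →
      covOperator cov X Y = (realCalculus g).lich ξ ξ' (screenJ g N ξ') X Y) :
    HasLichnerowiczTorsion g N ξ ξ' (fun x => cov.torsion x) := by
  have L := realCalculus_isLawful g
  have D := realScreenData hN hξ
  have ht : ∀ {X Y : Π x : M, TangentSpace 𝓘(ℝ, E) x}, (realCalculus g).Smooth X →
      (realCalculus g).Smooth Y → ∀ x, cov.torsion x (X x) (Y x) =
        (realCalculus g).torsion ((realCalculus g).lich ξ ξ' (screenJ g N ξ')) X Y x := by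
    intro X Y hX hY x
    rw [torsion_apply g cov hX hY, Calculus.torsion, Calculus.torsion, h X Y hX hY, h Y X hY hX]
  have ho := fun {X} => isOrth_iff_mem_screen hN hξ (X := X)
  refine ⟨fun X Y hX hY x => ?_, fun X hX x => ?_, fun X hX x => ?_, fun x => ?_⟩
  · rw [ht hX.1 hY.1, D.torsion_screen_screen L hX.1 hY.1 (ho.mpr hX.2) (ho.mpr hY.2), nijenhuis,
      screenPart_eq hN hξ]
    rfl
  · rw [ht hξ.smooth hX.1, D.torsion_null_screen L hX.1 (ho.mpr hX.2),
      tau_of_not_dual (by decide) (by decide), component_screen hN hξ, component_screen hN hξ,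
      screenPart_eq hN hξ]
    rfl
  -- This is the previous formula with ξ and ξ' exchanged, up to the symmetry of the Lie derivative
  -- of g in its two arguments.
  · rw [ht hξ.smooth' hX.1, ← IsScreenData.lich_swap,
      (D.swap L).torsion_null_screen L hX.1 ⟨(ho.mpr hX.2).right, (ho.mpr hX.2).left⟩,
      tau_of_not_dual (by decide) (by decide), component_screen hN hξ, component_screen hN hξ,
      screenPart_eq hN hξ, IsScreenData.screenProj_swap]
    have e : (realCalculus g).lie₂ X (realCalculus g).pair ξ' ξ =
        (realCalculus g).lie₂ X (realCalculus g).pair ξ ξ' := by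
      simp only [lie₂]
      rw [L.pair_comm ξ' ξ, L.pair_comm _ ξ, L.pair_comm ξ' _]
      ring
    rw [e]
    rfl
  · rw [ht hξ.smooth hξ.smooth', D.torsion_null_dual L, screenPart_eq hN hξ]

end Lichnerowicz

end WittGeometry

end



/-! ### Assembly of the theorem. -/

theorem proposition6p1 {E : Type*} [NormedAddCommGroup E] [NormedSpace ℝ E]
    [FiniteDimensional ℝ E] [CompleteSpace E]
    {M : Type*} [TopologicalSpace M] [ChartedSpace E M] [IsManifold 𝓘(ℝ, E) ∞ M]
    [T2Space M] [SigmaCompactSpace M]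
    (m : ℕ) (g : PseudoMetric E M) (N : Π x : M, Submodule ℂ (CTangent E x))
    (hN : IsAlmostRobinson m g N)
    (ξ ξ' : Π x : M, TangentSpace 𝓘(ℝ, E) x) (hξ : IsNullFrame g N ξ ξ') :
    -- the real and the complex Witt structure, and the Hermitian structure on the screen bundle
    IsWittStructure (realCalculus g) RealIndex.star (realWitt g N ξ') (RealIndex.rank m) ∧
    IsWittStructure (complexCalculus g) ComplexIndex.star (complexWitt g N ξ')
      (ComplexIndex.rank m) ∧
    IsScreenHermitian g N ξ ξ' ∧
    -- the canonical Witt connection of the complex Witt structure exists and is unique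
    ∃ nabC : (Π x : M, CTangent E x) → (Π x : M, CTangent E x) → Π x : M, CTangent E x,
      IsCanonicalComplexWitt g N ξ' nabC ∧
      (∀ nab', IsCanonicalComplexWitt g N ξ' nab' →
        ∀ X Y, (complexCalculus g).Smooth X → (complexCalculus g).Smooth Y →
          nab' X Y = nabC X Y) ∧
      -- it restricts to a smooth connection on the tangent bundle
      ∃ cov : CovariantDerivative 𝓘(ℝ, E) E (fun x : M => TangentSpace 𝓘(ℝ, E) x),
        CovariantDerivative.ContMDiffCovariantDerivative cov ∞ ∧
        (∀ X Y, (realCalculus g).Smooth X → (realCalculus g).Smooth Y →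
          nabC (complexify X) (complexify Y) = complexify (covOperator cov X Y)) ∧
        -- which is a Witt connection,
        IsWittOperator (realCalculus g) (realWitt g N ξ') (covOperator cov) ∧
        -- for which `J` and `ω` are parallel,
        (∀ X Y, (realCalculus g).Smooth X → (realCalculus g).Smooth Y →
          covOperator cov X (fieldJ g N ξ' Y) - fieldJ g N ξ' (covOperator cov X Y) = 0) ∧
        (∀ X Y Z, (realCalculus g).Smooth X → (realCalculus g).Smooth Y →
          (realCalculus g).Smooth Z →
          (realCalculus g).der X (omega g N ξ' Y Z) - omega g N ξ' (covOperator cov X Y) Z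
            - omega g N ξ' Y (covOperator cov X Z) = 0) ∧
        -- and whose torsion is given by the formulas
        HasLichnerowiczTorsion g N ξ ξ' (fun x => cov.torsion x) := by
  have D := realScreenData hN hξ
  have L := realCalculus_isLawful g
  have H := real_lich_isRealConnection hN hξ
  obtain ⟨cov, hcov⟩ := H.exists_covariantDerivative
  have W := real_lich_isWittOperator hN hξ
  refine ⟨isWittStructure_real hN hξ, isWittStructure_complex hN hξ, isScreenHermitian hN hξ,
    complexLich g N ξ ξ', complexLich_isCanonical hN hξ,
    fun nab' h X Y hX hY => h.unique hN hξ (complexLich_isCanonical hN hξ) hX hY, cov,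
    contMDiffCovariantDerivative_of_smooth g fun X Y hX hY => ?_, fun X Y hX hY => ?_,
    ⟨fun X Y Z hX hY hZ => ?_, fun i X Y hX hY => ?_⟩, fun X Y hX hY => ?_,
    fun X Y Z hX hY hZ => ?_, hasLichnerowiczTorsion hN hξ hcov⟩
  · rw [hcov X Y hX hY]
    exact H.smooth hX hY
  · rw [hcov X Y hX hY]
    exact complexLich_complexify hN hξ hX hY
  · rw [hcov X Y hX hY, hcov X Z hX hZ]
    exact W.metric X Y Z hX hY hZ
  · rw [hcov X Y hX hY.1]
    exact W.preserves i X Y hX hY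
  · rw [hcov X Y hX hY, hcov X (fieldJ g N ξ' Y) hX (D.smooth_J Y hY), sub_eq_zero]
    exact D.lich_J L hX hY
  · rw [hcov X Y hX hY, hcov X Z hX hZ]
    exact lich_fundForm_parallel hN hξ hX hY hZ
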